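/- **Theorem 3.5.** For every finite input alphabet, $$\mathsf{oneway\mbox{-}IP}(\text{cons-space},\text{cons-random-bits})=\mathsf{NL}=\mathsf{IP}_w(\text{log-space},\text{cons-random-bits}).$$ The classes are defined as follows. *Verifiers.* A verifier $V$ is a probabilistic Turing machine with a read-only two-way input tape, holding the input $x$ between two end-markers (the input head starts on the left one and never leaves the part of the tape between the end-markers, these included), one two-way read/write work tape, and a communication cell over a finite alphabet $\Gamma$ containing a null symbol $\epsilon$. Its finite state set consists of coin-tossing states, deterministic states, an accepting and a rejecting halting state, and each state $q$ carries a symbol $\gamma_q\in\Gamma$; the start state is not halting. In a non-halting state $q$ with $\gamma_q\ne\epsilon$ the verifier sends $\gamma_q$ to the prover and receives a symbol of $\Gamma$ in response; if $\gamma_q=\epsilon$ there is no communication. The next state, the symbol written on the work tape and the head movements (each in $\{-1,0,+1\}$) are determined by the state, the two scanned tape symbols, the received symbol (if any) and, in a coin-tossing state, a fresh fair random bit, which the prover does not see. *Provers.* A prover is an arbitrary function giving each response from the input string and the entire communication so far. A one-way prover is one that maps each input string to a sequence over $\Gamma$ and gives the $i$-th symbol of this sequence at the $i$-th communication step, whatever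 the verifier sends. *Proof systems.* A language $L$ has a (strong) interactive proof system with error $\varepsilon$ and verifier $V$ if (1) there is a prover $P$ such that for all $x\in L$ the interaction of $P$ and $V$ on $x$ results in acceptance with probability at least $1-\varepsilon$, and (2) for all $x\notin L$ and all provers $P^*$ the interaction of $P^*$ and $V$ on $x$ results in rejection with probability at least $1-\varepsilon$. It has a weak interactive proof system if (2) is replaced by (2′): for all $x\notin L$ and all provers $P^*$ the interaction results in acceptance with probability at most $\varepsilon$. In one-way proof systems all provers, in (1) and in (2), are one-way. *Classes.* $\mathsf{oneway\mbox{-}IP}(\text{cons-space},\text{cons-random-bits})$ is the class of languages that have, for some $\varepsilon<\frac12$, a strong one-way interactive proof system with error $\varepsilon$ whose verifier visits $O(1)$ work tape cells and tosses $O(1)$ coins; $\mathsf{IP}_w(\text{log-space},\text{cons-random-bits})$ is the class of languages that have, for some $\varepsilon<\frac12$, a weak interactive proof system (with arbitrary provers) with error $\varepsilon$ whose verifier visits $O(\log n)$ work tape cells and tosses $O(1)$ coins. These bounds are functions of the input length $n$ and hold in the worst case, over all inputs, all provers (one-way ones in the first class) and all coin outcomes; no bound on the running time is imposed. $\mathsf{NL}$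 is the class of languages recognized by nondeterministic Turing machines with a read-only two-way input tape and finitely many work tapes, all of whose computations on inputs of length $n$ visit $O(\log n)$ work tape cells. -/

import Mathlib

open MeasureTheory Filter Asymptotics

/-! ### Resource bounds -/

/-- Functions that are `O(1)`. -/
def consBound : Set (ℕ → ℕ) :=
  {f | (fun n => (f n : ℝ)) =O[atTop] (fun _ => (1 : ℝ))}

/-- Functions that are `O(log n)`. -/
def logBound : Set (ℕ → ℕ) :=
  {f | (fun n => (f n : ℝ)) =O[atTop] (fun n => Real.log (n : ℝ))}

/-! ### Tapes -/

/-- The symbol at position `p` of the input tape holding `x`: the input occupies the positions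
`1, …, |x|`, and the positions `0` and `|x| + 1` hold the end-marker `none`. -/
def inputSymbol {α : Type} (x : List α) (p : ℤ) : Option α :=
  if p ≤ 0 then none else x[p.toNat - 1]?

/-- The number of distinct cells on which a head has been at the times `0, …, t`. -/
def cellsVisited (head : ℕ → ℤ) (t : ℕ) : ℕ :=
  ((Finset.range (t + 1)).image head).card

/-! ### Nondeterministic Turing machines and `NL` -/

/-- A nondeterministic Turing machine with a read-only two-way input tape and `k` two-way
infinite work tapes.  Head movements are elements of `{-1, 0, 1}`. -/
structure NTM (α : Type) where
  State : Type
  Work : Type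
  finState : Finite State
  finWork : Finite Work
  k : ℕ
  start : State
  accept : State
  blank : Work
  /-- The possible moves: new state, written symbols, input head move, work head moves. -/
  δ : State → Option α → (Fin k → Work) →
    Set (State × (Fin k → Work) × SignType × (Fin k → SignType))

namespace NTM

variable {α : Type} (M : NTM α)

structure Config where
  state : M.State
  inputPos : ℤ
  work : Fin M.k → ℤ → M.Work
  workPos : Fin M.k → ℤ

def init : M.Config where
  state := M.start
  inputPos := 0
  work := fun _ _ => M.blank
  workPos := fun _ => 0

/-- One computation step on input `x`; the accepting state is halting. -/
def Step (x : List α) (c c' : M.Config) : Prop :=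
  c.state ≠ M.accept ∧
    ∃ m ∈ M.δ c.state (inputSymbol x c.inputPos) (fun i => c.work i (c.workPos i)),
      c' = { state := m.1
             inputPos := c.inputPos + (m.2.2.1 : ℤ)
             work := fun i => Function.update (c.work i) (c.workPos i) (m.2.1 i)
             workPos := fun i => c.workPos i + (m.2.2.2 i : ℤ) }

/-- `c 0, …, c t` is a computation of `M` on `x` (the values of `c` beyond `t` are irrelevant). -/
def IsComputation (x : List α) (c : ℕ → M.Config) (t : ℕ) : Prop :=
  c 0 = M.init ∧ ∀ i < t, M.Step x (c i) (c (i + 1))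

/-- The input head never leaves the part of the tape delimited by the end-markers. -/
def StaysOnInput : Prop :=
  ∀ x c t, M.IsComputation x c t →
    0 ≤ (c t).inputPos ∧ (c t).inputPos ≤ (x.length : ℤ) + 1

/-- On inputs of length `n`, every computation visits at most `s n` work tape cells in total. -/
def SpaceBound (s : ℕ → ℕ) : Prop :=
  ∀ x c t, M.IsComputation x c t →
    ∑ j : Fin M.k, cellsVisited (fun i => (c i).workPos j) t ≤ s x.length

def Accepts (x : List α) : Prop :=
  ∃ c t, M.IsComputation x c t ∧ (c t).state = M.accept

end NTM

/-- Languages recognized by nondeterministic Turing machines in logarithmic space. -/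
def NL (α : Type) : Set (Language α) :=
  {L | ∃ M : NTM α, M.StaysOnInput ∧ (∃ s ∈ logBound, M.SpaceBound s) ∧
    ∀ x, x ∈ L ↔ M.Accepts x}

/-! ### Verifiers and provers -/

/-- The states of a verifier: coin-tossing states, deterministic states, and the two halting
states. -/
inductive VState (R D : Type) : Type
  | coin (q : R)
  | det (q : D)
  | accept
  | reject

/-- A verifier: a probabilistic Turing machine with a read-only input tape, a single work tape
and a communication cell. -/
structure Verifier (α : Type) where
  /-- coin-tossing states -/
  R : Type
  /-- deterministic states -/
  D : Type
  /-- work tape alphabet -/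
  Work : Type
  /-- communication alphabet -/
  Comm : Type
  finR : Finite R
  finD : Finite D
  finWork : Finite Work
  finComm : Finite Comm
  start : VState R D
  start_ne_accept : start ≠ VState.accept
  start_ne_reject : start ≠ VState.reject
  blank : Work
  /-- the null communication symbol -/
  null : Comm
  /-- the communication symbol of each state -/
  msg : VState R D → Comm
  /-- transitions of the coin-tossing states; the last argument is the random bit -/
  δcoin : R → Option α → Work → Comm → Bool → VState R D × Work × SignType × SignType
  /-- transitions of the deterministic states -/
  δdet : D → Option α → Work → Comm → VState R D × Work × SignType × SignType

/-- A prover determines its response from the input string, the communication so far (the list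
of the exchanged pairs (verifier symbol, prover symbol), oldest first), and the verifier symbol
that it has to answer. -/
abbrev Prover (α Γ : Type) : Type := List α → List (Γ × Γ) → Γ → Γ

/-- The prover that writes the sequence `c x`, one symbol at each communication step,
irrespective of what the verifier sends. -/
def Prover.ofSequence {α Γ : Type} (c : List α → ℕ → Γ) : Prover α Γ :=
  fun x h _ => c x h.length

/-- The provers of one-way interactive proof systems. -/
def onewayProvers (α Γ : Type) : Set (Prover α Γ) := Set.range Prover.ofSequence

/-- The law of an infinite sequence of independent fair coin tosses. -/
noncomputable def coinMeasure : Measure (ℕ → Bool) :=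
  Measure.infinitePi fun _ : ℕ => (PMF.uniformOfFintype Bool).toMeasure

namespace Verifier

variable {α : Type} (V : Verifier α)

/-- A configuration of the verifier, together with the communication so far and the number of
coins tossed so far. -/
structure Config where
  state : VState V.R V.D
  inputPos : ℤ
  work : ℤ → V.Work
  workPos : ℤ
  history : List (V.Comm × V.Comm)
  coins : ℕ

def init : V.Config where
  state := V.start
  inputPos := 0
  work := fun _ => V.blank
  workPos := 0
  history := []
  coins := 0

open Classical in
/-- The symbol that the verifier reads from the communication cell: the response of the prover
if the present state communicates, and the null symbol otherwise. -/
noncomputable def received (P : Prover α V.Comm) (x : List α) (c : V.Config) : V.Comm :=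
  if V.msg c.state = V.null then V.null else P x c.history (V.msg c.state)

open Classical in
/-- The communication up to and including the present step. -/
noncomputable def newHistory (P : Prover α V.Comm) (x : List α) (c : V.Config) :
    List (V.Comm × V.Comm) :=
  if V.msg c.state = V.null then c.history
  else c.history ++ [(V.msg c.state, P x c.history (V.msg c.state))]

/-- The effect of the move `m`, with the given new communication and number of coins. -/
def apply (c : V.Config) (m : VState V.R V.D × V.Work × SignType × SignType)
    (h : List (V.Comm × V.Comm)) (n : ℕ) : V.Config where
  state := m.1
  inputPos := c.inputPos + (m.2.2.1 : ℤ)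
  work := Function.update c.work c.workPos m.2.1
  workPos := c.workPos + (m.2.2.2 : ℤ)
  history := h
  coins := n

/-- One step of the interaction; `ω i` is the outcome of the `i`-th coin toss. -/
noncomputable def step (P : Prover α V.Comm) (x : List α) (ω : ℕ → Bool) (c : V.Config) :
    V.Config :=
  match c.state with
  | .coin q =>
      V.apply c
        (V.δcoin q (inputSymbol x c.inputPos) (c.work c.workPos) (V.received P x c) (ω c.coins))
        (V.newHistory P x c) (c.coins + 1)
  | .det q =>
      V.apply c
        (V.δdet q (inputSymbol x c.inputPos) (c.work c.workPos) (V.received P x c))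
        (V.newHistory P x c) c.coins
  | .accept => c
  | .reject => c

/-- The configuration after `t` steps of the interaction. -/
noncomputable def run (P : Prover α V.Comm) (x : List α) (ω : ℕ → Bool) (t : ℕ) : V.Config :=
  (V.step P x ω)^[t] V.init

noncomputable def acceptProb (P : Prover α V.Comm) (x : List α) : ℝ :=
  coinMeasure.real {ω | ∃ t, (V.run P x ω t).state = VState.accept}

noncomputable def rejectProb (P : Prover α V.Comm) (x : List α) : ℝ :=
  coinMeasure.real {ω | ∃ t, (V.run P x ω t).state = VState.reject}

/-- The input head never leaves the part of the tape delimited by the end-markers, whatever the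
input, the prover (among the admissible ones) and the coin tosses. -/
def StaysOnInput (provers : Set (Prover α V.Comm)) : Prop :=
  ∀ P ∈ provers, ∀ x ω t,
    0 ≤ (V.run P x ω t).inputPos ∧ (V.run P x ω t).inputPos ≤ (x.length : ℤ) + 1

/-- Worst-case space bound: at most `s n` work tape cells are visited on inputs of length `n`. -/
def SpaceBound (provers : Set (Prover α V.Comm)) (s : ℕ → ℕ) : Prop :=
  ∀ P ∈ provers, ∀ x ω t, cellsVisited (fun i => (V.run P x ω i).workPos) t ≤ s x.length

/-- Worst-case bound on randomness: at most `r n` coins are tossed on inputs of length `n`. -/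
def CoinBound (provers : Set (Prover α V.Comm)) (r : ℕ → ℕ) : Prop :=
  ∀ P ∈ provers, ∀ x ω t, (V.run P x ω t).coins ≤ r x.length

/-- With some admissible prover, `V` forms an interactive proof system for `L` with error `ε`. -/
def StrongIPS (provers : Set (Prover α V.Comm)) (L : Language α) (ε : ℝ) : Prop :=
  (∃ P ∈ provers, ∀ x ∈ L, 1 - ε ≤ V.acceptProb P x) ∧
    ∀ x, x ∉ L → ∀ P ∈ provers, 1 - ε ≤ V.rejectProb P x

/-- The weak form, in which `V` need not halt on non-members. -/
def WeakIPS (provers : Set (Prover α V.Comm)) (L : Language α) (ε : ℝ) : Prop :=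
  (∃ P ∈ provers, ∀ x ∈ L, 1 - ε ≤ V.acceptProb P x) ∧
    ∀ x, x ∉ L → ∀ P ∈ provers, V.acceptProb P x ≤ ε

/-- `V` is a legitimate verifier whose space lies in `S` and whose randomness lies in `C`. -/
def Restricted (provers : Set (Prover α V.Comm)) (S C : Set (ℕ → ℕ)) : Prop :=
  V.StaysOnInput provers ∧ (∃ s ∈ S, V.SpaceBound provers s) ∧ ∃ r ∈ C, V.CoinBound provers r

end Verifier

/-- `oneway-IP(S-space, C-random-bits)`: one-way interactive proof systems, strong definition,
with some error probability below `1/2`. -/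
def onewayIP (α : Type) (S C : Set (ℕ → ℕ)) : Set (Language α) :=
  {L | ∃ V : Verifier α, V.Restricted (onewayProvers α V.Comm) S C ∧
    ∃ ε : ℝ, ε < 1 / 2 ∧ V.StrongIPS (onewayProvers α V.Comm) L ε}

/-- `IP_w(S-space, C-random-bits)`: (private-coin, two-way) interactive proof systems, weak
definition, with some error probability below `1/2`. -/
def weakIP (α : Type) (S C : Set (ℕ → ℕ)) : Set (Language α) :=
  {L | ∃ V : Verifier α, V.Restricted Set.univ S C ∧
    ∃ ε : ℝ, ε < 1 / 2 ∧ V.WeakIPS Set.univ L ε}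

/-! Everything is compared with one intermediate model, nondeterministic finite automata with
finitely many two-way input heads (`HeadLanguages`). The inclusions close up in the cycle: one-way
IP ⊆ weak IP ⊆ head languages ⊆ NL ⊆ head languages ⊆ one-way IP.

Logarithmic space to heads (`MultiNTM.Recognizes.mem_headLanguages`). A head on an input of length n
has n + 2 positions and so stores about log n bits. A work tape is split at its head into two
stacks, each stack is cut into boundedly many words, and each word is a number held by one head.
Pushing and popping are multiplication and division by a constant, carried out with a scratch head
(`Implementable.mulAdd`, `Implementable.divMod`). This is done for machines with several input
heads, so that it serves both NL and weak IP.

Weak IP to heads (`weakIP_subset_headLanguages`). With at most r coins there are 2^r outcomes. A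
nondeterministic machine guesses more than half of them, runs these in parallel, guesses the
prover's responses, and accepts if all the chosen outcomes accept. The prover does not see the
coins, so outcomes with equal communication must get equal responses. The communication is too long
to store, but if all outcomes wait for each other before each communication round, a relation on the
finite set of outcomes suffices to record which of them still agree (`Verifier.toMulti_sound`,
`Verifier.toMulti_complete`).

Heads to one-way IP (`headLanguages_subset_onewayIP`). The prover writes down an accepting run, edge
by edge. A finite-state verifier can follow only one head of the program, and its secret coins
choose which. If every choice passes, the runs fit together to a genuine run. A cheating prover
might still describe an endless run, which the strong definition forbids to go unnoticed. Therefore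
each letter also increments a clock with m digits in base n + 2, and each digit has a test of its
own, held by the verifier's head as it runs to and fro; the clock cannot overflow, so an endless
certificate fails some test (`HeadProgram.verifier_sound`). A false certificate is guaranteed to
fail just one test, so slightly less than half of the outcomes reject outright, which pushes both
error probabilities just below 1/2 (`exists_selection`).

Heads to NL holds because head positions can be kept in binary, one counter per tape. One-way IP
lies in weak IP because a verifier that always sends the same symbol turns every prover into a
one-way prover. -/

/-! ### Programs for finitely many input heads -/

/-- The elementary operations of an input head, whose positions are `0, …, n + 1`. -/
inductive HeadOp (α : Type) : Type
  | nop
  | inc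
  | dec
  | zero
  | sym (o : Option α)

/-- The effect of an operation on the position of the head. -/
def HeadOp.Exec {α : Type} (x : List α) : HeadOp α → ℕ → ℕ → Prop
  | .nop, p, p' => p' = p
  | .inc, p, p' => p ≤ x.length ∧ p' = p + 1
  | .dec, p, p' => p = p' + 1
  | .zero, p, p' => p = 0 ∧ p' = 0
  | .sym o, p, p' => inputSymbol x p = o ∧ p' = p

/-- A finite flow graph, each of whose edges applies an operation to one of the heads. -/
structure HeadProgram (α ι : Type) where
  Node : Type
  finNode : Finite Node
  edge : Node → ι → HeadOp α → Node → Prop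
  start : Node
  final : Node

/-- All head positions lie between the end-markers. -/
def HeadsOn {α ι : Type} (x : List α) (v : ι → ℕ) : Prop := ∀ i, v i ≤ x.length + 1

abbrev HeadRel (α ι : Type) : Type := List α → (ι → ℕ) → (ι → ℕ) → Prop

section Programs

variable {α ι : Type} [DecidableEq ι]

def HeadProgram.Step (P : HeadProgram α ι) (x : List α) (a b : P.Node × (ι → ℕ)) : Prop :=
  ∃ i op p, P.edge a.1 i op b.1 ∧ HeadOp.Exec x op (a.2 i) p ∧ b.2 = Function.update a.2 i p

def HeadProgram.Reach (P : HeadProgram α ι) (x : List α) :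
    P.Node × (ι → ℕ) → P.Node × (ι → ℕ) → Prop :=
  Relation.ReflTransGen (P.Step x)

theorem HeadOp.Exec.le {x : List α} {op : HeadOp α} {p p' : ℕ} (h : op.Exec x p p')
    (hp : p ≤ x.length + 1) : p' ≤ x.length + 1 := by
  cases op <;> simp only [HeadOp.Exec] at h <;> omega

theorem HeadsOn.update {x : List α} {v : ι → ℕ} (hv : HeadsOn x v) {i : ι} {p : ℕ}
    (hp : p ≤ x.length + 1) : HeadsOn x (Function.update v i p) := by
  intro j
  by_cases h : j = i
  · subst h; simpa using hp
  · simpa [h] using hv j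

theorem HeadProgram.Step.headsOn {P : HeadProgram α ι} {x : List α} {a b : P.Node × (ι → ℕ)}
    (h : P.Step x a b) (ha : HeadsOn x a.2) : HeadsOn x b.2 := by
  obtain ⟨i, op, p, -, hp, hb⟩ := h
  rw [hb]
  exact ha.update (hp.le (ha i))

theorem HeadProgram.Reach.headsOn {P : HeadProgram α ι} {x : List α} {a b : P.Node × (ι → ℕ)}
    (h : P.Reach x a b) (ha : HeadsOn x a.2) : HeadsOn x b.2 := by
  induction h with
  | refl => exact ha
  | tail _ h ih => exact h.headsOn ih

/-- `R` is the input-output relation of a program. -/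
def Implementable (R : HeadRel α ι) : Prop :=
  ∃ P : HeadProgram α ι, ∀ x v, HeadsOn x v →
    ∀ v', R x v v' ↔ P.Reach x (P.start, v) (P.final, v')

/-- Agreement is needed only where all heads are on the input. This lets later equivalences use `v i
≤ x.length + 1`, a bound that runs preserve by `HeadProgram.Reach.headsOn`. -/
theorem Implementable.congr {R S : HeadRel α ι} (h : Implementable R)
    (e : ∀ x v, HeadsOn x v → ∀ v', S x v v' ↔ R x v v') : Implementable S := by
  obtain ⟨P, hP⟩ := h
  exact ⟨P, fun x v hv v' => (e x v hv v').trans (hP x v hv v')⟩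

/-- One step in a graph whose edges `j` are labelled with relations `R j`. -/
def GraphStep {N J : Type} (src tgt : J → N) (R : J → HeadRel α ι) (x : List α)
    (a b : N × (ι → ℕ)) : Prop :=
  ∃ j, src j = a.1 ∧ tgt j = b.1 ∧ R j x a.2 b.2

/-- The program obtained from a graph by replacing its edges with programs. -/
def graphProgram {N J : Type} [Finite N] [Finite J] (src tgt : J → N)
    (P : J → HeadProgram α ι) (s f : N) : HeadProgram α ι where
  Node := N ⊕ Σ j, (P j).Node
  finNode := by
    have := fun j => (P j).finNode
    infer_instance
  edge a i op b :=
    match a, b with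
    | .inl a, .inr ⟨j, q⟩ => op = .nop ∧ src j = a ∧ q = (P j).start
    | .inr ⟨j, q⟩, .inl b => op = .nop ∧ tgt j = b ∧ q = (P j).final
    | .inr ⟨j, q⟩, .inr ⟨j', q'⟩ => ∃ h : j' = j, (P j).edge q i op (h ▸ q')
    | .inl _, .inl _ => False
  start := .inl s
  final := .inl f

/-- Each edge is replaced by a disjoint copy of its program, entered and left by `nop` edges; these
must name some head, whence `Nonempty ι`. Conversely, a run inside the copy `j` remembers the
valuation with which it entered, and that this valuation is on the input, so that the specification
of `P j` applies on leaving. Union, composition and iteration are all instances. -/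
theorem Implementable.graph [Nonempty ι] {N J : Type} [Finite N] [Finite J] (src tgt : J → N)
    {R : J → HeadRel α ι} (h : ∀ j, Implementable (R j)) (s f : N) :
    Implementable fun x v v' =>
      Relation.ReflTransGen (GraphStep src tgt R x) (s, v) (f, v') := by
  choose P hP using h
  refine ⟨graphProgram src tgt P s f, fun x v hv v' => ⟨fun hr => ?_, fun hr => ?_⟩⟩
  · have key : ∀ b : N × (ι → ℕ), Relation.ReflTransGen (GraphStep src tgt R x) (s, v) b →
        (graphProgram src tgt P s f).Reach x (.inl s, v) (.inl b.1, b.2) := by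
      intro b hb
      induction hb with
      | refl => exact .refl
      | @tail b c _ hc ih =>
        obtain ⟨j, hs, ht, hR⟩ := hc
        have hb2 : HeadsOn x b.2 := ih.headsOn hv
        have h3 : (P j).Reach x _ _ := (hP j x _ hb2 _).1 hR
        obtain ⟨i₀⟩ := ‹Nonempty ι›
        let φ : (P j).Node × (ι → ℕ) → (graphProgram src tgt P s f).Node × (ι → ℕ) :=
          fun a => (.inr ⟨j, a.1⟩, a.2)
        have h4 : (graphProgram src tgt P s f).Step x (.inl b.1, b.2) (φ ((P j).start, b.2)) :=
          ⟨i₀, .nop, b.2 i₀, ⟨rfl, hs, rfl⟩, rfl, by simp [φ]⟩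
        have h5 : (graphProgram src tgt P s f).Step x (φ ((P j).final, c.2)) (.inl c.1, c.2) :=
          ⟨i₀, .nop, c.2 i₀, ⟨rfl, ht, rfl⟩, rfl, by simp [φ]⟩
        have h6 : (graphProgram src tgt P s f).Reach x (φ ((P j).start, b.2))
            (φ ((P j).final, c.2)) :=
          Relation.ReflTransGen.lift φ
            (fun a b ⟨i, op, p, he, hp, hv⟩ => ⟨i, op, p, ⟨rfl, he⟩, hp, hv⟩) _ _ h3
        exact (Relation.ReflTransGen.head h4 h6).trans (.single h5) |> ih.trans
    exact key _ hr
  · have key : ∀ b : (graphProgram src tgt P s f).Node × (ι → ℕ),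
        (graphProgram src tgt P s f).Reach x (.inl s, v) b →
        match b.1 with
        | .inl c => Relation.ReflTransGen (GraphStep src tgt R x) (s, v) (c, b.2)
        | .inr ⟨j, q⟩ => ∃ u, HeadsOn x u ∧
            Relation.ReflTransGen (GraphStep src tgt R x) (s, v) (src j, u) ∧
            (P j).Reach x ((P j).start, u) (q, b.2) := by
      intro b hb
      induction hb with
      | refl => exact .refl
      | @tail b c hb hc ih =>
        have hb2 : HeadsOn x b.2 := HeadProgram.Reach.headsOn hb hv
        obtain ⟨i, op, p, he, hp, hc2⟩ := hc
        obtain ⟨b1, b2⟩ := b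
        obtain ⟨c1, c2⟩ := c
        rcases b1 with b1 | ⟨j, q⟩ <;> rcases c1 with c1 | ⟨j', q'⟩
        · exact he.elim
        · obtain ⟨rfl, h1, h2⟩ := he
          simp only [HeadOp.Exec] at hp
          subst hp
          simp only [Function.update_eq_self] at hc2
          subst h1 h2 hc2
          exact ⟨_, hb2, ih, .refl⟩
        · obtain ⟨rfl, h1, h2⟩ := he
          simp only [HeadOp.Exec] at hp
          subst hp
          simp only [Function.update_eq_self] at hc2
          subst h1 h2 hc2
          obtain ⟨u, hu, h3, h4⟩ := ih
          exact h3.tail ⟨j, rfl, rfl, (hP j x u hu _).2 h4⟩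
        · obtain ⟨h, he⟩ := he
          subst h
          obtain ⟨u, hu, h3, h4⟩ := ih
          exact ⟨u, hu, h3, h4.tail ⟨i, op, p, he, hp, hc2⟩⟩
    exact key _ hr

theorem Implementable.op (i : ι) (op : HeadOp α) :
    Implementable fun x v v' => ∃ p, op.Exec x (v i) p ∧ v' = Function.update v i p := by
  refine ⟨⟨Bool, inferInstance, fun a j o b => a = false ∧ b = true ∧ j = i ∧ o = op,
    false, true⟩, fun x v _ v' => ⟨?_, fun h => ?_⟩⟩
  · rintro ⟨p, hp, rfl⟩
    exact .single ⟨i, op, p, ⟨rfl, rfl, rfl, rfl⟩, hp, rfl⟩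
  · rcases Relation.ReflTransGen.cases_head h with h | ⟨b, hb, hr⟩
    · simp at h
    · obtain ⟨j, o, p, ⟨_, hb1, rfl, rfl⟩, hp, hb2⟩ := hb
      rcases Relation.ReflTransGen.cases_head hr with h | ⟨c, hc, _⟩
      · subst h; exact ⟨p, hp, hb2⟩
      · obtain ⟨_, _, _, ⟨hf, _⟩, _⟩ := hc
        simp [hb1] at hf

theorem Implementable.iUnion [Nonempty ι] {J : Type} [Finite J] {R : J → HeadRel α ι}
    (h : ∀ j, Implementable (R j)) : Implementable fun x v v' => ∃ j, R j x v v' := by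
  refine (Implementable.graph (fun _ => false) (fun _ => true) h false true).congr
    fun x v _ v' => ⟨fun ⟨j, hj⟩ => .single ⟨j, rfl, rfl, hj⟩, fun h => ?_⟩
  rcases Relation.ReflTransGen.cases_head h with h | ⟨b, ⟨j, _, hb, hj⟩, hr⟩
  · simp at h
  · rcases Relation.ReflTransGen.cases_head hr with h | ⟨c, ⟨_, hf, _⟩, _⟩
    · subst h; exact ⟨j, hj⟩
    · simp [← hb] at hf

theorem Implementable.union [Nonempty ι] {R S : HeadRel α ι} (hR : Implementable R)
    (hS : Implementable S) : Implementable fun x v v' => R x v v' ∨ S x v v' := by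
  refine (Implementable.iUnion (R := fun b : Bool => bif b then R else S)
    (by rintro (_ | _); exacts [hS, hR])).congr fun x v _ v' => ?_
  simp [or_comm]

theorem Implementable.comp [Nonempty ι] {R S : HeadRel α ι} (hR : Implementable R)
    (hS : Implementable S) : Implementable fun x v v' => ∃ u, R x v u ∧ S x u v' := by
  refine (Implementable.graph (N := Fin 3) (J := Bool) (fun b => bif b then 0 else 1)
    (fun b => bif b then 1 else 2) (R := fun b : Bool => bif b then R else S)
    (by rintro (_ | _); exacts [hS, hR]) 0 2).congr fun x v _ v' => ⟨?_, fun h => ?_⟩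
  · rintro ⟨u, h1, h2⟩
    exact (Relation.ReflTransGen.single (b := (1, u)) ⟨true, rfl, rfl, h1⟩).tail
      ⟨false, rfl, rfl, h2⟩
  · rcases Relation.ReflTransGen.cases_head h with h | ⟨⟨b1, u⟩, ⟨j, h1, hb, hj⟩, hr⟩
    · simp at h
    · rcases j with _ | _
      · simp at h1
      · simp only [cond_true] at hb
        subst hb
        refine ⟨u, hj, ?_⟩
        rcases Relation.ReflTransGen.cases_head hr with h | ⟨⟨c1, w⟩, ⟨j, h1, hc, hj⟩, hr⟩
        · simp at h
        · rcases j with _ | _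
          · simp only [cond_false] at hc
            subst hc
            rcases Relation.ReflTransGen.cases_head hr with h | ⟨_, ⟨j, h1, _⟩, _⟩
            · obtain ⟨_, rfl⟩ := Prod.mk.inj h
              exact hj
            · rcases j with _ | _ <;> simp at h1
          · simp at h1

theorem Implementable.star [Nonempty ι] {R : HeadRel α ι} (hR : Implementable R) :
    Implementable fun x v v' => Relation.ReflTransGen (R x) v v' := by
  refine (Implementable.graph (N := Unit) (J := Unit) id id (fun _ => hR) () ()).congr
    fun x v _ v' => ⟨fun h => ?_, fun h => ?_⟩
  · exact Relation.ReflTransGen.lift (fun u => ((), u)) (fun a b hab => ⟨(), rfl, rfl, hab⟩) _ _ h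
  · exact Relation.ReflTransGen.lift (fun u : Unit × (ι → ℕ) => u.2)
      (fun a b ⟨_, _, _, hab⟩ => hab) _ _ h

theorem Implementable.eq [Nonempty ι] : Implementable fun (_ : List α) (v v' : ι → ℕ) => v' = v := by
  obtain ⟨i⟩ := ‹Nonempty ι›
  refine (Implementable.op i .nop).congr fun x v _ v' => ?_
  simp [HeadOp.Exec]

theorem Implementable.empty [Nonempty ι] :
    Implementable fun (_ : List α) (_ _ : ι → ℕ) => False :=
  (Implementable.iUnion (J := Empty) (R := fun _ _ v v' => v' = v) (fun _ => .eq)).congr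
    fun x v _ v' => by simp

/-- A guard that does not depend on the data. -/
theorem Implementable.guard [Nonempty ι] {R : HeadRel α ι} (p : Prop) (hR : p → Implementable R) :
    Implementable fun x v v' => p ∧ R x v v' := by
  by_cases hp : p
  · simpa [hp] using hR hp
  · simpa [hp] using Implementable.empty

theorem Implementable.inc (i : ι) : Implementable fun (x : List α) v v' =>
    v i ≤ x.length ∧ v' = Function.update v i (v i + 1) := by
  refine (Implementable.op i .inc).congr fun x v _ v' => ?_
  simp only [HeadOp.Exec]
  constructor
  · rintro ⟨h1, h2⟩; exact ⟨_, ⟨h1, rfl⟩, h2⟩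
  · rintro ⟨p, ⟨h1, rfl⟩, h2⟩; exact ⟨h1, h2⟩

theorem Implementable.dec (i : ι) : Implementable fun (_ : List α) v v' =>
    1 ≤ v i ∧ v' = Function.update v i (v i - 1) := by
  refine (Implementable.op i .dec).congr fun x v _ v' => ?_
  simp only [HeadOp.Exec]
  constructor
  · rintro ⟨h1, h2⟩; exact ⟨_, by omega, h2⟩
  · rintro ⟨p, h1, h2⟩; exact ⟨by omega, by rw [h2, h1]; simp⟩

theorem Implementable.zero (i : ι) : Implementable fun (_ : List α) v v' =>
    v i = 0 ∧ v' = v := by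
  refine (Implementable.op i .zero).congr fun x v _ v' => ?_
  simp only [HeadOp.Exec]
  constructor
  · rintro ⟨h1, h2⟩; exact ⟨0, ⟨h1, rfl⟩, by rw [h2, ← h1]; simp⟩
  · rintro ⟨p, ⟨h1, rfl⟩, h2⟩; exact ⟨h1, by rw [h2, ← h1]; simp⟩

theorem Implementable.sym (i : ι) (o : Option α) : Implementable fun x v v' =>
    inputSymbol x (v i) = o ∧ v' = v := by
  refine (Implementable.op i (.sym o)).congr fun x v _ v' => ?_
  simp only [HeadOp.Exec]
  constructor
  · rintro ⟨h1, h2⟩; exact ⟨_, ⟨h1, rfl⟩, by simp [h2]⟩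
  · rintro ⟨p, ⟨h1, rfl⟩, h2⟩; exact ⟨h1, by simpa using h2⟩

theorem Implementable.zeros [Nonempty ι] (l : List ι) : Implementable fun (_ : List α) v v' =>
    (∀ i ∈ l, v i = 0) ∧ v' = v := by
  induction l with
  | nil => simpa using Implementable.eq
  | cons i l ih =>
    refine ((Implementable.zero i).comp ih).congr fun x v _ v' => ?_
    constructor
    · rintro ⟨h1, h2⟩
      exact ⟨v, ⟨h1 i (by simp), rfl⟩, fun j hj => h1 j (by simp [hj]), h2⟩
    · rintro ⟨u, ⟨h1, rfl⟩, h2, h3⟩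
      exact ⟨by simpa [h1] using h2, h3⟩

theorem Implementable.add [Nonempty ι] (i : ι) (m : ℕ) : Implementable fun (x : List α) v v' =>
    v i + m ≤ x.length + 1 ∧ v' = Function.update v i (v i + m) := by
  induction m with
  | zero =>
    refine Implementable.eq.congr fun x v hv v' => ?_
    have := hv i
    simpa using fun _ => this
  | succ m ih =>
    refine (ih.comp (Implementable.inc i)).congr fun x v hv v' => ?_
    constructor
    · rintro ⟨h1, h2⟩
      exact ⟨_, ⟨by omega, rfl⟩, by simp; omega, by simpa [add_assoc] using h2⟩
    · rintro ⟨u, ⟨h1, rfl⟩, h2, h3⟩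
      simp only [Function.update_self, Function.update_idem] at h2 h3
      exact ⟨by omega, by simpa [add_assoc] using h3⟩

theorem Implementable.sub [Nonempty ι] (i : ι) (m : ℕ) : Implementable fun (_ : List α) v v' =>
    m ≤ v i ∧ v' = Function.update v i (v i - m) := by
  induction m with
  | zero =>
    refine Implementable.eq.congr fun x v hv v' => ?_
    simp
  | succ m ih =>
    refine (ih.comp (Implementable.dec i)).congr fun x v hv v' => ?_
    constructor
    · rintro ⟨h1, h2⟩
      exact ⟨_, ⟨by omega, rfl⟩, by simp; omega, by simpa [Nat.sub_sub] using h2⟩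
    · rintro ⟨u, ⟨h1, rfl⟩, h2, h3⟩
      simp only [Function.update_self, Function.update_idem] at h2 h3
      exact ⟨by omega, by simpa [Nat.sub_sub] using h3⟩

/-- Replace `v y = k * t` and `v z` by `0` and `v z + m * t`. -/
theorem Implementable.transfer [Nonempty ι] {y z : ι} (hyz : y ≠ z) (k m : ℕ) :
    Implementable fun (x : List α) v v' => ∃ t, v y = k * t ∧ v z + m * t ≤ x.length + 1 ∧
      v' = Function.update (Function.update v y 0) z (v z + m * t) := by
  have h1 := (((Implementable.sub (α := α) y k).comp (Implementable.add z m)).star).comp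
    (Implementable.zero y)
  refine h1.congr fun x v hv v' => ⟨?_, ?_⟩
  · rintro ⟨t, h1, h2, rfl⟩
    refine ⟨_, ?_, by simp [hyz], rfl⟩
    clear hv
    induction t generalizing v with
    | zero =>
      rw [mul_zero] at h1
      have e : Function.update (Function.update v y 0) z (v z + m * 0) = v := by
        rw [mul_zero, add_zero, ← h1]; simp
      rw [e]
    | succ t ih =>
      rw [mul_add, mul_one] at h1 h2
      set w := Function.update (Function.update v y (v y - k)) z (v z + m) with hw
      have h3 := ih w (by simp [hw, hyz]; omega) (by simp [hw]; omega)
      have e : Function.update (Function.update w y 0) z (w z + m * t)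
          = Function.update (Function.update v y 0) z (v z + m * (t + 1)) := by
        funext j
        by_cases hj : j = z
        · subst hj; simp [hw, mul_add]; ring
        · by_cases hj2 : j = y
          · subst hj2; simp [hj]
          · simp [hj, hj2, hw]
      rw [e] at h3
      refine Relation.ReflTransGen.head ⟨_, ⟨by omega, rfl⟩, ?_, ?_⟩ h3
      · simp [hyz.symm]; omega
      · simp [hw, hyz.symm]
  · rintro ⟨u, hu, h0, rfl⟩
    -- Loop invariant: after `t` rounds the head `y` still holds `a`. The zero test that follows the
    -- loop forces `a = 0`.
    have key : ∃ a t, v y = a + k * t ∧ v z + m * t ≤ x.length + 1 ∧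
        v' = Function.update (Function.update v y a) z (v z + m * t) := by
      clear h0
      induction hu with
      | refl => exact ⟨v y, 0, by simp, by simpa using hv z, by simp⟩
      | tail _ hc ih =>
        obtain ⟨a, t, h1, h2, rfl⟩ := ih
        obtain ⟨_, ⟨h3, rfl⟩, h4, rfl⟩ := hc
        simp [hyz, hyz.symm] at h3 h4
        refine ⟨a - k, t + 1, by rw [mul_add]; omega, by rw [mul_add]; omega, ?_⟩
        funext j
        by_cases hj : j = z
        · subst hj; simp [hyz.symm, mul_add]; ring
        · by_cases hj2 : j = y
          · subst hj2; simp [hj]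
          · simp [hj, hj2]
    obtain ⟨a, t, h1, h2, rfl⟩ := key
    simp [hyz] at h0
    subst h0
    exact ⟨t, by omega, h2, rfl⟩

/-- Replace `v y` by `w * v y + c`, with the help of the scratch head `z`. -/
theorem Implementable.mulAdd [Nonempty ι] {y z : ι} (hyz : y ≠ z) (w c : ℕ) :
    Implementable fun (x : List α) v v' => v z = 0 ∧ w * v y + c ≤ x.length + 1 ∧
      v' = Function.update v y (w * v y + c) := by
  -- Empty `y` into the scratch head, then refill `y` with `w` units for each unit of `z`, then add
  -- `c`.
  refine ((((Implementable.zero z).comp (.transfer hyz 1 1)).comp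
    (.transfer hyz.symm 1 w)).comp (.add y c)).congr fun x v hv v' => ⟨?_, ?_⟩
  · rintro ⟨h0, h1, rfl⟩
    refine ⟨_, ⟨_, ⟨_, ⟨h0, rfl⟩, v y, by simp, ?_, rfl⟩, v y, ?_, ?_, rfl⟩, ?_, ?_⟩
    · simpa [h0] using hv y
    · simp [h0]
    · simp [hyz]; omega
    · simp [hyz]; omega
    · funext j
      by_cases hj : j = y
      · subst hj; simp [hyz]
      · by_cases hj2 : j = z
        · subst hj2; simp [hj, h0]
        · simp [hj, hj2]
  · rintro ⟨_, ⟨_, ⟨_, ⟨h0, rfl⟩, t, h1, h2, rfl⟩, t', h3, h4, rfl⟩, h5, rfl⟩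
    simp [hyz, h0] at h1 h3 h4 h5
    subst h1 h3
    refine ⟨h0, by omega, ?_⟩
    funext j
    by_cases hj : j = y
    · subst hj; simp [hyz]
    · by_cases hj2 : j = z
      · subst hj2; simp [hj, h0]
      · simp [hj, hj2]

/-- The inverse of `Implementable.mulAdd`. -/
theorem Implementable.divMod [Nonempty ι] {y z : ι} (hyz : y ≠ z) {w : ℕ} (hw : 0 < w) (c : ℕ) :
    Implementable fun (_ : List α) v v' => v z = 0 ∧ ∃ t, v y = w * t + c ∧
      v' = Function.update v y t := by
  -- Subtract `c`, move one unit to `z` for each `w` units of `y`, and move the quotient back; a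
  -- remainder blocks the zero test in the first transfer.
  refine ((((Implementable.zero z).comp (.sub y c)).comp
    (.transfer hyz w 1)).comp (.transfer hyz.symm 1 1)).congr fun x v hv v' => ⟨?_, ?_⟩
  · rintro ⟨h0, t, h1, rfl⟩
    have h2 := hv y
    have h3 : t ≤ w * t := Nat.le_mul_of_pos_left t hw
    refine ⟨_, ⟨_, ⟨_, ⟨h0, rfl⟩, by omega, rfl⟩, t, ?_, ?_, rfl⟩, t, ?_, ?_, ?_⟩
    · simp; omega
    · simp [hyz.symm, h0]; omega
    · simp [hyz.symm, h0]
    · simp [hyz]; omega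
    · funext j
      by_cases hj : j = y
      · subst hj; simp [hyz]
      · by_cases hj2 : j = z
        · subst hj2; simp [hj, h0]
        · simp [hj, hj2]
  · rintro ⟨_, ⟨_, ⟨_, ⟨h0, rfl⟩, h1, rfl⟩, t, h2, h3, rfl⟩, t', h4, h5, rfl⟩
    simp [hyz, hyz.symm, h0] at h1 h2 h3 h4 h5
    subst h4
    refine ⟨h0, t, by omega, ?_⟩
    funext j
    by_cases hj : j = y
    · subst hj; simp [hyz]
    · by_cases hj2 : j = z
      · subst hj2; simp [hj, h0]
      · simp [hj, hj2]

end Programs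


/-! ### Stacks of logarithmic size, stored in head positions -/

section Stacks

variable {W : Type}

/-- The value of a word in bijective base `w`, the digit of the letter `a` being `num a + 1`. -/
def stackCode (num : W → ℕ) (w : ℕ) : List W → ℕ
  | [] => 0
  | a :: l => w * stackCode num w l + (num a + 1)

/-- Digits lie in `1, …, w`, so a word of length `c` has code at most `(w + 1) ^ c - 1`. Hence `(w +
1) ^ c ≤ n + 2` is exactly the condition used for a segment of length `c` to fit into a head
position, which is at most `n + 1`. -/
theorem stackCode_lt {num : W → ℕ} {w : ℕ} (hw : ∀ a, num a < w) (l : List W) :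
    stackCode num w l + 1 ≤ (w + 1) ^ l.length := by
  induction l with
  | nil => simp [stackCode]
  | cons a l ih =>
    have h1 := hw a
    have h2 := Nat.mul_le_mul_left (w + 1) ih
    simp only [stackCode, List.length_cons, pow_succ]
    rw [mul_comm ((w + 1) ^ l.length)]
    refine le_trans ?_ h2
    nlinarith

theorem stackCode_eq_zero {num : W → ℕ} {w : ℕ} {l : List W} :
    stackCode num w l = 0 ↔ l = [] := by
  cases l <;> simp [stackCode]

/-- Since no digit is 0, a code determines its word without any record of the length: the empty word
alone has code 0, and otherwise division with remainder recovers the top letter. -/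
theorem stackCode_eq {num : W → ℕ} {w : ℕ} (hw : ∀ a, num a < w) (hn : num.Injective)
    {l : List W} {a : W} {t : ℕ} (h : stackCode num w l = w * t + (num a + 1)) :
    ∃ l', l = a :: l' ∧ stackCode num w l' = t := by
  cases l with
  | nil => simp [stackCode] at h
  | cons b l =>
    simp only [stackCode] at h
    have ha := hw a
    have hb := hw b
    have h0 : w * stackCode num w l + num b = w * t + num a := by omega
    have h1 : stackCode num w l = t := by
      have := congrArg (· / w) h0
      simpa [Nat.mul_add_div (by omega : 0 < w), Nat.div_eq_of_lt ha, Nat.div_eq_of_lt hb]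
        using this
    subst h1
    have h2 : num b = num a := by omega
    exact ⟨l, by rw [hn h2], rfl⟩

/-- The concatenation of the words `g (B - 1), …, g 0`. -/
def joinSegments (g : ℕ → List W) : ℕ → List W
  | 0 => []
  | B + 1 => g B ++ joinSegments g B

theorem joinSegments_congr {g g' : ℕ → List W} {B : ℕ} (h : ∀ i < B, g i = g' i) :
    joinSegments g B = joinSegments g' B := by
  induction B with
  | zero => rfl
  | succ B ih =>
    simp only [joinSegments]
    rw [h B (by omega), ih fun i hi => h i (by omega)]

/-- The top of the stack is the first letter of the highest nonempty segment. The segments below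
need not be full, so a letter may be pushed on any segment with nothing above it. -/
theorem joinSegments_cons {g : ℕ → List W} {B i : ℕ} (hi : i < B)
    (h : ∀ i', i < i' → i' < B → g i' = []) (a : W) :
    joinSegments (Function.update g i (a :: g i)) B = a :: joinSegments g B := by
  induction B with
  | zero => omega
  | succ B ih =>
    simp only [joinSegments]
    by_cases hB : i = B
    · subst hB
      rw [Function.update_self, joinSegments_congr (g' := g)]
      · simp
      · intro j hj; rw [Function.update_of_ne (by omega)]
    · rw [Function.update_of_ne (by omega), h B (by omega) (by omega),
        ih (by omega) fun i' h1 h2 => h i' h1 (by omega)]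
      simp

theorem length_joinSegments {g : ℕ → List W} {B k c : ℕ} (hk : k < B)
    (h1 : ∀ i < k, (g i).length = c) (h2 : ∀ i, k < i → g i = []) :
    (joinSegments g B).length = k * c + (g k).length := by
  induction B with
  | zero => omega
  | succ B ih =>
    simp only [joinSegments, List.length_append]
    by_cases hB : k = B
    · subst hB
      have : ∀ b ≤ k, (joinSegments g b).length = b * c := by
        intro b hb
        induction b with
        | zero => simp [joinSegments]
        | succ b ihb =>
          simp [joinSegments, h1 b (by omega), ihb (by omega)]; ring
      rw [this k le_rfl]; ring
    · rw [h2 B (by omega), ih (by omega)]; simp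

variable {α ι : Type} [DecidableEq ι] {B : ℕ}

/-- Push a digit on the stack whose segments are stored in the heads `y i`. -/
def PushRel (y : Fin B → ι) (z : ι) (w c : ℕ) : HeadRel α ι := fun x v v' =>
  ∃ i : Fin B, (∀ i', i < i' → v (y i') = 0) ∧ v z = 0 ∧ w * v (y i) + c ≤ x.length + 1 ∧
    v' = Function.update v (y i) (w * v (y i) + c)

/-- Pop a digit from the stack whose segments are stored in the heads `y i`. -/
def PopRel (y : Fin B → ι) (z : ι) (w c : ℕ) : HeadRel α ι := fun _ v v' =>
  ∃ i : Fin B, (∀ i', i < i' → v (y i') = 0) ∧ v z = 0 ∧ ∃ t, v (y i) = w * t + c ∧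
    v' = Function.update v (y i) t

/-- The stack is empty. -/
def EmptyRel (y : Fin B → ι) : HeadRel α ι := fun _ v v' => (∀ i, v (y i) = 0) ∧ v' = v

/-- The segment is guessed by a finite union, and zero tests certify that all segments above it are
empty. -/
theorem implementable_pushRel [Nonempty ι] {y : Fin B → ι} {z : ι} (hz : ∀ i, y i ≠ z) (w c : ℕ) :
    Implementable (PushRel (α := α) y z w c) := by
  refine (Implementable.iUnion fun i : Fin B => (Implementable.zeros
    (((Finset.univ.filter fun i' => i < i').toList).map y)).comp (.mulAdd (hz i) w c)).congr
      fun x v hv v' => ?_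
  simp only [PushRel, List.mem_map, Finset.mem_toList, Finset.mem_filter, Finset.mem_univ,
    true_and]
  refine exists_congr fun i => ⟨?_, ?_⟩
  · rintro ⟨h1, h2⟩
    exact ⟨v, ⟨by rintro _ ⟨i', hi', rfl⟩; exact h1 i' hi', rfl⟩, h2⟩
  · rintro ⟨_, ⟨h1, rfl⟩, h2⟩
    exact ⟨fun i' hi' => h1 _ ⟨i', hi', rfl⟩, h2⟩

theorem implementable_popRel [Nonempty ι] {y : Fin B → ι} {z : ι} (hz : ∀ i, y i ≠ z) {w : ℕ}
    (hw : 0 < w) (c : ℕ) : Implementable (PopRel (α := α) y z w c) := by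
  refine (Implementable.iUnion fun i : Fin B => (Implementable.zeros
    (((Finset.univ.filter fun i' => i < i').toList).map y)).comp (.divMod (hz i) hw c)).congr
      fun x v hv v' => ?_
  simp only [PopRel, List.mem_map, Finset.mem_toList, Finset.mem_filter, Finset.mem_univ,
    true_and]
  refine exists_congr fun i => ⟨?_, ?_⟩
  · rintro ⟨h1, h2⟩
    exact ⟨v, ⟨by rintro _ ⟨i', hi', rfl⟩; exact h1 i' hi', rfl⟩, h2⟩
  · rintro ⟨_, ⟨h1, rfl⟩, h2⟩
    exact ⟨fun i' hi' => h1 _ ⟨i', hi', rfl⟩, h2⟩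

theorem implementable_emptyRel [Nonempty ι] (y : Fin B → ι) :
    Implementable (EmptyRel (α := α) y) := by
  refine (Implementable.zeros (Finset.univ.toList.map y)).congr fun x v hv v' => ?_
  simp [EmptyRel]

/-- The heads hold the stack `l`, cut into segments in an arbitrary way. -/
def StackEnc (num : W → ℕ) (w : ℕ) (u : Fin B → ℕ) (l : List W) : Prop :=
  ∃ g : ℕ → List W, (∀ i : Fin B, u i = stackCode num w (g i)) ∧ joinSegments g B = l

/-- The heads hold the stack `l`, cut into segments of length `c`. -/
def StackGood (num : W → ℕ) (w c : ℕ) (u : Fin B → ℕ) (l : List W) : Prop :=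
  ∃ (g : ℕ → List W) (k : ℕ), (∀ i : Fin B, u i = stackCode num w (g i)) ∧
    joinSegments g B = l ∧ k < B ∧ (∀ i < k, (g i).length = c) ∧ (g k).length ≤ c ∧
    ∀ i, k < i → g i = []

variable {num : W → ℕ} {w c : ℕ} {x : List α} {v v' : ι → ℕ} {y : Fin B → ι} {z : ι}

theorem joinSegments_nil {B : ℕ} : joinSegments (fun _ => ([] : List W)) B = [] := by
  induction B with
  | zero => rfl
  | succ B ih => simp [joinSegments, ih]

theorem stackEnc_nil : StackEnc num w (fun _ : Fin B => 0) ([] : List W) :=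
  ⟨fun _ => [], fun _ => rfl, joinSegments_nil⟩

theorem stackGood_nil (hB : 0 < B) : StackGood num w c (fun _ : Fin B => 0) ([] : List W) :=
  ⟨fun _ => [], 0, fun _ => rfl, joinSegments_nil, hB, by simp, by simp, by simp⟩

/-- The program cannot tell when a segment has reached its intended length, so the segment for a
push is guessed. The guess is harmless for soundness, because every way of cutting represents the
same stack. `StackGood` is the particular cutting with which some run never overflows. -/
theorem StackEnc.push (hy : y.Injective) {l : List W}
    (h : StackEnc num w (v ∘ y) l) {a : W} (hp : PushRel y z w (num a + 1) x v v') :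
    StackEnc num w (v' ∘ y) (a :: l) := by
  obtain ⟨g, h1, rfl⟩ := h
  obtain ⟨i, h2, -, -, rfl⟩ := hp
  refine ⟨Function.update g i (a :: g i), fun j => ?_, joinSegments_cons i.2 (fun i' h3 h4 => ?_) a⟩
  · by_cases hj : j = i
    · subst hj; simpa [stackCode] using Or.inl (h1 j)
    · have h3 : (j : ℕ) ≠ i := fun h => hj (Fin.ext h)
      simpa [hy.eq_iff, hj, h3] using h1 j
  · exact stackCode_eq_zero.1 ((h1 ⟨i', h4⟩).symm.trans (h2 ⟨i', h4⟩ h3))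

theorem StackEnc.pop (hw : ∀ a, num a < w) (hn : num.Injective) (hy : y.Injective) {l : List W}
    (h : StackEnc num w (v ∘ y) l) {a : W} (hp : PopRel y z w (num a + 1) x v v') :
    ∃ l', l = a :: l' ∧ StackEnc num w (v' ∘ y) l' := by
  obtain ⟨g, h1, rfl⟩ := h
  obtain ⟨i, h2, -, t, ht, rfl⟩ := hp
  obtain ⟨s, hs, hst⟩ := stackCode_eq hw hn ((h1 i).symm.trans ht)
  -- Pushing the letter back on the popped stack reproduces the original one, which identifies its
  -- top letter and its tail.
  have h3 := joinSegments_cons (g := Function.update g i s) i.2 (fun i' h3 h4 => by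
    rw [Function.update_of_ne (by omega)]
    exact stackCode_eq_zero.1 ((h1 ⟨i', h4⟩).symm.trans (h2 ⟨i', h4⟩ h3))) a
  rw [Function.update_self, Function.update_idem, ← hs, Function.update_eq_self] at h3
  refine ⟨_, h3, _, fun j => ?_, rfl⟩
  by_cases hj : j = i
  · subst hj; simp [hst]
  · have h3 : (j : ℕ) ≠ i := fun h => hj (Fin.ext h)
    simpa [hy.eq_iff, hj, h3] using h1 j

theorem StackEnc.empty {l : List W} (h : StackEnc num w (v ∘ y) l)
    (hp : EmptyRel y x v v') : l = [] := by
  obtain ⟨g, h1, rfl⟩ := h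
  rw [joinSegments_congr (g' := fun _ => []), joinSegments_nil]
  intro i hi
  exact stackCode_eq_zero.1 ((h1 ⟨i, hi⟩).symm.trans (hp.1 _))

/-- The letter goes to segment `k`, or to segment `k + 1` if `k` already has `c` letters; the bound
`hl` says that there is such a segment. By `hx` a segment of `c` letters fits into a head position.
-/
theorem StackGood.push (hw : ∀ a, num a < w) (hy : y.Injective) (hc : 0 < c) {l : List W}
    (h : StackGood num w c (v ∘ y) l) (hl : l.length < B * c) (hz : v z = 0)
    (hx : (w + 1) ^ c ≤ x.length + 2) (a : W) :
    ∃ v', PushRel y z w (num a + 1) x v v' ∧ StackGood num w c (v' ∘ y) (a :: l) := by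
  obtain ⟨g, k, h1, rfl, hk, h2, h3, h4⟩ := h
  rw [length_joinSegments hk h2 h4] at hl
  have key : ∀ i : Fin B, (∀ i' < (i : ℕ), (g i').length = c) → (g i).length < c →
      (∀ i', (i : ℕ) < i' → g i' = []) →
      ∃ v', PushRel y z w (num a + 1) x v v' ∧
        StackGood num w c (v' ∘ y) (a :: joinSegments g B) := by
    intro i h5 h6 h7
    refine ⟨_, ⟨i, fun i' hi' => ?_, hz, ?_, rfl⟩, Function.update g i (a :: g i), i,
      fun j => ?_, joinSegments_cons i.2 (fun i' h3 h4 => h7 i' h3) a, i.2, fun j hj => ?_, ?_,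
      fun j hj => ?_⟩
    · exact (h1 i').trans (stackCode_eq_zero.2 (h7 _ hi'))
    · have h8 := stackCode_lt hw (a :: g i)
      have h9 : (w + 1) ^ (a :: g i).length ≤ (w + 1) ^ c := Nat.pow_le_pow_right (by omega) h6
      have h10 : v (y i) = stackCode num w (g i) := h1 i
      simp only [stackCode] at h8
      rw [h10]; omega
    · by_cases hj : j = i
      · subst hj; simpa [stackCode] using Or.inl (h1 j)
      · have h3 : (j : ℕ) ≠ i := fun h => hj (Fin.ext h)
        simpa [hy.eq_iff, hj, h3] using h1 j
    · rw [Function.update_of_ne (by omega)]; exact h5 j hj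
    · simpa using h6
    · rw [Function.update_of_ne (by omega)]; exact h7 j hj
  by_cases h5 : (g k).length < c
  · exact key ⟨k, hk⟩ h2 h5 h4
  · have h6 : (g k).length = c := by omega
    have h7 : k + 1 < B := by
      by_contra h
      have : B = k + 1 := by omega
      subst this
      rw [h6] at hl
      have : (k + 1) * c = k * c + c := by ring
      omega
    refine key ⟨k + 1, h7⟩ (fun i' hi' => ?_) ?_ fun i' hi' => h4 i' (by simp at hi'; omega)
    · simp only at hi'
      by_cases h : i' = k
      · rw [h, h6]
      · exact h2 i' (by omega)
    · simpa [h4 (k + 1) (by omega)] using hc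

/-- Earlier pops may have emptied segment `k`. The top letter is then in segment `k - 1`, which has
`c > 0` letters. -/
theorem StackGood.pop (hy : y.Injective) (hc : 0 < c) {l : List W} {a : W}
    (h : StackGood num w c (v ∘ y) (a :: l)) (hz : v z = 0) :
    ∃ v', PopRel y z w (num a + 1) x v v' ∧ StackGood num w c (v' ∘ y) l := by
  obtain ⟨g, k, h1, hg, hk, h2, h3, h4⟩ := h
  have hlen := length_joinSegments hk h2 h4
  rw [hg, List.length_cons] at hlen
  have key : ∀ i : Fin B, (∀ i' < (i : ℕ), (g i').length = c) → (g i).length ≤ c → g i ≠ [] →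
      (∀ i', (i : ℕ) < i' → g i' = []) →
      ∃ v', PopRel y z w (num a + 1) x v v' ∧ StackGood num w c (v' ∘ y) l := by
    intro i h5 h6 h6' h7
    obtain ⟨b, s, hs⟩ := List.exists_cons_of_ne_nil h6'
    have h8 := joinSegments_cons (g := Function.update g i s) i.2 (fun i' h3 h4 => by
      rw [Function.update_of_ne (by omega)]; exact h7 i' h3) b
    rw [Function.update_self, Function.update_idem, ← hs, Function.update_eq_self, hg] at h8
    obtain ⟨rfl, rfl⟩ := List.cons.inj h8
    refine ⟨_, ⟨i, fun i' hi' => ?_, hz, stackCode num w s, ?_, rfl⟩, Function.update g i s, i,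
      fun j => ?_, rfl, i.2, fun j hj => ?_, ?_, fun j hj => ?_⟩
    · exact (h1 i').trans (stackCode_eq_zero.2 (h7 _ hi'))
    · have := h1 i
      rw [hs] at this
      exact this
    · by_cases hj : j = i
      · subst hj; simp
      · have h3 : (j : ℕ) ≠ i := fun h => hj (Fin.ext h)
        simpa [hy.eq_iff, hj, h3] using h1 j
    · rw [Function.update_of_ne (by omega)]; exact h5 j hj
    · rw [hs] at h6
      simp at h6 ⊢; omega
    · rw [Function.update_of_ne (by omega)]; exact h7 j hj
  by_cases h5 : g k = []
  · have hk0 : k ≠ 0 := by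
      rintro rfl
      rw [h5] at hlen
      simp at hlen
    refine key ⟨k - 1, by omega⟩ (fun i' hi' => h2 i' (by simp at hi'; omega)) ?_ ?_
      fun i' hi' => ?_
    · exact (h2 _ (by simp; omega)).le
    · intro h
      have := h2 (k - 1) (by omega)
      simp only at h
      rw [h] at this
      simp at this; omega
    · by_cases h : i' = k
      · rw [h, h5]
      · exact h4 i' (by simp at hi'; omega)
  · exact key ⟨k, hk⟩ h2 h3 h5 h4

theorem StackGood.empty (hc : 0 < c) (h : StackGood num w c (v ∘ y) ([] : List W)) :
    EmptyRel y x v v := by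
  obtain ⟨g, k, h1, hg, hk, h2, h3, h4⟩ := h
  have hlen := length_joinSegments hk h2 h4
  rw [hg, List.length_nil] at hlen
  have h5 : k = 0 := by
    rcases Nat.eq_zero_or_pos k with h | h
    · exact h
    · have := Nat.mul_pos h hc; omega
  subst h5
  refine ⟨fun i => (h1 i).trans (stackCode_eq_zero.2 ?_), rfl⟩
  by_cases hi : (i : ℕ) = 0
  · rw [hi]; exact List.length_eq_zero_iff.1 (by omega)
  · exact h4 i (by omega)

end Stacks


/-! ### Languages of head programs -/

/-- The languages recognized by head programs. -/
def HeadLanguages (α : Type) : Set (Language α) :=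
  {L | ∃ (k : ℕ) (P : HeadProgram α (Fin k)), ∀ x, x ∈ L ↔
    ∃ v, P.Reach x (P.start, fun _ => 0) (P.final, v)}

theorem HeadLanguages.of_implementable {α ι : Type} [DecidableEq ι] [Finite ι] {L : Language α}
    {R : HeadRel α ι} (hR : Implementable R)
    (h : ∀ x, x ∈ L ↔ ∃ v, R x (fun _ => 0) v) : L ∈ HeadLanguages α := by
  obtain ⟨P, hP⟩ := hR
  obtain ⟨k, ⟨e⟩⟩ := Finite.exists_equiv_fin ι
  refine ⟨k, ⟨P.Node, P.finNode, fun a i op b => P.edge a (e.symm i) op b, P.start, P.final⟩,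
    fun x => ?_⟩
  rw [h]
  simp only [hP x (fun _ => 0) (fun _ => Nat.zero_le _)]
  constructor
  · rintro ⟨v, hv⟩
    refine ⟨v ∘ e.symm, ?_⟩
    refine Relation.ReflTransGen.lift
      (fun a : P.Node × (ι → ℕ) => (a.1, a.2 ∘ e.symm)) ?_ _ _ hv
    rintro a b ⟨i, op, p, h1, h2, h3⟩
    refine ⟨e i, op, p, by simpa using h1, by simpa using h2, ?_⟩
    funext j
    simp only [Function.comp, h3, Function.update_apply]
    simp [Equiv.symm_apply_eq]
  · rintro ⟨v, hv⟩
    refine ⟨v ∘ e, ?_⟩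
    refine Relation.ReflTransGen.lift
      (fun a : P.Node × (Fin k → ℕ) => (a.1, a.2 ∘ e)) ?_ _ _ hv
    rintro a b ⟨i, op, p, h1, h2, h3⟩
    refine ⟨e.symm i, op, p, h1, by simpa using h2, ?_⟩
    funext j
    simp only [Function.comp, h3, Function.update_apply]
    simp [Equiv.eq_symm_apply]

/-! ### Machines with several input heads -/

/-- A nondeterministic machine with finitely many input heads and finitely many work tapes. -/
structure MultiNTM (α : Type) where
  State : Type
  Work : Type
  Head : Type
  Tape : Type
  finState : Finite State
  finWork : Finite Work
  finHead : Finite Head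
  finTape : Finite Tape
  start : Set State
  accept : Set State
  blank : Work
  δ : State → (Head → Option α) → (Tape → Work) →
    Set (State × (Tape → Work) × (Head → SignType) × (Tape → SignType))

namespace MultiNTM

variable {α : Type} (M : MultiNTM α)

structure Config where
  state : M.State
  head : M.Head → ℤ
  work : M.Tape → ℤ → M.Work
  workPos : M.Tape → ℤ

def init (q : M.State) : M.Config where
  state := q
  head := fun _ => 0
  work := fun _ _ => M.blank
  workPos := fun _ => 0

/-- The effect of a move. -/
def apply (c : M.Config)
    (m : M.State × (M.Tape → M.Work) × (M.Head → SignType) × (M.Tape → SignType)) : M.Config where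
  state := m.1
  head := fun h => c.head h + (m.2.2.1 h : ℤ)
  work := fun t => Function.update (c.work t) (c.workPos t) (m.2.1 t)
  workPos := fun t => c.workPos t + (m.2.2.2 t : ℤ)

def Step (x : List α) (c c' : M.Config) : Prop :=
  ∃ m ∈ M.δ c.state (fun h => inputSymbol x (c.head h)) (fun t => c.work t (c.workPos t)),
    c' = M.apply c m

/-- The heads are on the input and the work tape heads within distance `s` from the origin. -/
def Within (x : List α) (s : ℕ) (c : M.Config) : Prop :=
  (∀ h, 0 ≤ c.head h ∧ c.head h ≤ (x.length : ℤ) + 1) ∧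
    ∀ t, -(s : ℤ) ≤ c.workPos t ∧ c.workPos t ≤ s

/-- `M` recognizes `L`, and accepts the members of `L` in space `s`. -/
def Recognizes (L : Language α) (s : ℕ → ℕ) : Prop :=
  (∀ x ∈ L, ∃ q ∈ M.start, ∃ c : M.Config, c.state ∈ M.accept ∧
    Relation.ReflTransGen (fun c c' => M.Step x c c' ∧ M.Within x (s x.length) c')
      (M.init q) c) ∧
  ∀ x, ∀ q ∈ M.start, ∀ c : M.Config, c.state ∈ M.accept →
    Relation.ReflTransGen (M.Step x) (M.init q) c → x ∈ L

end MultiNTM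

/-! ### Simulating work tapes with heads -/

/-- The words `S false` and `S true` are the parts of the tape to the left and to the right of the
position `p`, up to blanks. -/
def TapeRep {W : Type} (blank : W) (f : ℤ → W) (p : ℤ) (S : Bool → List W) : Prop :=
  (∀ i : ℕ, f (p - 1 - i) = (S false).getD i blank) ∧
    ∀ i : ℕ, f (p + 1 + i) = (S true).getD i blank

/-- The move after writing `b` away from the current cell in the direction `d`. -/
def moveLists {W : Type} (b : W) (d : SignType) (S : Bool → List W) : Bool → List W :=
  match d with
  | 0 => S
  | 1 => fun σ => bif σ then (S true).tail else b :: S false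
  | -1 => fun σ => bif σ then b :: S true else (S false).tail

/-- The symbol scanned after the move. -/
def moveSymbol {W : Type} (blank b : W) (d : SignType) (S : Bool → List W) : W :=
  match d with
  | 0 => b
  | 1 => (S true).headD blank
  | -1 => (S false).headD blank

section

variable {W : Type} {blank : W} {f : ℤ → W} {p : ℤ} {S : Bool → List W}

theorem List.getD_tail_eq {W : Type} (l : List W) (i : ℕ) (d : W) :
    l.tail.getD i d = l.getD (i + 1) d := by
  cases l <;> simp

/-- A move pushes the written symbol on the stack left behind and pops the new scanned symbol from
the other. The scanned cell is on neither stack, and blanks are understood beyond the end of a list,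
so popping an empty stack yields a blank. -/
theorem TapeRep.move (h : TapeRep blank f p S) (b : W) (d : SignType) :
    TapeRep blank (Function.update f p b) (p + d) (moveLists b d S) ∧
      Function.update f p b (p + d) = moveSymbol blank b d S := by
  obtain ⟨h1, h2⟩ := h
  have e1 : ∀ q, q ≠ p → Function.update f p b q = f q := fun q hq => Function.update_of_ne hq _ _
  have hneg : ((SignType.neg : SignType) : ℤ) = -1 := rfl
  have hpos : ((SignType.pos : SignType) : ℤ) = 1 := rfl
  rcases d with _ | _ | _
  · refine ⟨⟨fun i => ?_, fun i => ?_⟩, ?_⟩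
    · have : Function.update f p b (p - 1 - i) = f (p - 1 - i) := e1 _ (by omega)
      simpa [moveLists] using this.trans (h1 i)
    · have : Function.update f p b (p + 1 + i) = f (p + 1 + i) := e1 _ (by omega)
      simpa [moveLists] using this.trans (h2 i)
    · simp [moveSymbol]
  · refine ⟨⟨fun i => ?_, fun i => ?_⟩, ?_⟩
    · have h3 := (e1 (p - 1 - (i + 1 : ℕ)) (by omega)).trans (h1 (i + 1))
      rw [← List.getD_tail_eq] at h3
      refine Eq.trans (congrArg _ ?_) h3
      push_cast; omega
    · rcases i with _ | i
      · simp [moveLists]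
      · have h3 := (e1 (p + 1 + i) (by omega)).trans (h2 i)
        simp only [moveLists, cond_true, List.getD_cons_succ]
        rw [← h3]
        congr 1
        push_cast; omega
    · have h3 := (e1 (p - 1 - (0 : ℕ)) (by omega)).trans (h1 0)
      simp only [moveSymbol]
      rw [List.headD_eq_head?_getD, List.head?_eq_getElem?, ← List.getD_eq_getElem?_getD, ← h3]
      congr 1
      push_cast; omega
  · refine ⟨⟨fun i => ?_, fun i => ?_⟩, ?_⟩
    · rcases i with _ | i
      · simp [moveLists]
      · have h3 := (e1 (p - 1 - i) (by omega)).trans (h1 i)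
        simp only [moveLists, cond_false, List.getD_cons_succ]
        rw [← h3]
        congr 1
        push_cast; omega
    · have h3 := (e1 (p + 1 + (i + 1 : ℕ)) (by omega)).trans (h2 (i + 1))
      rw [← List.getD_tail_eq] at h3
      refine Eq.trans (congrArg _ ?_) h3
      push_cast; omega
    · have h3 := (e1 (p + 1 + (0 : ℕ)) (by omega)).trans (h2 0)
      simp only [moveSymbol]
      rw [List.headD_eq_head?_getD, List.head?_eq_getElem?, ← List.getD_eq_getElem?_getD, ← h3]
      congr 1
      push_cast; omega

/-- The two lists stay within the cells of `[-s, s]` on their side of the head. The bounds `h3` and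
`h4` on the new position are needed when the popped list is already empty. -/
theorem moveLists_length {s : ℤ} {d : SignType} (b : W)
    (h1 : ((S false).length : ℤ) ≤ s + p) (h2 : ((S true).length : ℤ) ≤ s - p)
    (h3 : -s ≤ p + (d : ℤ)) (h4 : p + (d : ℤ) ≤ s) :
    ((moveLists b d S false).length : ℤ) ≤ s + (p + d) ∧
      ((moveLists b d S true).length : ℤ) ≤ s - (p + d) := by
  rcases d with _ | _ | _
  · simpa [moveLists] using ⟨h1, h2⟩
  · simp only [moveLists, cond_true, cond_false, List.length_tail, List.length_cons,
      SignType.neg_eq_neg_one, SignType.coe_neg, SignType.coe_one] at *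
    omega
  · simp only [moveLists, cond_true, cond_false, List.length_tail, List.length_cons,
      SignType.pos_eq_one, SignType.coe_one] at *
    omega

end

section Seq

variable {α ι J : Type} [DecidableEq ι]

/-- The sequential composition of the relations `R j`, `j ∈ l`. -/
def SeqRel (R : J → HeadRel α ι) : List J → HeadRel α ι
  | [] => fun _ v v' => v' = v
  | j :: l => fun x v v' => ∃ u, R j x v u ∧ SeqRel R l x u v'

theorem implementable_seqRel [Nonempty ι] {R : J → HeadRel α ι} (h : ∀ j, Implementable (R j))
    (l : List J) : Implementable (SeqRel R l) := by
  induction l with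
  | nil => exact .eq
  | cons j l ih => exact (h j).comp ih

variable {R : J → HeadRel α ι} {owner : ι → Option J} {x : List α} {Pre Post : J → (ι → ℕ) → Prop}

theorem SeqRel.frame (hR : ∀ j v v', R j x v v' → ∀ i, owner i ≠ some j → v' i = v i)
    {l : List J} {v v' : ι → ℕ} (h : SeqRel R l x v v') {i : ι} (hi : owner i = none) :
    v' i = v i := by
  induction l generalizing v with
  | nil => rw [show v' = v from h]
  | cons j l ih =>
    obtain ⟨u, h1, h2⟩ := h
    rw [ih h2, hR j v u h1 i (by simp [hi])]

/-- The components are processed one after another, although a move changes all of them at once. As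
each touches only the heads that it owns, and conditions on a component depend only on those heads,
the order is immaterial. -/
theorem SeqRel.sound (hR : ∀ j v v', R j x v v' → ∀ i, owner i ≠ some j → v' i = v i)
    (hPre : ∀ j v v', (∀ i, owner i = some j → v' i = v i) → Pre j v → Pre j v')
    (hPost : ∀ j v v', (∀ i, owner i = some j → v' i = v i) → Post j v → Post j v')
    (hs : ∀ j v v', R j x v v' → Pre j v → Post j v') {l : List J} (hl : l.Nodup)
    {v v' : ι → ℕ} (h : SeqRel R l x v v') (h1 : ∀ j ∈ l, Pre j v) (h2 : ∀ j ∉ l, Post j v) :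
    ∀ j, Post j v' := by
  induction l generalizing v with
  | nil =>
    rw [show v' = v from h]
    exact fun j => h2 j (by simp)
  | cons j l ih =>
    obtain ⟨u, h3, h4⟩ := h
    rw [List.nodup_cons] at hl
    have hne : ∀ k ≠ j, ∀ i, owner i = some k → u i = v i := fun k hk i hi =>
      hR j v u h3 i (by rw [hi]; simpa using hk)
    refine ih hl.2 h4 (fun k hk => ?_) fun k hk => ?_
    · exact hPre k v u (hne k fun h => hl.1 (h ▸ hk)) (h1 k (by simp [hk]))
    · by_cases hkj : k = j
      · subst hkj; exact hs k v u h3 (h1 k (by simp))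
      · exact hPost k v u (hne k hkj) (h2 k (by simp [hk, hkj]))

theorem SeqRel.complete {Inv : (ι → ℕ) → Prop}
    (hR : ∀ j v v', R j x v v' → ∀ i, owner i ≠ some j → v' i = v i)
    (hPre : ∀ j v v', (∀ i, owner i = some j → v' i = v i) → Pre j v → Pre j v')
    (hPost : ∀ j v v', (∀ i, owner i = some j → v' i = v i) → Post j v → Post j v')
    (hs : ∀ j v, Inv v → Pre j v → ∃ v', R j x v v' ∧ Inv v' ∧ Post j v') {l : List J}
    (hl : l.Nodup) {v : ι → ℕ} (hv : Inv v) (h1 : ∀ j ∈ l, Pre j v) (h2 : ∀ j ∉ l, Post j v) :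
    ∃ v', SeqRel R l x v v' ∧ Inv v' ∧ ∀ j, Post j v' := by
  induction l generalizing v with
  | nil => exact ⟨v, rfl, hv, fun j => h2 j (by simp)⟩
  | cons j l ih =>
    rw [List.nodup_cons] at hl
    obtain ⟨u, h3, h4, h5⟩ := hs j v hv (h1 j (by simp))
    have hne : ∀ k ≠ j, ∀ i, owner i = some k → u i = v i := fun k hk i hi =>
      hR j v u h3 i (by rw [hi]; simpa using hk)
    obtain ⟨v', h6, h7⟩ := ih hl.2 h4 (fun k hk =>
      hPre k v u (hne k fun h => hl.1 (h ▸ hk)) (h1 k (by simp [hk]))) fun k hk => by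
        by_cases hkj : k = j
        · subst hkj; exact h5
        · exact hPost k v u (hne k hkj) (h2 k (by simp [hk, hkj]))
    exact ⟨v', ⟨u, h3, h6⟩, h7⟩

end Seq


/-! ### Simulating machines with several input heads -/

section Shift

variable {α ι : Type} [DecidableEq ι]

/-- Move the head `i` in the direction `d`. -/
def ShiftRel (i : ι) (d : SignType) : HeadRel α ι := fun x v v' =>
  0 ≤ (v i : ℤ) + d ∧ (v i : ℤ) + d ≤ x.length + 1 ∧
    v' = Function.update v i ((v i : ℤ) + d).toNat

theorem implementable_shiftRel [Nonempty ι] (i : ι) (d : SignType) :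
    Implementable (ShiftRel (α := α) i d) := by
  rcases d with _ | _ | _
  · refine Implementable.eq.congr fun x v hv v' => ?_
    have := hv i
    have h2 : (v i : ℤ) ≤ x.length + 1 := by omega
    simp [ShiftRel, h2]
  · refine (Implementable.dec i).congr fun x v hv v' => ?_
    have := hv i
    have e : ((SignType.neg : SignType) : ℤ) = -1 := rfl
    have e2 : ((v i : ℤ) + -1).toNat = v i - 1 := by omega
    simp only [ShiftRel, e, e2]
    refine ⟨fun ⟨h1, h2, h3⟩ => ⟨by omega, h3⟩, fun ⟨h1, h2⟩ => ⟨by omega, by omega, h2⟩⟩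
  · refine (Implementable.inc i).congr fun x v hv v' => ?_
    have := hv i
    have e : ((SignType.pos : SignType) : ℤ) = 1 := rfl
    have e2 : ((v i : ℤ) + 1).toNat = v i + 1 := by omega
    simp only [ShiftRel, e, e2]
    refine ⟨fun ⟨h1, h2, h3⟩ => ⟨by omega, h3⟩, fun ⟨h1, h2⟩ => ⟨by omega, by omega, h2⟩⟩

end Shift

section StackPop

variable {α ι W : Type} [DecidableEq ι] {B : ℕ}

/-- Pop the symbol `a`, where the empty stack yields the blank symbol. -/
def PopBlankRel (num : W → ℕ) (w : ℕ) (blank : W) (y : Fin B → ι) (z : ι) (a : W) :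
    HeadRel α ι := fun x v v' =>
  PopRel y z w (num a + 1) x v v' ∨ (a = blank ∧ EmptyRel y x v v')

variable {num : W → ℕ} {w : ℕ} {blank : W} {y : Fin B → ι} {z : ι} {x : List α} {v v' : ι → ℕ}

theorem implementable_popBlankRel [Nonempty ι] (hw : 0 < w) (hz : ∀ i, y i ≠ z) (a : W) :
    Implementable (PopBlankRel (α := α) num w blank y z a) :=
  (implementable_popRel hz hw _).union (.guard _ fun _ => implementable_emptyRel y)

theorem StackEnc.popBlank (hw : ∀ a, num a < w) (hn : num.Injective) (hy : y.Injective)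
    {l : List W} (h : StackEnc num w (v ∘ y) l) {a : W}
    (hp : PopBlankRel num w blank y z a x v v') :
    a = l.headD blank ∧ StackEnc num w (v' ∘ y) l.tail := by
  rcases hp with hp | ⟨rfl, hp⟩
  · obtain ⟨l', rfl, h2⟩ := h.pop hw hn hy hp
    exact ⟨rfl, h2⟩
  · have := h.empty hp
    subst this
    rw [hp.2]
    exact ⟨rfl, h⟩

theorem StackGood.popBlank {c : ℕ} (hy : y.Injective) (hc : 0 < c) {l : List W}
    (h : StackGood num w c (v ∘ y) l) (hz : v z = 0) :
    ∃ v', PopBlankRel num w blank y z (l.headD blank) x v v' ∧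
      StackGood num w c (v' ∘ y) l.tail := by
  cases l with
  | nil => exact ⟨v, .inr ⟨rfl, h.empty hc⟩, h⟩
  | cons a l =>
    obtain ⟨v', h1, h2⟩ := h.pop (x := x) hy hc hz
    exact ⟨v', .inl h1, h2⟩

theorem PushRel.frame {c : ℕ} (h : PushRel y z w c x v v') {j : ι} (hj : ∀ i, y i ≠ j) :
    v' j = v j := by
  obtain ⟨i, -, -, -, rfl⟩ := h
  exact Function.update_of_ne (hj i).symm _ _

theorem PopBlankRel.frame {a : W} (h : PopBlankRel num w blank y z a x v v') {j : ι}
    (hj : ∀ i, y i ≠ j) : v' j = v j := by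
  rcases h with ⟨i, -, -, t, -, rfl⟩ | ⟨-, -, rfl⟩
  · exact Function.update_of_ne (hj i).symm _ _
  · rfl

end StackPop

namespace MultiNTM

variable {α : Type} (M : MultiNTM α) (B : ℕ)

/-- The heads of the simulation: a scratch head, the heads of the machine, and the heads holding
the segments of the two stacks of each tape. -/
abbrev Var : Type := Option (M.Head ⊕ M.Tape × Bool × Fin B)

variable {M B}

/-- The heads holding the part of a tape on one side. -/
def seg (t : M.Tape) (σ : Bool) (i : Fin B) : M.Var B := some (.inr (t, σ, i))

theorem seg_injective (t : M.Tape) (σ : Bool) : (seg (B := B) t σ).Injective := by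
  intro i j h
  simpa [seg] using h

/-- The component of the machine to which a head of the simulation belongs. -/
def owner : M.Var B → Option (M.Head ⊕ M.Tape)
  | none => none
  | some (.inl h) => some (.inl h)
  | some (.inr (t, _, _)) => some (.inr t)

theorem seg_ne {t : M.Tape} {j : M.Var B} (h : owner j ≠ some (.inr t)) (σ : Bool) (i : Fin B) :
    seg t σ i ≠ j := by
  rintro rfl
  exact h rfl

variable [DecidableEq M.Head] [DecidableEq M.Tape] (num : M.Work → ℕ) (w : ℕ)

/-- Write `b` on the tape `t` and move in the direction `d`, where the symbol `a` is found. -/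
def TapeRel (t : M.Tape) (b : M.Work) (d : SignType) (a : M.Work) : HeadRel α (M.Var B) :=
  match d with
  | 0 => fun _ v v' => a = b ∧ v' = v
  | 1 => fun x v v' => ∃ u, PushRel (seg t false) none w (num b + 1) x v u ∧
      PopBlankRel num w M.blank (seg t true) none a x u v'
  | -1 => fun x v v' => ∃ u, PushRel (seg t true) none w (num b + 1) x v u ∧
      PopBlankRel num w M.blank (seg t false) none a x u v'

variable {num w}

theorem implementable_tapeRel (hw : 0 < w) (t : M.Tape) (b : M.Work) (d : SignType)
    (a : M.Work) : Implementable (TapeRel (B := B) num w t b d a) := by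
  have hz : ∀ σ (i : Fin B), seg t σ i ≠ none := fun σ i => by simp [seg]
  rcases d with _ | _ | _
  · exact .guard _ fun _ => .eq
  · exact (implementable_pushRel (hz _) _ _).comp (implementable_popBlankRel hw (hz _) _)
  · exact (implementable_pushRel (hz _) _ _).comp (implementable_popBlankRel hw (hz _) _)

theorem TapeRel.frame {t : M.Tape} {b : M.Work} {d : SignType} {a : M.Work} {x : List α}
    {v v' : M.Var B → ℕ} (h : TapeRel num w t b d a x v v') {j : M.Var B}
    (hj : owner j ≠ some (.inr t)) : v' j = v j := by
  rcases d with _ | _ | _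
  · rw [h.2]
  · obtain ⟨u, h1, h2⟩ := h
    rw [h2.frame (seg_ne hj _), h1.frame (seg_ne hj _)]
  · obtain ⟨u, h1, h2⟩ := h
    rw [h2.frame (seg_ne hj _), h1.frame (seg_ne hj _)]

omit [DecidableEq M.Head] [DecidableEq M.Tape] in
theorem seg_ne_seg (t : M.Tape) {σ τ : Bool} (h : σ ≠ τ) (i j : Fin B) :
    seg t σ i ≠ seg t τ j := by
  simp [seg, h]

theorem TapeRel.sound (hw : ∀ a, num a < w) (hn : num.Injective) {t : M.Tape} {b : M.Work}
    {d : SignType} {a : M.Work} {x : List α} {v v' : M.Var B → ℕ}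
    (h : TapeRel num w t b d a x v v') {S : Bool → List M.Work}
    (hS : ∀ σ, StackEnc num w (v ∘ seg t σ) (S σ)) :
    (∀ σ, StackEnc num w (v' ∘ seg t σ) (moveLists b d S σ)) ∧
      a = moveSymbol M.blank b d S := by
  rcases d with _ | _ | _
  · obtain ⟨h1, h2⟩ := h
    rw [h2]
    exact ⟨hS, h1⟩
  all_goals
    obtain ⟨u, h1, h2⟩ := h
    have h3 := fun σ => (hS σ).push (z := none) (seg_injective t σ) (a := b) (x := x) (v' := u)
    have f1 := fun (σ τ : Bool) (hστ : σ ≠ τ) (h : PushRel (seg t σ) none w (num b + 1) x v u) =>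
      (show u ∘ seg t τ = v ∘ seg t τ from
        funext fun i => h.frame fun j => seg_ne_seg t hστ j i)
    have f2 := fun (σ τ : Bool) (hστ : σ ≠ τ)
        (h : PopBlankRel num w M.blank (seg t σ) none a x u v') =>
      (show v' ∘ seg t τ = u ∘ seg t τ from
        funext fun i => h.frame fun j => seg_ne_seg t hστ j i)
  · have h4 := h3 true h1
    have h5 : StackEnc num w (u ∘ seg t false) (S false) := by
      rw [f1 true false (by simp) h1]; exact hS false
    obtain ⟨h6, h7⟩ := h5.popBlank hw hn (seg_injective t false) h2
    refine ⟨?_, h6⟩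
    rintro (_ | _)
    · exact h7
    · rw [f2 false true (by simp) h2]; exact h4
  · have h4 := h3 false h1
    have h5 : StackEnc num w (u ∘ seg t true) (S true) := by
      rw [f1 false true (by simp) h1]; exact hS true
    obtain ⟨h6, h7⟩ := h5.popBlank hw hn (seg_injective t true) h2
    refine ⟨?_, h6⟩
    rintro (_ | _)
    · rw [f2 true false (by simp) h2]; exact h4
    · exact h7

theorem TapeRel.complete (hw : ∀ a, num a < w) {c : ℕ} (hc : 0 < c) {t : M.Tape}
    {x : List α} (hx : (w + 1) ^ c ≤ x.length + 2) {v : M.Var B → ℕ} {S : Bool → List M.Work}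
    (hS : ∀ σ, StackGood num w c (v ∘ seg t σ) (S σ)) (hl : ∀ σ, (S σ).length < B * c)
    (hv : v none = 0) (b : M.Work) (d : SignType) :
    ∃ v', TapeRel num w t b d (moveSymbol M.blank b d S) x v v' ∧
      ∀ σ, StackGood num w c (v' ∘ seg t σ) (moveLists b d S σ) := by
  rcases d with _ | _ | _
  · exact ⟨v, ⟨rfl, rfl⟩, hS⟩
  all_goals
    have key : ∀ σ τ : Bool, σ ≠ τ → ∃ u v', PushRel (seg t σ) none w (num b + 1) x v u ∧
        PopBlankRel num w M.blank (seg t τ) none ((S τ).headD M.blank) x u v' ∧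
        StackGood num w c (v' ∘ seg t σ) (b :: S σ) ∧
        StackGood num w c (v' ∘ seg t τ) (S τ).tail := by
      intro σ τ hστ
      obtain ⟨u, h1, h2⟩ := (hS σ).push hw (seg_injective t σ) hc (hl σ) hv hx b
      have f1 : u ∘ seg t τ = v ∘ seg t τ :=
        funext fun i => h1.frame fun j => seg_ne_seg t hστ j i
      have hu : u none = 0 := by rw [← hv]; exact h1.frame fun j => by simp [seg]
      obtain ⟨v', h3, h4⟩ := StackGood.popBlank (x := x) (blank := M.blank) (seg_injective t τ) hc
        (f1 ▸ hS τ : StackGood num w c (u ∘ seg t τ) (S τ)) hu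
      have f2 : v' ∘ seg t σ = u ∘ seg t σ :=
        funext fun i => h3.frame fun j => seg_ne_seg t hστ.symm j i
      exact ⟨u, v', h1, h3, f2 ▸ h2, h4⟩
  · obtain ⟨u, v', h1, h2, h3, h4⟩ := key true false (by simp)
    exact ⟨v', ⟨u, h1, h2⟩, by rintro (_ | _); exacts [h4, h3]⟩
  · obtain ⟨u, v', h1, h2, h3, h4⟩ := key false true (by simp)
    exact ⟨v', ⟨u, h1, h2⟩, by rintro (_ | _); exacts [h3, h4]⟩

variable (num w) in
/-- The action of a move `m` on one component, if `σ` are the symbols read from the input and `a`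
the symbols that are found on the tapes after the move. -/
def ComponentRel (σ : M.Head → Option α)
    (m : M.State × (M.Tape → M.Work) × (M.Head → SignType) × (M.Tape → SignType))
    (a : M.Tape → M.Work) : M.Head ⊕ M.Tape → HeadRel α (M.Var B)
  | .inl h => fun x v v' => inputSymbol x (v (some (.inl h))) = σ h ∧
      ShiftRel (some (.inl h)) (m.2.2.1 h) x v v'
  | .inr t => TapeRel num w t (m.2.1 t) (m.2.2.2 t) (a t)

variable {σ : M.Head → Option α}
  {m : M.State × (M.Tape → M.Work) × (M.Head → SignType) × (M.Tape → SignType)}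
  {a : M.Tape → M.Work} {x : List α}

theorem implementable_componentRel (hw : 0 < w) (j : M.Head ⊕ M.Tape) :
    Implementable (ComponentRel (B := B) num w σ m a j) := by
  rcases j with h | t
  · refine ((Implementable.sym (some (.inl h)) (σ h)).comp
      (implementable_shiftRel (some (.inl h)) (m.2.2.1 h))).congr fun x v hv v' => ⟨?_, ?_⟩
    · rintro ⟨h1, h2⟩
      exact ⟨v, ⟨h1, rfl⟩, h2⟩
    · rintro ⟨_, ⟨h1, rfl⟩, h2⟩
      exact ⟨h1, h2⟩
  · exact implementable_tapeRel hw _ _ _ _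

theorem ComponentRel.frame (j : M.Head ⊕ M.Tape) (v v' : M.Var B → ℕ)
    (h : ComponentRel num w σ m a j x v v') (i : M.Var B) (hi : owner i ≠ some j) :
    v' i = v i := by
  rcases j with k | t
  · obtain ⟨-, -, -, rfl⟩ := h
    refine Function.update_of_ne ?_ _ _
    rintro rfl
    exact hi rfl
  · exact TapeRel.frame h hi

variable (num w) in
/-- The heads of the simulation represent one component of the configuration `c`. -/
def CompEnc (c : M.Config) : M.Head ⊕ M.Tape → (M.Var B → ℕ) → Prop
  | .inl h, v => (v (some (.inl h)) : ℤ) = c.head h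
  | .inr t, v => ∃ S, TapeRep M.blank (c.work t) (c.workPos t) S ∧
      ∀ σ, StackEnc num w (v ∘ seg t σ) (S σ)

variable (num w) in
/-- The form of `CompEnc` with bounded segments of the stacks. -/
def CompGood (k s : ℕ) (c : M.Config) : M.Head ⊕ M.Tape → (M.Var B → ℕ) → Prop
  | .inl h, v => (v (some (.inl h)) : ℤ) = c.head h
  | .inr t, v => ∃ S, TapeRep M.blank (c.work t) (c.workPos t) S ∧
      ((S false).length : ℤ) ≤ s + c.workPos t ∧ ((S true).length : ℤ) ≤ s - c.workPos t ∧
      ∀ σ, StackGood num w k (v ∘ seg t σ) (S σ)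

omit [DecidableEq M.Head] [DecidableEq M.Tape] in
theorem CompEnc.of_eq {c : M.Config} (j : M.Head ⊕ M.Tape) (v v' : M.Var B → ℕ)
    (h : ∀ i, owner i = some j → v' i = v i) (hv : CompEnc num w c j v) :
    CompEnc num w c j v' := by
  rcases j with k | t
  · rwa [CompEnc, h (some (.inl k)) rfl]
  · obtain ⟨S, h1, h2⟩ := hv
    refine ⟨S, h1, fun σ => ?_⟩
    have : v' ∘ seg t σ = v ∘ seg t σ := funext fun i => h (seg t σ i) rfl
    rw [this]
    exact h2 σ

omit [DecidableEq M.Head] [DecidableEq M.Tape] in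
theorem CompGood.of_eq {c : M.Config} {k s : ℕ} (j : M.Head ⊕ M.Tape) (v v' : M.Var B → ℕ)
    (h : ∀ i, owner i = some j → v' i = v i) (hv : CompGood num w k s c j v) :
    CompGood num w k s c j v' := by
  rcases j with k | t
  · rwa [CompGood, h (some (.inl k)) rfl]
  · obtain ⟨S, h1, h2, h3, h4⟩ := hv
    refine ⟨S, h1, h2, h3, fun σ => ?_⟩
    have : v' ∘ seg t σ = v ∘ seg t σ := funext fun i => h (seg t σ i) rfl
    rw [this]
    exact h4 σ

variable (m σ a x) in
/-- The input symbols that the components read before the move and the tape symbols after it. -/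
def Reads (c : M.Config) : M.Head ⊕ M.Tape → Prop
  | .inl h => inputSymbol x (c.head h) = σ h
  | .inr t => (M.apply c m).work t ((M.apply c m).workPos t) = a t

/-- `Reads` records that the guesses made by an edge were verified: an input symbol by a test before
the head moves, a tape symbol when it is popped after the move. -/
theorem ComponentRel.sound (hw : ∀ a, num a < w) (hn : num.Injective) {c : M.Config}
    (j : M.Head ⊕ M.Tape) (v v' : M.Var B → ℕ) (h : ComponentRel num w σ m a j x v v')
    (hv : CompEnc num w c j v) :
    CompEnc num w (M.apply c m) j v' ∧ Reads σ m a x c j := by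
  rcases j with k | t
  · obtain ⟨h1, h2, h3, rfl⟩ := h
    simp only [CompEnc] at hv
    rw [hv] at h1 h2
    refine ⟨?_, h1⟩
    simp only [CompEnc, Function.update_self, apply]
    rw [hv]
    omega
  · obtain ⟨S, h1, h2⟩ := hv
    obtain ⟨h3, h4⟩ := TapeRel.sound hw hn h h2
    obtain ⟨h5, h6⟩ := h1.move (m.2.1 t) (m.2.2.2 t)
    exact ⟨⟨_, h5, h3⟩, h6.trans h4.symm⟩

/-- While the tape head is within distance `s` of the origin, a stack has at most `2 * s` letters,
fewer than the capacity `B * k` of its segments. -/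
theorem ComponentRel.complete (hw : ∀ a, num a < w) {k s : ℕ} (hk : 0 < k) (hs : 2 * s < B * k)
    (hx : (w + 1) ^ k ≤ x.length + 2) {c : M.Config} (hc : M.Within x s (M.apply c m))
    (hr : ∀ j, Reads σ m a x c j)
    (j : M.Head ⊕ M.Tape) (v : M.Var B → ℕ) (hz : v none = 0)
    (hv : CompGood num w k s c j v) (hp : ∀ t, -(s : ℤ) ≤ c.workPos t ∧ c.workPos t ≤ s) :
    ∃ v', ComponentRel num w σ m a j x v v' ∧ v' none = 0 ∧
      CompGood num w k s (M.apply c m) j v' := by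
  rcases j with i | t
  · simp only [CompGood] at hv
    have h1 := hr (.inl i)
    have h2 := hc.1 i
    simp only [apply] at h2
    refine ⟨_, ⟨by rw [hv]; exact h1, ?_, ?_, rfl⟩, ?_, ?_⟩
    · rw [hv]; exact h2.1
    · rw [hv]; exact h2.2
    · simpa using hz
    · simp only [CompGood, Function.update_self, apply]
      rw [hv]
      omega
  · obtain ⟨S, h1, h2, h3, h4⟩ := hv
    have h0 := hp t
    have hl : ∀ σ, (S σ).length < B * k := by
      rintro (_ | _) <;> omega
    obtain ⟨v', h5, h6⟩ := TapeRel.complete hw hk hx h4 hl hz (m.2.1 t) (m.2.2.2 t)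
    obtain ⟨h7, h8⟩ := h1.move (m.2.1 t) (m.2.2.2 t)
    have h9 := moveLists_length (m.2.1 t) h2 h3 (hc.2 t).1 (hc.2 t).2
    rw [show moveSymbol M.blank (m.2.1 t) (m.2.2.2 t) S = a t from h8.symm.trans (hr (.inr t))] at h5
    exact ⟨v', h5, (h5.frame (by simp [owner])).trans hz, _, h7, h9.1, h9.2, h6⟩

end MultiNTM


/-! ### Capacity of the segments, and comparison of the input with a fixed word -/

theorem exists_segments_of_mem_logBound {s : ℕ → ℕ} (hs : s ∈ logBound) {b : ℕ} (hb : 2 ≤ b) :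
    ∃ B n₀ : ℕ, ∀ n ≥ n₀, ∃ k, 0 < k ∧ 2 * s n < B * k ∧ b ^ k ≤ n + 2 := by
  obtain ⟨C, hC⟩ := hs.bound
  obtain ⟨n₀, hn₀⟩ := eventually_atTop.1 hC
  -- With `k = Nat.log b (n + 2)` one has `log n ≤ (k + 1) * log b ≤ 2 * k * log b`, hence `2 * s n
  -- ≤ 4 * |C| * log b * k`. The threshold `b` makes `k` positive.
  refine ⟨⌈4 * |C| * Real.log b⌉₊ + 1, max n₀ b, fun n hn => ?_⟩
  have h1 := hn₀ n (le_trans (le_max_left _ _) hn)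
  have hbn : b ≤ n := le_trans (le_max_right _ _) hn
  have hk : 0 < Nat.log b (n + 2) := Nat.log_pos (by omega) (by omega)
  refine ⟨Nat.log b (n + 2), hk, ?_, Nat.pow_log_le_self b (by omega)⟩
  set k := Nat.log b (n + 2)
  have h2 : n + 2 < b ^ (k + 1) := Nat.lt_pow_succ_log_self (by omega) _
  have hn1 : (1 : ℝ) ≤ n := by exact_mod_cast (by omega : 1 ≤ n)
  have hlogb : 0 ≤ Real.log b := Real.log_nonneg (by exact_mod_cast (by omega : 1 ≤ b))
  have hlogn : 0 ≤ Real.log n := Real.log_nonneg hn1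
  have h3 : Real.log n ≤ (k + 1) * Real.log b := by
    have h4 : (n : ℝ) ≤ (b : ℝ) ^ (k + 1) := by exact_mod_cast (by omega : n ≤ b ^ (k + 1))
    have h5 := Real.log_le_log (by linarith) h4
    rw [Real.log_pow] at h5
    exact_mod_cast h5
  have hk1 : (1 : ℝ) ≤ k := by exact_mod_cast hk
  rw [Real.norm_eq_abs, Real.norm_eq_abs, abs_of_nonneg hlogn,
    abs_of_nonneg (Nat.cast_nonneg _)] at h1
  have h4 : (s n : ℝ) ≤ |C| * (2 * k * Real.log b) := by
    refine h1.trans ((mul_le_mul_of_nonneg_right (le_abs_self C) hlogn).trans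
      (mul_le_mul_of_nonneg_left (h3.trans ?_) (abs_nonneg C)))
    exact mul_le_mul_of_nonneg_right (by linarith) hlogb
  have h5 := Nat.le_ceil (4 * |C| * Real.log b)
  have h6 : (2 * s n : ℝ) < ((⌈4 * |C| * Real.log b⌉₊ + 1 : ℕ) : ℝ) * k := by
    push_cast
    have := mul_le_mul_of_nonneg_right h5 (by linarith : (0 : ℝ) ≤ k)
    nlinarith
  exact_mod_cast h6

theorem inputSymbol_succ {α : Type} (x : List α) (p : ℕ) :
    inputSymbol x ((p + 1 : ℕ) : ℤ) = x[p]? := by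
  simp [inputSymbol]

/-- Compare the input to the right of the head `i` with the word `y`. -/
theorem Implementable.word {α ι : Type} [DecidableEq ι] [Nonempty ι] (i : ι) (y : List α) :
    Implementable fun (x : List α) v v' => v i ≤ x.length ∧ x.drop (v i) = y ∧
      v' = Function.update v i (x.length + 1) := by
  induction y with
  | nil =>
    refine ((Implementable.inc i).comp (.sym i none)).congr fun x v hv v' => ⟨?_, ?_⟩
    · rintro ⟨h1, h2, rfl⟩
      have h3 : v i = x.length := by simp at h2; omega
      exact ⟨_, ⟨h1, rfl⟩, by
        rw [Function.update_self, inputSymbol_succ, List.getElem?_eq_none_iff]; omega, by rw [h3]⟩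
    · rintro ⟨_, ⟨h1, rfl⟩, h2, rfl⟩
      rw [Function.update_self, inputSymbol_succ, List.getElem?_eq_none_iff] at h2
      have h3 : v i = x.length := by omega
      exact ⟨h1, by simp [h3], by rw [h3]⟩
  | cons b y ih =>
    refine (((Implementable.inc i).comp (.sym i (some b))).comp ih).congr
      fun x v hv v' => ⟨?_, ?_⟩
    · rintro ⟨h1, h2, rfl⟩
      have h3 : v i < x.length := by
        by_contra h
        rw [List.drop_eq_nil_of_le (by omega)] at h2
        simp at h2
      rw [List.drop_eq_getElem_cons h3] at h2
      obtain ⟨h4, h5⟩ := List.cons.inj h2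
      refine ⟨_, ⟨_, ⟨h1, rfl⟩, ?_, rfl⟩, ?_, ?_, ?_⟩
      · rw [Function.update_self, inputSymbol_succ, List.getElem?_eq_getElem h3, h4]
      · simp; omega
      · simpa using h5
      · simp
    · rintro ⟨_, ⟨_, ⟨h1, rfl⟩, h2, rfl⟩, h3, h4, rfl⟩
      rw [Function.update_self, inputSymbol_succ] at h2
      obtain ⟨h5, h6⟩ := List.getElem?_eq_some_iff.1 h2
      rw [Function.update_self] at h3 h4
      refine ⟨h1, ?_, by simp⟩
      rw [List.drop_eq_getElem_cons h5, h6, h4]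

/-- The input has length at least `n`. -/
theorem Implementable.le_length {α ι : Type} [DecidableEq ι] [Nonempty ι] (i : ι) (n : ℕ) :
    Implementable fun (x : List α) v v' => v i + n ≤ x.length ∧ v' = v := by
  refine ((Implementable.add i (n + 1)).comp (.sub i (n + 1))).congr fun x v hv v' => ⟨?_, ?_⟩
  · rintro ⟨h1, rfl⟩
    exact ⟨_, ⟨by omega, rfl⟩, by simp, by simp⟩
  · rintro ⟨_, ⟨h1, rfl⟩, h2, rfl⟩
    exact ⟨by omega, by simp⟩

/-! ### The flow graph that simulates a machine with several input heads -/

namespace MultiNTM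

variable {α : Type} {M : MultiNTM α}

theorem CompEnc.init {num : M.Work → ℕ} {w B : ℕ} (q : M.State) (j : M.Head ⊕ M.Tape) :
    CompEnc (B := B) num w (M.init q) j (fun _ => 0) := by
  rcases j with h | t
  · rfl
  · exact ⟨fun _ => [], ⟨fun _ => rfl, fun _ => rfl⟩, fun _ => stackEnc_nil⟩

theorem CompGood.init {num : M.Work → ℕ} {w B k s : ℕ} (hB : 0 < B) (q : M.State)
    (j : M.Head ⊕ M.Tape) :
    CompGood (B := B) num w k s (M.init q) j (fun _ => 0) := by
  rcases j with h | t
  · rfl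
  · exact ⟨fun _ => [], ⟨fun _ => rfl, fun _ => rfl⟩, by simp [MultiNTM.init],
      by simp [MultiNTM.init], fun _ => stackGood_nil hB⟩

variable (M)

/-- The nodes of the simulation: the start, the end, and the states of the machine together with
the scanned work symbols. -/
abbrev SimNode : Type := Bool ⊕ M.State × (M.Tape → M.Work)

/-- The transitions of the machine, with the symbols found on the tapes afterwards. -/
abbrev SimMove : Type :=
  {e : M.State × (M.Tape → M.Work) × (M.Head → Option α) ×
    (M.State × (M.Tape → M.Work) × (M.Head → SignType) × (M.Tape → SignType)) ×
    (M.Tape → M.Work) // e.2.2.2.1 ∈ M.δ e.1 e.2.2.1 e.2.1}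

/-- The edges of the simulation: start in a state, move, accept, or accept a short word. -/
abbrev SimEdge (F : Set (List α)) : Type :=
  (M.start ⊕ M.SimMove) ⊕ ({a : M.State × (M.Tape → M.Work) // a.1 ∈ M.accept} ⊕ F)

def simSrc (F : Set (List α)) : M.SimEdge F → M.SimNode
  | .inl (.inl _) => .inl false
  | .inl (.inr e) => .inr (e.1.1, e.1.2.1)
  | .inr (.inl a) => .inr a.1
  | .inr (.inr _) => .inl false

def simTgt (F : Set (List α)) : M.SimEdge F → M.SimNode
  | .inl (.inl q) => .inr (q.1, fun _ => M.blank)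
  | .inl (.inr e) => .inr (e.1.2.2.2.1.1, e.1.2.2.2.2)
  | .inr (.inl _) => .inl true
  | .inr (.inr _) => .inl true

variable [DecidableEq M.Head] [DecidableEq M.Tape]

/-- The space bound is available only for long inputs, so the start edge requires length at least
`n₀`; the finitely many shorter members are listed in `F` and compared letter by letter. The scratch
head `none` stands at 0 at the start, so the word compared is the whole input. -/
def simRel (num : M.Work → ℕ) (w B n₀ : ℕ) (l : List (M.Head ⊕ M.Tape)) (F : Set (List α)) :
    M.SimEdge F → HeadRel α (M.Var B)
  | .inl (.inl _) => fun x v v' => v none + n₀ ≤ x.length ∧ v' = v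
  | .inl (.inr e) => SeqRel (ComponentRel num w e.1.2.2.1 e.1.2.2.2.1 e.1.2.2.2.2) l
  | .inr (.inl _) => fun _ v v' => v' = v
  | .inr (.inr y) => fun x v v' => v none ≤ x.length ∧ x.drop (v none) = y ∧
      v' = Function.update v none (x.length + 1)

theorem implementable_simRel {num : M.Work → ℕ} {w B n₀ : ℕ} (hw : 0 < w)
    {l : List (M.Head ⊕ M.Tape)} {F : Set (List α)} (e : M.SimEdge F) :
    Implementable (M.simRel num w B n₀ l F e) := by
  rcases e with (q | e) | (a | y)
  · exact .le_length none n₀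
  · exact implementable_seqRel (implementable_componentRel hw) l
  · exact .eq
  · exact .word none _

variable {M}

/-- No space bound enters: whatever segments are guessed, a run of the graph traces a genuine run of
the machine. The node supplies the state and the scanned work symbols, the valuation supplies
everything else. -/
theorem simRel_sound {L : Language α} {s : ℕ → ℕ} (h : M.Recognizes L s) {num : M.Work → ℕ}
    {w B n₀ : ℕ} (hw : ∀ a, num a < w) (hn : num.Injective) {l : List (M.Head ⊕ M.Tape)}
    (hl : l.Nodup) (hmem : ∀ j, j ∈ l) {F : Set (List α)} (hF : ∀ y ∈ F, y ∈ L) {x : List α}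
    {b : M.SimNode × (M.Var B → ℕ)}
    (hb : Relation.ReflTransGen (GraphStep (M.simSrc F) (M.simTgt F) (M.simRel num w B n₀ l F) x)
      (.inl false, fun _ => 0) b) :
    match b.1 with
    | .inl false => b.2 = fun _ => 0
    | .inl true => x ∈ L
    | .inr (q, a) => b.2 none = 0 ∧ ∃ q₀ ∈ M.start, ∃ c : M.Config,
        Relation.ReflTransGen (M.Step x) (M.init q₀) c ∧ c.state = q ∧
        (∀ t, c.work t (c.workPos t) = a t) ∧ ∀ j, CompEnc num w c j b.2 := by
  induction hb with
  | refl => rfl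
  | @tail b b' _ hb' ih =>
    obtain ⟨e, h1, h2, h3⟩ := hb'
    obtain ⟨b1, v⟩ := b
    obtain ⟨b1', v'⟩ := b'
    simp only at h1 h2 h3
    subst h1 h2
    rcases e with (q | e) | (a | y)
    · replace ih : v = fun _ => 0 := ih
      obtain ⟨-, rfl⟩ := h3
      subst ih
      exact ⟨rfl, q.1, q.2, _, .refl, rfl, fun _ => rfl, fun j => CompEnc.init q.1 j⟩
    · obtain ⟨hz, q₀, hq₀, c, hc, hq, ha, hv⟩ := ih
      have hfr := SeqRel.frame (owner := owner) (R := ComponentRel num w _ _ _)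
        (fun j v v' h => ComponentRel.frame j v v' h) h3 (i := none) rfl
      have hs := SeqRel.sound (owner := owner) (R := ComponentRel num w _ _ _)
        (fun j v v' h => ComponentRel.frame j v v' h)
        (Pre := CompEnc num w c)
        (Post := fun j v => CompEnc num w (M.apply c e.1.2.2.2.1) j v ∧
          Reads e.1.2.2.1 e.1.2.2.2.1 e.1.2.2.2.2 x c j)
        CompEnc.of_eq (fun j v v' h hv => ⟨CompEnc.of_eq j v v' h hv.1, hv.2⟩)
        (fun j v v' h hv => ComponentRel.sound hw hn j v v' h hv) hl h3
        (fun j _ => hv j) (fun j hj => absurd (hmem j) hj)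
      refine ⟨hfr.trans hz, q₀, hq₀, _, hc.tail ⟨e.1.2.2.2.1, ?_, rfl⟩, rfl,
        fun t => (hs (.inr t)).2, fun j => (hs j).1⟩
      have e1 : (fun h => inputSymbol x (c.head h)) = e.1.2.2.1 :=
        funext fun k => (hs (.inl k)).2
      have e2 : (fun t => c.work t (c.workPos t)) = e.1.2.1 := funext ha
      rw [e1, e2, hq]
      exact e.2
    · obtain ⟨hz, q₀, hq₀, c, hc, hq, ha, hv⟩ := ih
      exact h.2 x q₀ hq₀ c (hq ▸ a.2) hc
    · obtain ⟨-, h4, -⟩ := h3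
      replace ih : v = fun _ => 0 := ih
      subst ih
      have : x = y := by simpa using h4
      exact this ▸ hF _ y.2

/-- A computation within space `s` never exhausts the segments, so the canonical cutting can be
maintained. `Within` is part of the induction because a move is simulated under a bound on the
position that precedes it. -/
theorem simRel_complete {num : M.Work → ℕ} {s k : ℕ}
    {w B n₀ : ℕ} (hw : ∀ a, num a < w) {l : List (M.Head ⊕ M.Tape)}
    (hl : l.Nodup) (hmem : ∀ j, j ∈ l) {F : Set (List α)} {x : List α}
    (hk : 0 < k) (hs : 2 * s < B * k) (hx : (w + 1) ^ k ≤ x.length + 2) (hx' : n₀ ≤ x.length)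
    {q : M.State} (hq : q ∈ M.start) {c : M.Config}
    (hc : Relation.ReflTransGen (fun c c' => M.Step x c c' ∧ M.Within x s c') (M.init q) c) :
    M.Within x s c ∧ ∃ v, v none = 0 ∧ (∀ j, CompGood num w k s c j v) ∧
      Relation.ReflTransGen (GraphStep (M.simSrc F) (M.simTgt F) (M.simRel num w B n₀ l F) x)
        (.inl false, fun _ => 0) (.inr (c.state, fun t => c.work t (c.workPos t)), v) := by
  induction hc with
  | refl =>
    refine ⟨⟨fun h => ?_, fun t => ?_⟩, fun _ => 0, rfl, fun j => CompGood.init ?_ q j,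
      .single ⟨.inl (.inl ⟨q, hq⟩), rfl, rfl, ?_, rfl⟩⟩
    · simp [MultiNTM.init]; omega
    · simp [MultiNTM.init]
    · exact Nat.pos_of_mul_pos_right (Nat.zero_lt_of_lt hs)
    · simpa using hx'
  | @tail c c' _ hc' ih =>
    obtain ⟨hin, v, hz, hv, hr⟩ := ih
    obtain ⟨⟨m, hm, rfl⟩, hin'⟩ := hc'
    let e : M.SimMove := ⟨(c.state, fun t => c.work t (c.workPos t),
      fun h => inputSymbol x (c.head h), m,
      fun t => (M.apply c m).work t ((M.apply c m).workPos t)), hm⟩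
    have hreads : ∀ j, Reads e.1.2.2.1 e.1.2.2.2.1 e.1.2.2.2.2 x c j := by
      rintro (_ | _) <;> rfl
    obtain ⟨v', h1, h2, h3⟩ := SeqRel.complete (owner := owner)
      (R := ComponentRel num w e.1.2.2.1 e.1.2.2.2.1 e.1.2.2.2.2)
      (fun j v v' h => ComponentRel.frame j v v' h)
      (Pre := CompGood num w k s c) (Post := CompGood num w k s (M.apply c m))
      (Inv := fun v => v none = 0)
      CompGood.of_eq CompGood.of_eq
      (fun j v hz hv => ComponentRel.complete hw hk hs hx hin' hreads j v hz hv hin.2) hl hz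
      (fun j _ => hv j) (fun j hj => absurd (hmem j) hj)
    exact ⟨hin', v', h2, h3, hr.tail ⟨.inl (.inr e), rfl, rfl, h1⟩⟩

omit [DecidableEq M.Head] [DecidableEq M.Tape] in
/-- Languages recognized in logarithmic space by machines with several input heads are recognized
by head programs. -/
theorem Recognizes.mem_headLanguages [Finite α] {L : Language α} {s : ℕ → ℕ}
    (h : M.Recognizes L s) (hs : s ∈ logBound) : L ∈ HeadLanguages α := by
  classical
  have := M.finState
  have := M.finWork
  have := M.finHead
  have := M.finTape
  obtain ⟨w, ⟨f⟩⟩ := Finite.exists_equiv_fin M.Work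
  have hw : 0 < w := Fin.pos (f M.blank)
  let num : M.Work → ℕ := fun a => f a
  have hnum : ∀ a, num a < w := fun a => (f a).2
  have hinj : num.Injective := Fin.val_injective.comp f.injective
  obtain ⟨B, n₀, hB⟩ := exists_segments_of_mem_logBound hs (b := w + 1) (by omega)
  let F : Set (List α) := {y | y ∈ L ∧ y.length < n₀}
  have : Finite F := ((List.finite_length_lt α n₀).subset fun y hy => hy.2)
  have := Fintype.ofFinite (M.Head ⊕ M.Tape)
  let l : List (M.Head ⊕ M.Tape) := Finset.univ.toList
  have hl : l.Nodup := Finset.nodup_toList _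
  have hmem : ∀ j, j ∈ l := fun j => by simp [l]
  refine HeadLanguages.of_implementable (Implementable.graph (M.simSrc F) (M.simTgt F)
    (M.implementable_simRel (num := num) (w := w) (B := B) (n₀ := n₀) (l := l) (F := F) hw)
    (.inl false) (.inl true)) fun x => ⟨fun hx => ?_, ?_⟩
  · by_cases hn : x.length < n₀
    · exact ⟨_, .single ⟨.inr (.inr ⟨x, hx, hn⟩), rfl, rfl, by simp, by simp, rfl⟩⟩
    · obtain ⟨q, hq, c, hc, hr⟩ := h.1 x hx
      obtain ⟨k, hk, h1, h2⟩ := hB x.length (by omega)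
      obtain ⟨-, v, -, -, h3⟩ := simRel_complete (n₀ := n₀) (F := F) hnum hl hmem hk h1 h2 (by omega) hq hr
      exact ⟨v, h3.tail ⟨.inr (.inl ⟨(c.state, _), hc⟩), rfl, rfl, rfl⟩⟩
  · rintro ⟨v, hv⟩
    exact simRel_sound h hnum hinj hl hmem (fun y hy => hy.1) hv

end MultiNTM


/-! ### Visited cells and bounds -/

/-- Discrete intermediate value property of a head that moves by at most one cell. -/
theorem exists_le_eq_of_between {head : ℕ → ℤ} {t : ℕ} (h0 : head 0 = 0)
    (hs : ∀ i < t, |head (i + 1) - head i| ≤ 1) {z : ℤ}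
    (hz : 0 ≤ z ∧ z ≤ head t ∨ head t ≤ z ∧ z ≤ 0) : ∃ i ≤ t, head i = z := by
  induction t with
  | zero => exact ⟨0, le_rfl, by omega⟩
  | succ t ih =>
    by_cases h : z = head (t + 1)
    · exact ⟨t + 1, le_rfl, h.symm⟩
    · have h1 := abs_le.1 (hs t (by omega))
      obtain ⟨i, hi, h2⟩ := ih (fun i hi => hs i (by omega)) (by omega)
      exact ⟨i, by omega, h2⟩

/-- Every cell between the origin and the present position has been visited. This converts the
number of visited cells into the distance bound of `MultiNTM.Within`. -/
theorem natAbs_lt_cellsVisited {head : ℕ → ℤ} {t : ℕ} (h0 : head 0 = 0)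
    (hs : ∀ i < t, |head (i + 1) - head i| ≤ 1) : (head t).natAbs < cellsVisited head t := by
  have h1 : Finset.uIcc 0 (head t) ⊆ (Finset.range (t + 1)).image head := by
    intro z hz
    rw [Finset.mem_uIcc, inf_le_iff, le_sup_iff] at hz
    obtain ⟨i, hi, h2⟩ := exists_le_eq_of_between h0 hs (z := z) (by omega)
    exact Finset.mem_image.2 ⟨i, by simpa [Nat.lt_succ_iff] using hi, h2⟩
  have h2 := Finset.card_le_card h1
  rw [Int.card_uIcc] at h2
  simp only [sub_zero] at h2
  exact h2

theorem abs_signType_le (d : SignType) : |(d : ℤ)| ≤ 1 := by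
  rcases d with _ | _ | _ <;> decide

/-- An eventual bound on a sequence extends to a bound at all indices, so a single `r` bounds the
coins on inputs of every length. -/
theorem mem_consBound_iff {f : ℕ → ℕ} : f ∈ consBound ↔ ∃ C, ∀ n, f n ≤ C := by
  simp only [consBound, Set.mem_ofPred_eq]
  rw [isBigO_one_nat_atTop_iff]
  constructor
  · rintro ⟨C, hC⟩
    refine ⟨⌈C⌉₊, fun n => ?_⟩
    have := (hC n).trans (Nat.le_ceil C)
    rw [Real.norm_natCast] at this
    exact_mod_cast this
  · rintro ⟨C, hC⟩
    refine ⟨C, fun n => ?_⟩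
    rw [Real.norm_natCast]
    exact_mod_cast hC n

theorem consBound_subset_logBound : consBound ⊆ logBound := by
  intro f hf
  refine IsBigO.trans hf ?_
  exact ((Real.isLittleO_const_log_atTop (c := 1)).comp_tendsto
    tendsto_natCast_atTop_atTop).isBigO

/-! ### Nondeterministic Turing machines as machines with one input head -/

namespace NTM

variable {α : Type} (M : NTM α)

theorem reflTransGen_iff {x : List α} {d : M.Config} :
    Relation.ReflTransGen (M.Step x) M.init d ↔ ∃ c t, M.IsComputation x c t ∧ c t = d := by
  constructor
  · intro h
    induction h with
    | refl => exact ⟨fun _ => M.init, 0, ⟨rfl, by simp⟩, rfl⟩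
    | @tail d d' _ hs ih =>
      obtain ⟨c, t, ⟨h0, h1⟩, rfl⟩ := ih
      refine ⟨fun i => if i ≤ t then c i else d', t + 1, ⟨by simpa using h0, fun i hi => ?_⟩,
        by simp⟩
      rcases Nat.lt_succ_iff_lt_or_eq.1 hi with h | rfl
      · simpa [h.le, Nat.succ_le_of_lt h] using h1 i h
      · simpa using hs
  · rintro ⟨c, t, ⟨h0, h1⟩, rfl⟩
    rw [← h0]
    have : ∀ i ≤ t, Relation.ReflTransGen (M.Step x) (c 0) (c i) := by
      intro i hi
      induction i with
      | zero => exact .refl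
      | succ i ih => exact (ih (by omega)).tail (h1 i (by omega))
    exact this t le_rfl

theorem IsComputation.mono {M : NTM α} {x : List α} {c : ℕ → M.Config} {t i : ℕ}
    (h : M.IsComputation x c t) (hi : i ≤ t) : M.IsComputation x c i :=
  ⟨h.1, fun j hj => h.2 j (by omega)⟩

/-- A Turing machine as a machine with one input head. -/
def toMulti : MultiNTM α where
  State := M.State
  Work := M.Work
  Head := Unit
  Tape := Fin M.k
  finState := M.finState
  finWork := M.finWork
  finHead := inferInstance
  finTape := inferInstance
  start := {M.start}
  accept := {M.accept}
  blank := M.blank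
  δ q σ a := {m | q ≠ M.accept ∧ ∃ m' ∈ M.δ q (σ ()) a,
    m = (m'.1, m'.2.1, fun _ => m'.2.2.1, m'.2.2.2)}

def toMultiConfig (c : M.Config) : M.toMulti.Config where
  state := c.state
  head := fun _ => c.inputPos
  work := c.work
  workPos := c.workPos

theorem toMulti_step {x : List α} {c c' : M.Config} (h : M.Step x c c') :
    M.toMulti.Step x (M.toMultiConfig c) (M.toMultiConfig c') := by
  obtain ⟨h1, m, hm, rfl⟩ := h
  exact ⟨_, ⟨h1, m, hm, rfl⟩, rfl⟩

theorem exists_of_toMulti_step {x : List α} {c : M.Config} {d : M.toMulti.Config}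
    (h : M.toMulti.Step x (M.toMultiConfig c) d) : ∃ c', M.Step x c c' ∧ M.toMultiConfig c' = d := by
  obtain ⟨_, ⟨h1, m, hm, rfl⟩, rfl⟩ := h
  exact ⟨_, ⟨h1, m, hm, rfl⟩, rfl⟩

/-- Prefixes of computations are computations, so the position and space bounds, stated at the end
of a computation, hold after each of its steps. -/
theorem toMulti_recognizes {L : Language α} {s : ℕ → ℕ} (h1 : M.StaysOnInput)
    (h2 : M.SpaceBound s) (h3 : ∀ x, x ∈ L ↔ M.Accepts x) : M.toMulti.Recognizes L s := by
  refine ⟨fun x hx => ?_, ?_⟩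
  · obtain ⟨c, t, hc, hacc⟩ := (h3 x).1 hx
    refine ⟨M.start, rfl, M.toMultiConfig (c t), hacc, ?_⟩
    have : ∀ i ≤ t, Relation.ReflTransGen (fun c c' => M.toMulti.Step x c c' ∧
        M.toMulti.Within x (s x.length) c') (M.toMultiConfig M.init) (M.toMultiConfig (c i)) := by
      intro i hi
      induction i with
      | zero => rw [hc.1]
      | succ i ih =>
        refine (ih (by omega)).tail ⟨M.toMulti_step (hc.2 i (by omega)), fun _ => h1 x c _ (hc.mono hi),
          fun (j : Fin M.k) => ?_⟩
        have h4 := h2 x c _ (hc.mono hi)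
        have h5 := natAbs_lt_cellsVisited (head := fun i => (c i).workPos j) (t := i + 1)
          (by simp [hc.1, init]) (fun l hl => by
            obtain ⟨_, m, _, hm⟩ := hc.2 l (by omega)
            simp only [hm, add_sub_cancel_left]
            exact abs_signType_le _)
        have h6 := Finset.single_le_sum (f := fun j : Fin M.k =>
          cellsVisited (fun i => (c i).workPos j) (i + 1)) (fun _ _ => Nat.zero_le _)
          (Finset.mem_univ j)
        change -(s x.length : ℤ) ≤ (c (i + 1)).workPos j ∧ (c (i + 1)).workPos j ≤ s x.length
        omega
    exact this t le_rfl
  · rintro x _ rfl c hc hr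
    have : ∀ d, Relation.ReflTransGen (M.toMulti.Step x) (M.toMultiConfig M.init) d →
        ∃ c, Relation.ReflTransGen (M.Step x) M.init c ∧ M.toMultiConfig c = d := by
      intro d hd
      induction hd with
      | refl => exact ⟨_, .refl, rfl⟩
      | tail _ hs ih =>
        obtain ⟨c, hc, rfl⟩ := ih
        obtain ⟨c', h4, rfl⟩ := M.exists_of_toMulti_step hs
        exact ⟨c', hc.tail h4, rfl⟩
    obtain ⟨c, h4, rfl⟩ := this c hr
    obtain ⟨c, t, h5, rfl⟩ := M.reflTransGen_iff.1 h4
    exact (h3 x).2 ⟨c, t, h5, hc⟩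

end NTM

theorem NL_subset_headLanguages (α : Type) [Finite α] : NL α ⊆ HeadLanguages α := by
  rintro L ⟨M, h1, ⟨s, hs, h2⟩, h3⟩
  exact (M.toMulti_recognizes h1 h2 h3).mem_headLanguages hs

/-! ### Constantly many coins -/

/-- Infinite coin sequences that extend a finite one. -/
def extendCoins {r : ℕ} (u : Fin r → Bool) (i : ℕ) : Bool := if h : i < r then u ⟨i, h⟩ else false

/-- The event is a disjoint union of cylinders, one for each prefix in `S`, and each has measure `1
/ 2 ^ r`. -/
theorem coinMeasure_cylinder {r : ℕ} (S : Set (Fin r → Bool)) :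
    coinMeasure.real {ω | (fun i : Fin r => ω i) ∈ S} = S.ncard / 2 ^ r := by
  classical
  have : IsProbabilityMeasure coinMeasure := by unfold coinMeasure; infer_instance
  have h1 : ∀ u : Fin r → Bool,
      {ω : ℕ → Bool | (fun i : Fin r => ω i) = u} =
        Set.pi (Finset.range r) fun i => {extendCoins u i} := by
    intro u
    ext ω
    simp only [Set.mem_ofPred_eq, Set.mem_pi, Finset.coe_range, Set.mem_Iio,
      Set.mem_singleton_iff]
    constructor
    · rintro rfl i hi
      simp [extendCoins, hi]
    · intro h
      funext i
      rw [h i i.2]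
      simp [extendCoins]
  have h2 : ∀ u : Fin r → Bool,
      coinMeasure.real {ω : ℕ → Bool | (fun i : Fin r => ω i) = u} = 1 / 2 ^ r := by
    intro u
    rw [h1, measureReal_def, coinMeasure, Measure.infinitePi_pi _ (fun i _ => .of_discrete)]
    simp
  have h3 : {ω : ℕ → Bool | (fun i : Fin r => ω i) ∈ S} =
      ⋃ u ∈ S.toFinite.toFinset, {ω : ℕ → Bool | (fun i : Fin r => ω i) = u} := by
    ext ω
    simp
  rw [h3, measureReal_biUnion_finset]
  · simp only [h2, Finset.sum_const, nsmul_eq_mul]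
    rw [Set.ncard_eq_toFinset_card S]
    ring
  · intro u _ u' _ huu'
    refine Set.disjoint_left.2 ?_
    rintro ω rfl h
    exact huu' h
  · intro u _
    rw [h1]
    exact MeasurableSet.pi (Finset.countable_toSet _) fun i _ => .of_discrete

/-! ### Runs and probabilities of a verifier with boundedly many coins -/

namespace Verifier

variable {α : Type} (V : Verifier α)

theorem run_succ (P : Prover α V.Comm) (x : List α) (ω : ℕ → Bool) (t : ℕ) :
    V.run P x ω (t + 1) = V.step P x ω (V.run P x ω t) := by
  rw [run, run, Function.iterate_succ_apply']

/-- A step consults the prover at one history only, and the coins at one index only, and neither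
unless it communicates or tosses. This locality lets unused coins be changed and a prover be defined
gradually. -/
theorem step_congr {P P' : Prover α V.Comm} {x : List α} {ω ω' : ℕ → Bool} {c : V.Config}
    (hω : (∃ q, c.state = .coin q) → ω c.coins = ω' c.coins)
    (hP : V.msg c.state = V.null ∨ P x c.history (V.msg c.state) = P' x c.history (V.msg c.state)) :
    V.step P x ω c = V.step P' x ω' c := by
  have h1 : V.received P x c = V.received P' x c := by
    rcases hP with h | h
    · simp [received, h]
    · simp [received, h]
  have h2 : V.newHistory P x c = V.newHistory P' x c := by
    rcases hP with h | h
    · simp [newHistory, h]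
    · simp [newHistory, h]
  unfold step
  rw [h1, h2]
  split
  · rename_i q hq
    rw [hω ⟨q, hq⟩]
  all_goals rfl

theorem run_congr {P : Prover α V.Comm} {x : List α} {ω ω' : ℕ → Bool} {r : ℕ}
    (hr : ∀ t, (V.run P x ω t).coins ≤ r) (h : ∀ i < r, ω i = ω' i) (t : ℕ) :
    V.run P x ω t = V.run P x ω' t := by
  induction t with
  | zero => rfl
  | succ t ih =>
    rw [run_succ, run_succ, ← ih]
    refine V.step_congr ?_ (.inr rfl)
    rintro ⟨q, hq⟩
    -- The toss raises the count of coins to at most `r`, so its index is strictly below `r`.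
    refine h _ ?_
    have h1 := hr (t + 1)
    rw [run_succ, step, hq] at h1
    exact h1

theorem run_le_of_halt {P : Prover α V.Comm} {x : List α} {ω : ℕ → Bool} {t t' : ℕ} (h : t ≤ t')
    (hq : (V.run P x ω t).state = .accept ∨ (V.run P x ω t).state = .reject) :
    V.run P x ω t' = V.run P x ω t := by
  induction t', h using Nat.le_induction with
  | base => rfl
  | succ t' _ ih =>
    rw [run_succ, ih]
    rcases hq with hq | hq <;> simp [step, hq]

/-- Only the first `r` bits are ever consulted, so the event is a cylinder and its probability is a
count of prefixes. -/
theorem probability_eq {P : Prover α V.Comm} {x : List α} {r : ℕ}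
    (hr : ∀ ω t, (V.run P x ω t).coins ≤ r) (q : VState V.R V.D) :
    coinMeasure.real {ω | ∃ t, (V.run P x ω t).state = q} =
      {u : Fin r → Bool | ∃ t, (V.run P x (extendCoins u) t).state = q}.ncard / 2 ^ r := by
  rw [← coinMeasure_cylinder]
  congr 1
  ext ω
  simp only [Set.mem_ofPred_eq]
  have h : ∀ t, V.run P x ω t = V.run P x (extendCoins fun i : Fin r => ω i) t :=
    V.run_congr (hr ω) fun i hi => by simp [extendCoins, hi]
  simp only [h]

/-- Halting states persist, so no outcome both accepts and rejects; an outcome may do neither, hence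
the inequality. -/
theorem acceptProb_add_rejectProb_le {P : Prover α V.Comm} {x : List α} {r : ℕ}
    (hr : ∀ ω t, (V.run P x ω t).coins ≤ r) : V.acceptProb P x + V.rejectProb P x ≤ 1 := by
  rw [acceptProb, rejectProb, V.probability_eq hr, V.probability_eq hr, ← add_div,
    div_le_one (by positivity), ← Nat.cast_add, ← Set.ncard_union_eq]
  · have := Set.ncard_le_card (α := Fin r → Bool) 
      ({u | ∃ t, (V.run P x (extendCoins u) t).state = .accept} ∪
        {u | ∃ t, (V.run P x (extendCoins u) t).state = .reject})
    simp at this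
    exact_mod_cast this
  · refine Set.disjoint_left.2 ?_
    rintro u ⟨t, ht⟩ ⟨t', ht'⟩
    rcases le_total t t' with h | h
    · rw [V.run_le_of_halt h (.inl ht), ht] at ht'
      cases ht'
    · rw [V.run_le_of_halt h (.inr ht'), ht'] at ht
      cases ht

/-! ### One-way provers as provers that are sent a single symbol -/

open Classical in
/-- The verifier that sends `m` whenever `V` communicates. -/
noncomputable abbrev mute (m : V.Comm) : Verifier α :=
  { V with msg := fun q => if V.msg q = V.null then V.null else m }

/-- The communication of a prover who is sent the symbol `m` all the time. -/
def muteHistory {α Γ : Type} (P : Prover α Γ) (m : Γ) (x : List α) : ℕ → List (Γ × Γ)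
  | 0 => []
  | i + 1 => muteHistory P m x i ++ [(m, P x (muteHistory P m x i) m)]

/-- The sequence of the responses of a prover who is sent the symbol `m` all the time. -/
def muteSequence {α Γ : Type} (P : Prover α Γ) (m : Γ) (x : List α) (i : ℕ) : Γ :=
  P x (muteHistory P m x i) m

theorem length_muteHistory {α Γ : Type} (P : Prover α Γ) (m : Γ) (x : List α) (i : ℕ) :
    (muteHistory P m x i).length = i := by
  induction i with
  | zero => rfl
  | succ i ih => simp [muteHistory, ih]

theorem muteSequence_ofSequence {α Γ : Type} (c : List α → ℕ → Γ) (m : Γ) :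
    muteSequence (Prover.ofSequence c) m = c := by
  funext x i
  simp [muteSequence, Prover.ofSequence, length_muteHistory]

/-- A prover that is always sent the same symbol learns only the number of the round, so its
responses form a fixed sequence. Only the recorded history differs. By `hm` the states that
communicated still do. -/
theorem mute_run {m : V.Comm} (hm : ∀ q, V.msg q ≠ V.null → m ≠ V.null) (P : Prover α V.Comm)
    (x : List α) (ω : ℕ → Bool) (t : ℕ) :
    (V.mute m).run P x ω t = 
      { state := (V.run (.ofSequence (muteSequence P m)) x ω t).state
        inputPos := (V.run (.ofSequence (muteSequence P m)) x ω t).inputPos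
        work := (V.run (.ofSequence (muteSequence P m)) x ω t).work
        workPos := (V.run (.ofSequence (muteSequence P m)) x ω t).workPos
        history := muteHistory P m x (V.run (.ofSequence (muteSequence P m)) x ω t).history.length
        coins := (V.run (.ofSequence (muteSequence P m)) x ω t).coins } := by
  induction t with
  | zero => rfl
  | succ t ih =>
    rw [run_succ, run_succ, ih]
    generalize V.run (.ofSequence (muteSequence P m)) x ω t = c
    by_cases h : V.msg c.state = V.null
    · unfold step
      rcases hc : c.state with q | q | _ | _ <;> rw [hc] at h <;>
        simp [hc, h, received, newHistory, apply]
    · have h' := hm _ h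
      unfold step
      rcases hc : c.state with q | q | _ | _ <;> rw [hc] at h <;>
        simp [hc, h, h', received, newHistory, apply, Prover.ofSequence, muteSequence, muteHistory]

end Verifier

/-- Muting makes all provers one-way, and leaves the responses of the honest one unchanged. On
non-members, rejection with probability at least `1 - ε` leaves at most `ε` for acceptance. -/
theorem onewayIP_subset_weakIP (α : Type) :
    onewayIP α consBound consBound ⊆ weakIP α logBound consBound := by
  rintro L ⟨V, ⟨h1, ⟨s, hs, h2⟩, ⟨r, hr, h3⟩⟩, ε, hε, ⟨P, ⟨c, hc⟩, h4⟩, h5⟩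
  obtain ⟨m, hm⟩ : ∃ m, ∀ q, V.msg q ≠ V.null → m ≠ V.null := by
    by_cases h : ∃ q, V.msg q ≠ V.null
    · obtain ⟨q, hq⟩ := h
      exact ⟨_, fun _ _ => hq⟩
    · exact ⟨V.null, fun q hq => (h ⟨q, hq⟩).elim⟩
  have hone : ∀ P, Prover.ofSequence (Verifier.muteSequence P m) ∈ onewayProvers α V.Comm :=
    fun P => ⟨_, rfl⟩
  have hacc : ∀ P x, (V.mute m).acceptProb P x =
      V.acceptProb (.ofSequence (Verifier.muteSequence P m)) x := by
    intro P x
    simp only [Verifier.acceptProb, V.mute_run hm]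
  refine ⟨V.mute m, ⟨fun P _ x ω t => ?_, ⟨s, consBound_subset_logBound hs, fun P _ x ω t => ?_⟩,
    r, hr, fun P _ x ω t => ?_⟩, ε, hε, ⟨P, trivial, fun x hx => ?_⟩, fun x hx P _ => ?_⟩
  · rw [V.mute_run hm]; exact h1 _ (hone P) x ω t
  · simp only [V.mute_run hm]; exact h2 _ (hone P) x ω t
  · rw [V.mute_run hm]; exact h3 _ (hone P) x ω t
  · rw [hacc, ← hc, Verifier.muteSequence_ofSequence, hc]
    exact h4 x hx
  · rw [hacc]
    have h6 := V.acceptProb_add_rejectProb_le (x := x) (h3 _ (hone P) x)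
    have h7 := h5 x hx _ (hone P)
    linarith


/-! ### Simulating all coin outcomes of a verifier in parallel -/

instance {R D : Type} [Finite R] [Finite D] : Finite (VState R D) := by
  refine Finite.of_surjective
    (fun a : R ⊕ D ⊕ Bool => match a with
      | .inl q => VState.coin q
      | .inr (.inl q) => VState.det q
      | .inr (.inr true) => VState.accept
      | .inr (.inr false) => VState.reject) ?_
  rintro (q | q | _ | _)
  exacts [⟨.inl q, rfl⟩, ⟨.inr (.inl q), rfl⟩, ⟨.inr (.inr true), rfl⟩, ⟨.inr (.inr false), rfl⟩]

namespace Verifier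

variable {α : Type} (V : Verifier α) (r : ℕ)

/-- The state of the parallel simulation: the simulated coin outcomes, the state and the number of
tossed coins for each of them, and a relation that identifies outcomes with the same
communication. -/
structure SimState where
  sel : Set (Fin r → Bool)
  state : (Fin r → Bool) → VState V.R V.D
  coins : (Fin r → Bool) → Fin (r + 1)
  same : (Fin r → Bool) → (Fin r → Bool) → Prop

instance : Finite (V.SimState r) := by
  have := V.finR
  have := V.finD
  refine Finite.of_injective (fun s : V.SimState r => (s.sel, s.state, s.coins, s.same)) ?_
  rintro ⟨_, _, _, _⟩ ⟨_, _, _, _⟩ h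
  simpa using h

variable {V r}

/-- The selected outcome `u` has not halted. -/
def SimState.Active (s : V.SimState r) (u : Fin r → Bool) : Prop :=
  u ∈ s.sel ∧ s.state u ≠ .accept ∧ s.state u ≠ .reject

/-- All active outcomes are ready to communicate. -/
def SimState.Ready (s : V.SimState r) : Prop := ∀ u, s.Active u → V.msg (s.state u) ≠ V.null

/-- The outcomes for which the next step is carried out. -/
def SimState.Moving (s : V.SimState r) (u : Fin r → Bool) : Prop :=
  s.Active u ∧ (s.Ready ∨ V.msg (s.state u) = V.null)

/-- The guessed responses `γ` are functions of the communication. -/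
def SimState.Consistent (s : V.SimState r) (γ : (Fin r → Bool) → V.Comm) : Prop :=
  s.Ready → ∀ u u', s.Active u → s.Active u' → s.same u u' →
    V.msg (s.state u) = V.msg (s.state u') → γ u = γ u'

open Classical in
variable (V) in
/-- The move of the verifier in the state `q`. -/
noncomputable def move (q : VState V.R V.D) (o : Option α) (a : V.Work) (g : V.Comm) (b : Bool) :
    VState V.R V.D × V.Work × SignType × SignType :=
  match q with
  | .coin q => V.δcoin q o a (if V.msg (.coin q) = V.null then V.null else g) b
  | .det q => V.δdet q o a (if V.msg (.det q) = V.null then V.null else g)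
  | .accept => (.accept, a, 0, 0)
  | .reject => (.reject, a, 0, 0)

/-- The number of coins tossed in a step from the state `q`. -/
def VState.tosses {R D : Type} : VState R D → ℕ
  | .coin _ => 1
  | _ => 0

open Classical in
/-- The move of the simulation in which the responses are `γ`. -/
noncomputable def SimState.next (s : V.SimState r) (σ : (Fin r → Bool) → Option α)
    (a : (Fin r → Bool) → V.Work) (γ : (Fin r → Bool) → V.Comm) :
    V.SimState r × ((Fin r → Bool) → V.Work) × ((Fin r → Bool) → SignType) ×
      ((Fin r → Bool) → SignType) :=
  let m := fun u => if s.Moving u then V.move (s.state u) (σ u) (a u) (γ u)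
    (extendCoins u (s.coins u)) else (s.state u, a u, 0, 0)
  ({ sel := s.sel
     state := fun u => (m u).1
     coins := fun u => if s.Moving u then
      Fin.ofNat (r + 1) (s.coins u + VState.tosses (s.state u)) else s.coins u
     same := fun u u' => s.same u u' ∧ (s.Ready → V.msg (s.state u) = V.msg (s.state u')) },
    fun u => (m u).2.1, fun u => (m u).2.2.1, fun u => (m u).2.2.2)

variable (V r)

/-- The machine that simulates the verifier for the majority of the outcomes of `r` coin tosses. -/
noncomputable abbrev toMulti : MultiNTM α where
  State := V.SimState r
  Work := V.Work
  Head := Fin r → Bool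
  Tape := Fin r → Bool
  finState := inferInstance
  finWork := V.finWork
  finHead := inferInstance
  finTape := inferInstance
  start := {s | 2 ^ r < 2 * s.sel.ncard ∧ s.state = (fun _ => V.start) ∧ s.coins = (fun _ => 0) ∧
    s.same = fun _ _ => True}
  accept := {s | ∀ u ∈ s.sel, s.state u = .accept}
  blank := V.blank
  δ s σ a := {m | ∃ γ, s.Consistent γ ∧ m = s.next σ a γ}

variable {V r}

/-- The configuration of the simulation represents the configurations `d u` of the verifier. -/
structure Corr (c : (V.toMulti r).Config) (d : (Fin r → Bool) → V.Config) : Prop where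
  state : ∀ u, (SimState.state c.state u) = (d u).state
  coins : ∀ u, ((SimState.coins c.state u : Fin (r + 1)) : ℕ) = (d u).coins
  head : ∀ u, c.head u = (d u).inputPos
  work : ∀ u, c.work u = (d u).work
  workPos : ∀ u, c.workPos u = (d u).workPos

/-- Within one step a prover matters only through its present response, so a constant prover can
stand for it. -/
theorem step_eq_move (x : List α) (ω : ℕ → Bool) (c : V.Config) (g : V.Comm) :
    ∃ h, V.step (fun _ _ _ => g) x ω c = V.apply c
      (V.move c.state (inputSymbol x c.inputPos) (c.work c.workPos) g (ω c.coins)) h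
      (c.coins + VState.tosses c.state) := by
  obtain ⟨q, p, f, p', h, n⟩ := c
  rcases q with q | q | _ | _
  · exact ⟨_, rfl⟩
  · exact ⟨_, rfl⟩
  · exact ⟨h, by simp [step, move, VState.tosses, apply]⟩
  · exact ⟨h, by simp [step, move, VState.tosses, apply]⟩

open Classical in
/-- The configurations of the verifier after a move of the simulation. -/
noncomputable def corrNext (x : List α) (s : V.SimState r) (d : (Fin r → Bool) → V.Config)
    (γ : (Fin r → Bool) → V.Comm) (u : Fin r → Bool) : V.Config :=
  if s.Moving u then V.step (fun _ _ _ => γ u) x (extendCoins u) (d u) else d u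

theorem Corr.next {c : (V.toMulti r).Config} {d : (Fin r → Bool) → V.Config} (h : Corr c d)
    {x : List α} {γ : (Fin r → Bool) → V.Comm} {s : V.SimState r} (hs : c.state = s)
    (hr : ∀ u, (corrNext x s d γ u).coins ≤ r) :
    Corr ((V.toMulti r).apply c (s.next (fun u => inputSymbol x (c.head u))
      (fun u => c.work u (c.workPos u)) γ)) (corrNext x s d γ) := by
  have key : ∀ u, s.Moving u → ∃ h, corrNext x s d γ u = V.apply (d u)
      (V.move (s.state u) (inputSymbol x (c.head u)) (c.work u (c.workPos u)) (γ u)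
        (extendCoins u (s.coins u))) h ((d u).coins + VState.tosses (s.state u)) := by
    intro u hu
    obtain ⟨h', hh⟩ := step_eq_move x (extendCoins u) (d u) (γ u)
    refine ⟨h', ?_⟩
    rw [corrNext, if_pos hu, hh, h.work, h.workPos, h.head, ← hs, h.state, h.coins]
  have key' : ∀ u, ¬ s.Moving u → corrNext x s d γ u = d u := fun u hu => by
    rw [corrNext, if_neg hu]
  refine ⟨fun u => ?_, fun u => ?_, fun u => ?_, fun u => ?_, fun u => ?_⟩ <;>
    by_cases hu : s.Moving u
  · obtain ⟨_, e⟩ := key u hu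
    rw [e]
    simp [MultiNTM.apply, SimState.next, hu, apply]
  · rw [key' u hu, ← h.state, hs]
    simp [MultiNTM.apply, SimState.next, hu]
  · have hru := hr u
    obtain ⟨_, e⟩ := key u hu
    rw [e] at hru ⊢
    simp only [apply] at hru ⊢
    rw [← h.coins, hs] at hru ⊢
    simp only [MultiNTM.apply, SimState.next, hu, if_true, Fin.val_ofNat]
    -- The bound `hr` excludes a wrap-around of the coin counter modulo `r + 1`.
    exact Nat.mod_eq_of_lt (by omega)
  · rw [key' u hu, ← h.coins, hs]
    simp [MultiNTM.apply, SimState.next, hu]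
  · obtain ⟨_, e⟩ := key u hu
    rw [e]
    simp [MultiNTM.apply, SimState.next, hu, apply, h.head]
  · rw [key' u hu, ← h.head]
    simp [MultiNTM.apply, SimState.next, hu]
  · obtain ⟨_, e⟩ := key u hu
    rw [e]
    simp [MultiNTM.apply, SimState.next, hu, apply, h.work, h.workPos]
  · rw [key' u hu, ← h.work]
    simp [MultiNTM.apply, SimState.next, hu]
  · obtain ⟨_, e⟩ := key u hu
    rw [e]
    simp [MultiNTM.apply, SimState.next, hu, apply, h.workPos]
  · rw [key' u hu, ← h.workPos]
    simp [MultiNTM.apply, SimState.next, hu]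

theorem Corr.init {q : V.SimState r} (hq : q ∈ (V.toMulti r).start) :
    Corr ((V.toMulti r).init q) fun _ => V.init := by
  obtain ⟨-, h1, h2, -⟩ := hq
  exact ⟨fun u => congrFun h1 u, fun u => by
    rw [show SimState.coins ((V.toMulti r).init q).state = fun _ => 0 from h2]; rfl,
    fun _ => rfl, fun _ => rfl, fun _ => rfl⟩

theorem history_step {x : List α} {ω : ℕ → Bool} {c : V.Config} {P : Prover α V.Comm}
    (h1 : c.state ≠ .accept) (h2 : c.state ≠ .reject) :
    (V.step P x ω c).history = V.newHistory P x c := by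
  rcases hc : c.state with q | q | _ | _
  · simp [step, hc, apply]
  · simp [step, hc, apply]
  · exact (h1 hc).elim
  · exact (h2 hc).elim

theorem SimState.Active.of_next {s : V.SimState r} {σ a γ} {u : Fin r → Bool}
    (h : (s.next σ a γ).1.Active u) : s.Active u := by
  obtain ⟨h1, h2, h3⟩ := h
  by_cases hm : s.Moving u
  · exact hm.1
  · simp only [SimState.next, hm, if_false] at h1 h2 h3
    exact ⟨h1, h2, h3⟩

/-- Every run of the simulation is the interaction with some prover. -/
theorem toMulti_sound {x : List α} (hcoin : ∀ P ω t, (V.run P x ω t).coins ≤ r) {q : V.SimState r}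
    (hq : q ∈ (V.toMulti r).start) {c : (V.toMulti r).Config}
    (h : Relation.ReflTransGen ((V.toMulti r).Step x) ((V.toMulti r).init q) c) :
    ∃ (s : V.SimState r) (d : (Fin r → Bool) → V.Config) (P : Prover α V.Comm) (k : ℕ),
      c.state = s ∧ Corr c d ∧ s.sel = q.sel ∧
      (∀ P' : Prover α V.Comm, (∀ y h m, h.length < k → P' y h m = P y h m) →
        ∀ u ∈ s.sel, ∃ t, V.run P' x (extendCoins u) t = d u) ∧
      (∀ u, s.Active u → (d u).history.length = k) ∧
      ∀ u u', s.Active u → s.Active u' → (d u).history = (d u').history → s.same u u' := by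
  classical
  -- Invariant: all active outcomes have been through exactly `k` communication rounds, and only the
  -- values of `P` on histories shorter than `k` have been used, so the others are still free. Equal
  -- histories imply `same`, which makes consistent guesses well defined as functions of the
  -- history.
  induction h with
  | refl =>
    refine ⟨q, _, fun _ _ _ => V.null, 0, rfl, Corr.init hq, rfl, fun _ _ u _ => ⟨0, rfl⟩,
      fun _ _ => rfl, fun u u' _ _ _ => ?_⟩
    rw [hq.2.2.2]
    trivial
  | @tail c c' _ hs ih =>
    obtain ⟨s, d, P, k, hs', hcor, hsel, hP, hlen, hsame⟩ := ih
    obtain ⟨_, ⟨γ, hγ, rfl⟩, rfl⟩ := hs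
    rw [hs'] at hγ
    rw [hs']
    -- extend the prover by the guessed responses
    obtain ⟨k', P', hk, hPP', hstep⟩ : ∃ (k' : ℕ) (P' : Prover α V.Comm), (k' = if s.Ready then k + 1 else k) ∧
        (∀ (y : List α) h m, h.length < k → P' y h m = P y h m) ∧
        ∀ P'' : Prover α V.Comm, (∀ y h m, h.length < k' → P'' y h m = P' y h m) →
          ∀ u, s.Moving u → V.msg (s.state u) = V.null ∨
            P'' x (d u).history (V.msg (s.state u)) = γ u := by
      by_cases hr : s.Ready
      -- On a history of length `k` the new prover answers as guessed for some active outcome with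
      -- that history and message; by consistency it does not matter which one is chosen. All active
      -- histories have length `k`, so shorter ones keep their answers.
      · refine ⟨k + 1, fun y h m => if hu : ∃ u, s.Active u ∧ (d u).history = h ∧
          V.msg (s.state u) = m then γ hu.choose else P y h m, by simp [hr], ?_, ?_⟩
        · intro y h m hh
          refine dif_neg ?_
          rintro ⟨u, hu, rfl, -⟩
          have := hlen u hu
          omega
        · intro P'' hP'' u hu
          right
          rw [hP'' _ _ _ (by rw [hlen u hu.1]; omega)]
          have hex : ∃ u', s.Active u' ∧ (d u').history = (d u).history ∧
              V.msg (s.state u') = V.msg (s.state u) := ⟨u, hu.1, rfl, rfl⟩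
          refine (dif_pos hex).trans ?_
          obtain ⟨h1, h2, h3⟩ := hex.choose_spec
          exact hγ hr _ _ h1 hu.1 (hsame _ _ h1 hu.1 h2) h3
      · exact ⟨k, P, by simp [hr], fun _ _ _ _ => rfl, fun _ _ u hu => .inl (hu.2.resolve_left hr)⟩
    have hkk : k ≤ k' := by rw [hk]; split <;> omega
    have hrun : ∀ P'' : Prover α V.Comm, (∀ y h m, h.length < k' → P'' y h m = P' y h m) →
        ∀ u ∈ s.sel, ∃ t, V.run P'' x (extendCoins u) t = corrNext x s d γ u := by
      intro P'' hP'' u hu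
      obtain ⟨t, ht⟩ := hP P'' (fun y h m hh => (hP'' y h m (by omega)).trans (hPP' y h m hh)) u hu
      by_cases hm : s.Moving u
      · refine ⟨t + 1, ?_⟩
        rw [run_succ, ht, corrNext, if_pos hm]
        refine V.step_congr (fun _ => rfl) ?_
        rw [← hcor.state, hs']
        exact hstep P'' hP'' u hm
      · exact ⟨t, by rw [ht, corrNext, if_neg hm]⟩
    refine ⟨_, corrNext x s d γ, P', k', rfl, hcor.next hs' fun u => ?_, hsel, hrun,
      fun u hu => ?_, fun u u' hu hu' hh => ?_⟩
    · by_cases hu : u ∈ s.sel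
      · obtain ⟨t, ht⟩ := hrun P' (fun _ _ _ _ => rfl) u hu
        rw [← ht]
        exact hcoin _ _ _
      -- An unselected outcome never moves, and its counter is bounded by its type.
      · rw [corrNext, if_neg fun h => hu h.1.1, ← hcor.coins]
        omega
    · have hu' := hu.of_next
      have e1 := hcor.state u
      rw [hs'] at e1
      by_cases hm : s.Moving u
      · rw [corrNext, if_pos hm, history_step (e1 ▸ hu'.2.1) (e1 ▸ hu'.2.2), newHistory, ← e1, hk]
        by_cases hr : s.Ready
        · rw [if_neg (hr u hu'), if_pos hr, List.length_append, hlen u hu']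
          rfl
        · rw [if_pos (hm.2.resolve_left hr), if_neg hr, hlen u hu']
      · have hr : ¬ s.Ready := fun hr => hm ⟨hu', .inl hr⟩
        rw [corrNext, if_neg hm, hk, if_neg hr, hlen u hu']
    · have hau := hu.of_next
      have hau' := hu'.of_next
      have e1 := hcor.state u
      have e2 := hcor.state u'
      rw [hs'] at e1 e2
      by_cases hr : s.Ready
      · rw [corrNext, corrNext, if_pos ⟨hau, .inl hr⟩, if_pos ⟨hau', .inl hr⟩,
          history_step (e1 ▸ hau.2.1) (e1 ▸ hau.2.2), history_step (e2 ▸ hau'.2.1) (e2 ▸ hau'.2.2),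
          newHistory, newHistory, ← e1, ← e2, if_neg (hr u hau), if_neg (hr u' hau')] at hh
        obtain ⟨h1, h2⟩ := List.append_inj' hh rfl
        simp only [List.cons.injEq, Prod.mk.injEq, and_true] at h2
        exact ⟨hsame u u' hau hau' h1, fun _ => h2.1⟩
      · have e : ∀ u, s.Active u → (corrNext x s d γ u).history = (d u).history := by
          intro u hu
          by_cases hm : s.Moving u
          · have e1 := hcor.state u
            rw [hs'] at e1
            rw [corrNext, if_pos hm, history_step (e1 ▸ hu.2.1) (e1 ▸ hu.2.2), newHistory, ← e1,
              if_pos (hm.2.resolve_left hr)]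
          · rw [corrNext, if_neg hm]
        rw [e u hau, e u' hau'] at hh
        exact ⟨hsame u u' hau hau' hh, fun h => (hr h).elim⟩

/-- The interaction with a prover is simulated, as long as the selected outcomes are accepting. -/
theorem toMulti_complete {x : List α} {P : Prover α V.Comm} {b : ℕ}
    (hcoin : ∀ ω t, (V.run P x ω t).coins ≤ r)
    (hin : ∀ ω t, 0 ≤ (V.run P x ω t).inputPos ∧ (V.run P x ω t).inputPos ≤ (x.length : ℤ) + 1)
    (hwork : ∀ ω t, -(b : ℤ) ≤ (V.run P x ω t).workPos ∧ (V.run P x ω t).workPos ≤ b)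
    {T : (Fin r → Bool) → ℕ} (n : ℕ) (c : (V.toMulti r).Config) (s : V.SimState r)
    (hs : c.state = s) (t : (Fin r → Bool) → ℕ)
    (hT : ∀ u ∈ s.sel, (V.run P x (extendCoins u) (T u)).state = .accept)
    (hcor : Corr c fun u => V.run P x (extendCoins u) (t u))
    (hsame : ∀ u u', s.Active u → s.Active u' → s.same u u' →
      (V.run P x (extendCoins u) (t u)).history = (V.run P x (extendCoins u') (t u')).history)
    (hn : ∑ u, (T u - t u) ≤ n) :
    ∃ c' : (V.toMulti r).Config, c'.state ∈ (V.toMulti r).accept ∧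
      Relation.ReflTransGen (fun c c' => (V.toMulti r).Step x c c' ∧ (V.toMulti r).Within x b c')
        c c' := by
  classical
  -- The sum of `T u - t u` decreases with each move: only selected outcomes move, and these lead to
  -- acceptance at time `T u`.
  induction n generalizing c s t with
  | zero =>
    refine ⟨c, ?_, .refl⟩
    rw [hs]
    intro u hu
    have h1 : T u ≤ t u := by
      have := Finset.sum_eq_zero_iff.1 (Nat.le_zero.1 hn) u (Finset.mem_univ u)
      omega
    rw [← hs, hcor.state, V.run_le_of_halt h1 (.inl (hT u hu)), hT u hu]
  | succ n ih =>
    by_cases hact : ∃ u, s.Active u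
    · have hst : ∀ u, s.state u = (V.run P x (extendCoins u) (t u)).state := by
        intro u; rw [← hcor.state, hs]
      let γ : (Fin r → Bool) → V.Comm := fun u =>
        P x (V.run P x (extendCoins u) (t u)).history (V.msg (s.state u))
      have hγ : s.Consistent γ := by
        intro hr u u' hu hu' hsm hmsg
        simp only [γ, hsame u u' hu hu' hsm, hmsg]
      let t' : (Fin r → Bool) → ℕ := fun u => if s.Moving u then t u + 1 else t u
      have hd : corrNext x s (fun u => V.run P x (extendCoins u) (t u)) γ =
          fun u => V.run P x (extendCoins u) (t' u) := by
        funext u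
        by_cases hm : s.Moving u
        · simp only [corrNext, hm, if_true, t', run_succ]
          exact V.step_congr (fun _ => rfl) (.inr (by simp only [γ, hst]))
        · simp only [corrNext, hm, if_false, t']
      have hcor' := hcor.next (x := x) (γ := γ) hs fun u => by rw [hd]; exact hcoin _ _
      rw [hd] at hcor'
      have hlt : ∀ u, s.Moving u → t u < T u := by
        intro u hu
        by_contra h
        have := V.run_le_of_halt (not_lt.1 h) (.inl (hT u hu.1.1))
        exact hu.1.2.1 (by rw [hst, this, hT u hu.1.1])
      -- There is no deadlock: either some active outcome is silent and may move, or all are ready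
      -- and communicate together.
      have hmov : ∃ u, s.Moving u := by
        by_cases hr : s.Ready
        · obtain ⟨u, hu⟩ := hact
          exact ⟨u, hu, .inl hr⟩
        · simp only [SimState.Ready, not_forall, not_not] at hr
          obtain ⟨u, hu, hm⟩ := hr
          exact ⟨u, hu, .inr hm⟩
      have hsum : ∑ u, (T u - t' u) < ∑ u, (T u - t u) := by
        obtain ⟨u, hu⟩ := hmov
        refine Finset.sum_lt_sum (fun u _ => ?_) ⟨u, Finset.mem_univ u, ?_⟩
        · simp only [t']; split <;> omega
        · have := hlt u hu
          simp only [t', hu, if_true]; omega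
      obtain ⟨c', h1, h2⟩ := ih _ _ rfl t' hT hcor' (fun u u' hu hu' hsm => by
          have hau := hu.of_next
          have hau' := hu'.of_next
          obtain ⟨hsm1, hsm2⟩ := hsm
          have hh := hsame u u' hau hau' hsm1
          by_cases hr : s.Ready
          · have hm : s.Moving u := ⟨hau, .inl hr⟩
            have hm' : s.Moving u' := ⟨hau', .inl hr⟩
            simp only [t', hm, hm', if_true, run_succ]
            rw [history_step (hst u ▸ hau.2.1) (hst u ▸ hau.2.2),
              history_step (hst u' ▸ hau'.2.1) (hst u' ▸ hau'.2.2), newHistory, newHistory,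
              ← hst, ← hst, hh, hsm2 hr]
          · have e : ∀ u, s.Active u → (V.run P x (extendCoins u) (t' u)).history =
                (V.run P x (extendCoins u) (t u)).history := by
              intro u hu
              by_cases hm : s.Moving u
              · simp only [t', hm, if_true, run_succ]
                rw [history_step (hst u ▸ hu.2.1) (hst u ▸ hu.2.2), newHistory, ← hst,
                  if_pos (hm.2.resolve_left hr)]
              · simp only [t', hm, if_false]
            rw [e u hau, e u' hau', hh]) (by omega)
      refine ⟨c', h1, .head ⟨⟨_, ⟨γ, hs ▸ hγ, rfl⟩, rfl⟩, fun u => ?_, fun u => ?_⟩ ?_⟩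
      · rw [hs, hcor'.head]; exact hin _ _
      · rw [hs, hcor'.workPos]; exact hwork _ _
      · rw [hs]; exact h2
    · refine ⟨c, ?_, .refl⟩
      rw [hs]
      intro u hu
      have h1 : s.state u = .accept ∨ s.state u = .reject := by
        by_contra h
        rw [not_or] at h
        exact hact ⟨u, hu, h⟩
      have hst : s.state u = (V.run P x (extendCoins u) (t u)).state := by
        rw [← hcor.state, hs]
      rw [hst] at h1 ⊢
      rcases le_total (t u) (T u) with h | h
      · rw [← V.run_le_of_halt h h1, hT u hu]
      · rw [V.run_le_of_halt h (.inl (hT u hu)), hT u hu]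

theorem abs_workPos_step (P : Prover α V.Comm) (x : List α) (ω : ℕ → Bool) (c : V.Config) :
    |(V.step P x ω c).workPos - c.workPos| ≤ 1 := by
  unfold step
  split
  · simp only [apply, add_sub_cancel_left]; exact abs_signType_le _
  · simp only [apply, add_sub_cancel_left]; exact abs_signType_le _
  · simp
  · simp

end Verifier

/-- As `ε < 1 / 2`, on members some prover makes more than half of the `2 ^ r` outcomes accept, and
on non-members no prover does. The simulation guesses such a majority and ignores the other
outcomes, which need not halt. -/
theorem weakIP_subset_headLanguages (α : Type) [Finite α] :
    weakIP α logBound consBound ⊆ HeadLanguages α := by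
  rintro L ⟨V, ⟨h1, ⟨s, hs, h2⟩, ⟨f, hf, h3⟩⟩, ε, hε, ⟨P, -, h4⟩, h5⟩
  obtain ⟨r, hr⟩ := mem_consBound_iff.1 hf
  have hcoin : ∀ P x ω t, (V.run P x ω t).coins ≤ r := fun P x ω t =>
    (h3 P trivial x ω t).trans (hr _)
  have hprob : ∀ P x, V.acceptProb P x = ({u : Fin r → Bool |
      ∃ t, (V.run P x (extendCoins u) t).state = .accept}.ncard : ℝ) / 2 ^ r := fun P x =>
    V.probability_eq (hcoin P x) _
  have h2r : (0 : ℝ) < 2 ^ r := by positivity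
  refine MultiNTM.Recognizes.mem_headLanguages (M := V.toMulti r) (s := s) ⟨fun x hx => ?_, ?_⟩ hs
  · have h6 := h4 x hx
    rw [hprob, le_div_iff₀ h2r] at h6
    set A := {u : Fin r → Bool | ∃ t, (V.run P x (extendCoins u) t).state = .accept} with hA
    have h7 : 2 ^ r < 2 * A.ncard := by
      have : (2 : ℝ) ^ r < 2 * A.ncard := by nlinarith
      exact_mod_cast this
    let q : V.SimState r := ⟨A, fun _ => V.start, fun _ => 0, fun _ _ => True⟩
    have hq : q ∈ (V.toMulti r).start := ⟨h7, rfl, rfl, rfl⟩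
    have hT : ∀ u, ∃ t, u ∈ A → (V.run P x (extendCoins u) t).state = .accept := by
      intro u
      by_cases hu : u ∈ A
      · obtain ⟨t, ht⟩ := hu
        exact ⟨t, fun _ => ht⟩
      · exact ⟨0, fun h => (hu h).elim⟩
    choose T hT using hT
    refine ⟨q, hq, Verifier.toMulti_complete (P := P) (T := T) (hcoin P x)
      (fun ω t => h1 P trivial x ω t) (fun ω t => ?_) _ _ q rfl (fun _ => 0) hT
      (Verifier.Corr.init hq) (fun _ _ _ _ _ => rfl) le_rfl⟩
    have h8 := h2 P trivial x ω t
    have h9 := natAbs_lt_cellsVisited (head := fun i => (V.run P x ω i).workPos) (t := t) rfl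
      fun i _ => by
        simp only [V.run_succ]
        exact Verifier.abs_workPos_step P x ω _
    omega
  · intro x q hq c hc hr'
    obtain ⟨s', d, P, k, hs', hcor, hsel, hP, -⟩ :=
      Verifier.toMulti_sound (fun P => hcoin P x) hq hr'
    by_contra hx
    have h6 := h5 x hx P trivial
    have h7 : q.sel ⊆ {u : Fin r → Bool |
        ∃ t, (V.run P x (extendCoins u) t).state = .accept} := by
      intro u hu
      rw [← hsel] at hu
      obtain ⟨t, ht⟩ := hP P (fun _ _ _ _ => rfl) u hu
      refine ⟨t, ?_⟩
      rw [ht, ← hcor.state]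
      rw [hs'] at hc ⊢
      exact hc u hu
    have h8 := Set.ncard_le_ncard h7
    have h9 : 2 ^ r < 2 * q.sel.ncard := hq.1
    rw [hprob, div_le_iff₀ h2r] at h6
    have h10 : (2 : ℝ) ^ r < 2 * ({u : Fin r → Bool |
        ∃ t, (V.run P x (extendCoins u) t).state = .accept}.ncard : ℝ) := by
      exact_mod_cast lt_of_lt_of_le h9 (Nat.mul_le_mul_left 2 h8)
    nlinarith


/-! ### Finite-state control of a single head -/

theorem inputSymbol_eq_none {α : Type} {x : List α} {p : ℕ} (hp : p ≤ x.length + 1) :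
    inputSymbol x p = none ↔ p = 0 ∨ p = x.length + 1 := by
  cases p with
  | zero => simp [inputSymbol]
  | succ p =>
    rw [inputSymbol_succ, List.getElem?_eq_none_iff]
    omega

/-- The flag `b` tells the two end-markers apart. -/
def FlagOK (n : ℕ) (b : Bool) (p : ℕ) : Prop :=
  p ≤ n + 1 ∧ (b = true → 1 ≤ p) ∧ (b = false → p ≤ n)

open Classical in
/-- The effect of an operation on the flag, and the movement of the head, if the operation is
possible. -/
noncomputable def HeadOp.flagStep {α : Type} (op : HeadOp α) (b : Bool) (o : Option α) :
    Option (Bool × SignType) :=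
  match op with
  | .nop => some (b, 0)
  | .inc => if o = none ∧ b = true then none else some (true, 1)
  | .dec => if o = none ∧ b = false then none else some (false, -1)
  | .zero => if o = none ∧ b = false then some (b, 0) else none
  | .sym o' => if o = o' then some (b, 0) else none

section

variable {α : Type} {x : List α}

/-- The flag recalls the last direction: the head cannot be at 0 after moving right, nor at `n + 1`
after moving left. So the flag identifies the end-marker, also on the empty input. -/
theorem FlagOK.isMax {b : Bool} {p : ℕ} (h : FlagOK x.length b p) :
    (inputSymbol x p = none ∧ b = true) ↔ p = x.length + 1 := by
  rw [inputSymbol_eq_none h.1]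
  obtain ⟨h1, h2, h3⟩ := h
  cases b
  · have := h3 rfl
    simp; omega
  · have := h2 rfl
    simp; omega

theorem FlagOK.isZero {b : Bool} {p : ℕ} (h : FlagOK x.length b p) :
    (inputSymbol x p = none ∧ b = false) ↔ p = 0 := by
  rw [inputSymbol_eq_none h.1]
  obtain ⟨h1, h2, h3⟩ := h
  cases b
  · have := h3 rfl
    simp; omega
  · have := h2 rfl
    simp; omega

theorem HeadOp.flagStep_sound {op : HeadOp α} {b b' : Bool} {p : ℕ} {d : SignType}
    (h : FlagOK x.length b p) (hs : op.flagStep b (inputSymbol x p) = some (b', d)) :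
    ∃ p', op.Exec x p p' ∧ (p' : ℤ) = p + d ∧ FlagOK x.length b' p' := by
  have h1 := h.1
  cases op with
  | nop =>
    simp only [flagStep, Option.some.injEq, Prod.mk.injEq] at hs
    obtain ⟨rfl, rfl⟩ := hs
    exact ⟨p, rfl, by simp, h⟩
  | inc =>
    simp only [flagStep, h.isMax, Option.ite_none_left_eq_some, Option.some.injEq,
      Prod.mk.injEq] at hs
    obtain ⟨h2, rfl, rfl⟩ := hs
    exact ⟨p + 1, ⟨by omega, rfl⟩, by simp, by omega, by simp, by simp⟩
  | dec =>
    simp only [flagStep, h.isZero, Option.ite_none_left_eq_some, Option.some.injEq,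
      Prod.mk.injEq] at hs
    obtain ⟨h2, rfl, rfl⟩ := hs
    refine ⟨p - 1, ?_, ?_, by omega, by simp, fun _ => by omega⟩
    · simp only [Exec]; omega
    · simp only [SignType.coe_neg, SignType.coe_one]; omega
  | zero =>
    simp only [flagStep, h.isZero, Option.ite_none_right_eq_some, Option.some.injEq,
      Prod.mk.injEq] at hs
    obtain ⟨rfl, rfl, rfl⟩ := hs
    exact ⟨0, ⟨rfl, rfl⟩, by simp, h⟩
  | sym o =>
    simp only [flagStep, Option.ite_none_right_eq_some, Option.some.injEq, Prod.mk.injEq] at hs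
    obtain ⟨h2, rfl, rfl⟩ := hs
    exact ⟨p, ⟨h2, rfl⟩, by simp, h⟩

theorem HeadOp.flagStep_complete {op : HeadOp α} {b : Bool} {p p' : ℕ}
    (h : FlagOK x.length b p) (hs : op.Exec x p p') :
    ∃ b' d, op.flagStep b (inputSymbol x p) = some (b', d) ∧ (p' : ℤ) = p + (d : ℤ) ∧
      FlagOK x.length b' p' := by
  have h1 := h.1
  cases op with
  | nop =>
    simp only [Exec] at hs
    subst hs
    exact ⟨b, 0, rfl, by simp, h⟩
  | inc =>
    obtain ⟨h2, rfl⟩ := hs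
    refine ⟨true, 1, ?_, by simp, by omega, by simp, by simp⟩
    simp only [flagStep, h.isMax]
    exact if_neg (by omega)
  | dec =>
    simp only [Exec] at hs
    subst hs
    refine ⟨false, -1, ?_, by simp, by omega, by simp, by omega⟩
    simp only [flagStep, h.isZero]
    exact if_neg (by omega)
  | zero =>
    obtain ⟨rfl, rfl⟩ := hs
    refine ⟨b, 0, ?_, by simp, h⟩
    simp only [flagStep, h.isZero, if_true]
  | sym o =>
    obtain ⟨h2, rfl⟩ := hs
    exact ⟨b, 0, by simp [flagStep, h2], by simp, h⟩

/-- A head that runs to and fro between the end-markers holds a digit `c`.  The flags are the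
direction of the head and whether the digit is zero. -/
def ClockOK (n : ℕ) (f : Bool × Bool) (p c : ℕ) : Prop :=
  c ≤ n + 1 ∧ (f.1 = false → p = c) ∧ (f.1 = true → p + c = n + 1) ∧ (f.2 = true ↔ c = 0)

open Classical in
/-- The action on a digit: reset it, increment it, or leave it unchanged. -/
noncomputable def clockStep (f : Bool × Bool) (o : Option α) :
    Ordering → Option ((Bool × Bool) × SignType)
  | .lt => if o = none ∧ f.2 = false then some ((!f.1, true), 0) else none
  | .eq => if o = none ∧ f.2 = false then none else some ((f.1, false), if f.1 then -1 else 1)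
  | .gt => some (f, 0)

/-- In either direction of the head, the end-markers correspond to the digits 0 and `n + 1`, and the
second flag separates these two. -/
theorem ClockOK.isMax {f : Bool × Bool} {p c : ℕ} (h : ClockOK x.length f p c) :
    (inputSymbol x p = none ∧ f.2 = false) ↔ c = x.length + 1 := by
  obtain ⟨h1, h2, h3, h4⟩ := h
  obtain ⟨f1, f2⟩ := f
  have hp : p ≤ x.length + 1 := by
    cases f1
    · have := h2 rfl; omega
    · have := h3 rfl; omega
  rw [inputSymbol_eq_none hp]
  cases f1 <;> cases f2 <;> simp at h2 h3 h4 ⊢ <;> omega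

theorem ClockOK.le {f : Bool × Bool} {p c n : ℕ} (h : ClockOK n f p c) : p ≤ n + 1 := by
  obtain ⟨h1, h2, h3, h4⟩ := h
  cases hf : f.1
  · have := h2 hf; omega
  · have := h3 hf; omega

/-- The action on a digit `c` with largest value `n + 1`. -/
def DigitStep (n : ℕ) : Ordering → ℕ → ℕ → Prop
  | .lt, c, c' => c = n + 1 ∧ c' = 0
  | .eq, c, c' => c ≤ n ∧ c' = c + 1
  | .gt, c, c' => c' = c

theorem clockStep_sound {f f' : Bool × Bool} {p c : ℕ} {a : Ordering} {d : SignType}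
    (h : ClockOK x.length f p c) (hs : clockStep f (inputSymbol x p) a = some (f', d)) :
    ∃ p' c' : ℕ, DigitStep x.length a c c' ∧ (p' : ℤ) = p + d ∧ ClockOK x.length f' p' c' := by
  have hle := h.le
  cases a with
  | lt =>
    simp only [clockStep, h.isMax, Option.ite_none_right_eq_some, Option.some.injEq,
      Prod.mk.injEq] at hs
    obtain ⟨h2, rfl, rfl⟩ := hs
    -- Resetting needs no movement: reversing the direction at an end-marker turns the largest digit
    -- into 0.
    refine ⟨p, 0, ⟨h2, rfl⟩, by simp, by omega, ?_, ?_, by simp⟩ <;>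
      obtain ⟨h1, h2, h3, h4⟩ := h <;> cases hf : f.1 <;> simp [hf] at h2 h3 ⊢ <;> omega
  | eq =>
    simp only [clockStep, h.isMax, Option.ite_none_left_eq_some, Option.some.injEq,
      Prod.mk.injEq] at hs
    obtain ⟨h0, rfl, rfl⟩ := hs
    obtain ⟨h1, h2, h3, h4⟩ := h
    cases hf : f.1
    · simp [hf] at h2
      exact ⟨p + 1, c + 1, ⟨by omega, rfl⟩, by simp, by omega, by simp; omega, by simp, by simp⟩
    · simp [hf] at h3
      exact ⟨p - 1, c + 1, ⟨by omega, rfl⟩, by simp; omega, by omega, by simp, by simp; omega,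
        by simp⟩
  | gt =>
    simp only [clockStep, Option.some.injEq, Prod.mk.injEq] at hs
    obtain ⟨rfl, rfl⟩ := hs
    exact ⟨p, c, rfl, by simp, h⟩

/-- `DigitStep` determines the new digit, so it is enough that the step is possible; soundness then
gives the rest. -/
theorem clockStep_complete {f : Bool × Bool} {p c c' : ℕ} {a : Ordering}
    (h : ClockOK x.length f p c) (hs : DigitStep x.length a c c') :
    ∃ (f' : Bool × Bool) (d : SignType) (p' : ℕ), clockStep f (inputSymbol x p) a = some (f', d) ∧
      (p' : ℤ) = p + (d : ℤ) ∧ ClockOK x.length f' p' c' := by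
  have key : ∃ f' d, clockStep f (inputSymbol x p) a = some (f', d) := by
    cases a with
    | lt => exact ⟨_, _, if_pos (h.isMax.2 hs.1)⟩
    | eq =>
      refine ⟨_, _, if_neg ?_⟩
      rw [h.isMax]
      have := hs.1
      omega
    | gt => exact ⟨_, _, rfl⟩
  obtain ⟨f', d, hf⟩ := key
  obtain ⟨p', c'', h1, h2, h3⟩ := clockStep_sound h hf
  have : c'' = c' := by
    cases a <;> simp only [DigitStep] at h1 hs <;> omega
  exact ⟨f', d, p', hf, h2, this ▸ h3⟩

end

/-! ### Counting -/

/-- The number with the digits `a 0, …, a (m - 1)` in base `N`. -/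
def digitValue (N m : ℕ) (a : ℕ → ℕ) : ℕ := ∑ j ∈ Finset.range m, a j * N ^ j

theorem digitValue_lt {N m : ℕ} {a : ℕ → ℕ} (h : ∀ j < m, a j < N) : digitValue N m a < N ^ m := by
  induction m with
  | zero => simp [digitValue]
  | succ m ih =>
    have h1 := ih fun j hj => h j (by omega)
    have h2 := Nat.mul_le_mul_right (N ^ m) (Nat.succ_le_of_lt (h m (by omega)))
    rw [digitValue, Finset.sum_range_succ, ← digitValue, pow_succ, mul_comm (N ^ m)]
    rw [Nat.succ_mul] at h2
    omega

theorem digitValue_of_max {N m : ℕ} {a : ℕ → ℕ} (h : ∀ j < m, a j + 1 = N) :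
    digitValue N m a + 1 = N ^ m := by
  induction m with
  | zero => simp [digitValue]
  | succ m ih =>
    have h1 := ih fun j hj => h j (by omega)
    have h2 := congrArg (· * N ^ m) (h m (by omega))
    rw [digitValue, Finset.sum_range_succ, ← digitValue, pow_succ, mul_comm (N ^ m)]
    simp only [add_mul, one_mul] at h2
    omega

/-- A carry: the maximal digits below `τ` are worth `(n + 2) ^ τ - 1` and are reset, while the digit
`τ` gains `(n + 2) ^ τ`. -/
theorem digitValue_succ {n m τ : ℕ} {a a' : ℕ → ℕ} (hτ : τ < m)
    (h : ∀ j < m, DigitStep n (compare j τ) (a j) (a' j)) :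
    digitValue (n + 2) m a' = digitValue (n + 2) m a + 1 := by
  induction m with
  | zero => omega
  | succ m ih =>
    rw [digitValue, digitValue, Finset.sum_range_succ, Finset.sum_range_succ, ← digitValue,
      ← digitValue]
    by_cases hm : τ = m
    · subst hm
      have h1 : digitValue (n + 2) τ a + 1 = (n + 2) ^ τ := digitValue_of_max fun j hj => by
        have := h j (by omega)
        rw [Nat.compare_eq_lt.2 hj] at this
        rw [this.1]
      have h2 : digitValue (n + 2) τ a' = 0 := Finset.sum_eq_zero fun j hj => by
        rw [Finset.mem_range] at hj
        have := h j (by omega)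
        rw [Nat.compare_eq_lt.2 hj] at this
        rw [this.2, zero_mul]
      have h3 := h τ (by omega)
      rw [Nat.compare_eq_eq.2 rfl] at h3
      rw [h2, h3.2, add_mul, one_mul]
      omega
    · have h3 := h m (by omega)
      rw [Nat.compare_eq_gt.2 (by omega : τ < m)] at h3
      rw [ih (by omega) fun j hj => h j (by omega), show a' m = a m from h3]
      omega

/-- The digits of the numbers below `(n + 2) ^ m`, in succession. -/
theorem exists_clock (n m : ℕ) (hm : 0 < m) : ∃ (a : ℕ → ℕ → ℕ) (τ : ℕ → Fin m),
    (∀ j, a 0 j = 0) ∧ ∀ t, t + 1 < (n + 2) ^ m → ∀ j < m,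
      DigitStep n (compare j (τ t)) (a t j) (a (t + 1) j) := by
  have key : ∀ a : ℕ → ℕ, ∃ (a' : ℕ → ℕ) (τ : Fin m), (∀ j < m, a j ≤ n + 1) →
      digitValue (n + 2) m a + 1 < (n + 2) ^ m →
      ∀ j < m, DigitStep n (compare j τ) (a j) (a' j) := by
    intro a
    -- The carry stops at the lowest digit that is not maximal. If all digits are maximal, the value
    -- is `(n + 2) ^ m - 1` and has no successor in range.
    by_cases h : ∃ τ, τ < m ∧ a τ ≤ n
    · classical
      let τ := Nat.find h
      obtain ⟨h1, h2⟩ := Nat.find_spec h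
      refine ⟨fun j => if j < τ then 0 else if j = τ then a j + 1 else a j, ⟨τ, h1⟩,
        fun ha _ j hj => ?_⟩
      rcases lt_trichotomy j τ with hlt | rfl | hgt
      · have h3 := Nat.find_min h hlt
        have h4 := ha j hj
        rw [Nat.compare_eq_lt.2 hlt]
        exact ⟨by omega, by simp [hlt]⟩
      · rw [Nat.compare_eq_eq.2 rfl]
        exact ⟨h2, by simp⟩
      · rw [Nat.compare_eq_gt.2 hgt]
        simp only [DigitStep]
        rw [if_neg (by omega), if_neg (by omega)]
    · refine ⟨a, ⟨0, hm⟩, fun ha hv => ?_⟩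
      have := digitValue_of_max (N := n + 2) (m := m) (a := a) fun j hj => by
        have h1 := ha j hj
        have h2 : ¬ a j ≤ n := fun h' => h ⟨j, hj, h'⟩
        omega
      omega
  choose f τ hf using key
  let a : ℕ → ℕ → ℕ := fun t => f^[t] fun _ => 0
  have ha : ∀ t, a (t + 1) = f (a t) := fun t => Function.iterate_succ_apply' _ _ _
  have hval : ∀ t, t < (n + 2) ^ m → (∀ j < m, a t j ≤ n + 1) ∧ digitValue (n + 2) m (a t) = t := by
    intro t
    induction t with
    | zero => exact fun _ => ⟨fun _ _ => Nat.zero_le _, by simp [digitValue, a]⟩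
    | succ t ih =>
      intro ht
      obtain ⟨h1, h2⟩ := ih (by omega)
      have h3 := hf (a t) h1 (by omega)
      rw [ha]
      refine ⟨fun j hj => ?_, by rw [digitValue_succ (τ (a t)).2 h3, h2]⟩
      have h4 := h3 j hj
      have h5 := h1 j hj
      cases hc : compare j (τ (a t) : ℕ) <;> rw [hc] at h4 <;> simp only [DigitStep] at h4 <;> omega
  refine ⟨a, fun t => τ (a t), fun _ => rfl, fun t ht => ?_⟩
  rw [ha]
  obtain ⟨h1, h2⟩ := hval t (by omega)
  exact hf (a t) h1 (by omega)

/-- A shortest path repeats no vertex, since the part between two equal vertices could be cut out.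
Only the reachable vertices have to be covered by the finite type. -/
theorem exists_short_path {X Y : Type} [Fintype Y] {r : X → X → Prop} {a b : X}
    (h : Relation.ReflTransGen r a b) (g : Y → X)
    (hg : ∀ c, Relation.ReflTransGen r a c → ∃ y, g y = c) :
    ∃ (l : ℕ) (f : ℕ → X), l < Fintype.card Y ∧ f 0 = a ∧ f l = b ∧
      ∀ i < l, r (f i) (f (i + 1)) := by
  classical
  have hex : ∃ l, ∃ f : ℕ → X, f 0 = a ∧ f l = b ∧ ∀ i < l, r (f i) (f (i + 1)) := by
    clear hg
    induction h with
    | refl => exact ⟨0, fun _ => a, rfl, rfl, by simp⟩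
    | @tail b c _ hs ih =>
      obtain ⟨l, f, h0, h1, h2⟩ := ih
      refine ⟨l + 1, fun i => if i ≤ l then f i else c, by simpa using h0, by simp,
        fun i hi => ?_⟩
      rcases Nat.lt_succ_iff_lt_or_eq.1 hi with h | rfl
      · simpa [h.le, Nat.succ_le_of_lt h] using h2 i h
      · simpa [h1] using hs
  obtain ⟨f, h0, h1, h2⟩ := Nat.find_spec hex
  set l := Nat.find hex with hl
  have hmin := fun k (hk : k < l) => Nat.find_min hex hk
  refine ⟨l, f, ?_, h0, h1, h2⟩
  have hreach : ∀ i ≤ l, Relation.ReflTransGen r a (f i) := by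
    intro i hi
    induction i with
    | zero => rw [h0]
    | succ i ih => exact (ih (by omega)).tail (h2 i (by omega))
  have hy : ∀ i : Fin (l + 1), ∃ y, g y = f i := fun i => hg _ (hreach i (by omega))
  choose y hy using hy
  have hinj : Function.Injective y := by
    have key : ∀ i j : Fin (l + 1), i < j → y i ≠ y j := by
      intro i j hij hyy
      have hf : f i = f j := by rw [← hy, ← hy, hyy]
      have hij' : (i : ℕ) < j := hij
      have hj := j.2
      refine hmin (l - (j - i)) (by omega)
        ⟨fun k => if k ≤ i then f k else f (k + (j - i)), by simpa using h0, ?_, fun k hk => ?_⟩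
      · by_cases h : l - (j - i) ≤ (i : ℕ)
        · have : (j : ℕ) = l := by omega
          simp only [h, if_true]
          rw [show l - (j - i) = (i : ℕ) by omega, hf, this, h1]
        · simp only [h, if_false]
          rw [show l - (j - i) + (j - i) = l by omega, h1]
      · rcases lt_trichotomy k (i : ℕ) with h | h | h
        · simpa [h.le, Nat.succ_le_of_lt h] using h2 k (by omega)
        · have h3 := h2 j (by omega)
          subst h
          simp only [le_refl, if_true, Nat.succ_le_iff, lt_irrefl, if_false]
          rw [hf, show (i : ℕ) + 1 + (j - i) = j + 1 by omega]
          exact h3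
        · have h3 := h2 (k + (j - i)) (by omega)
          simp only [if_neg (not_le.2 h), if_neg (not_le.2 (Nat.lt_succ_of_lt h))]
          rw [show k + 1 + (j - i) = k + (j - i) + 1 by omega]
          exact h3
    intro i j hyy
    rcases lt_trichotomy i j with h | h | h
    · exact (key i j h hyy).elim
    · exact h
    · exact (key j i h hyy.symm).elim
  have := Fintype.card_le_of_injective y hinj
  simp only [Fintype.card_fin] at this
  omega

/-- A random choice of a test that is made only slightly more often than not. -/
theorem exists_selection (T : Type) [Finite T] [Nonempty T] :
    ∃ (r : ℕ) (sel : (Fin (r + 1) → Bool) → Option T),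
      2 ^ r + 1 ≤ {u | ∃ τ, sel u = some τ}.ncard ∧
      ∀ τ, 2 ^ r + 1 ≤ {u | sel u = none ∨ sel u = some τ}.ncard := by
  classical
  obtain ⟨k, ⟨g⟩⟩ := Finite.exists_equiv_fin T
  have hk : 0 < k := Fin.pos (g (Classical.arbitrary T))
  let r := k + 1
  -- Two full cycles of residues modulo `k` fit below `2 ^ r`, so each test is selected at least
  -- twice.
  have hr : 2 * k ≤ 2 ^ r := by
    have := Nat.lt_two_pow_self (n := k)
    simp only [r, pow_succ]; omega
  have hr1 : 2 ^ (r + 1) = 2 * 2 ^ r := by ring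
  have e : (Fin (r + 1) → Bool) ≃ Fin (2 ^ (r + 1)) :=
    Fintype.equivOfCardEq (by simp)
  -- Of the `2 ^ (r + 1)` outcomes, `2 ^ r + 1` select a test and the remaining `2 ^ r - 1` reject
  -- outright.
  let sel : (Fin (r + 1) → Bool) → Option T := fun u =>
    if (e u : ℕ) < 2 ^ r + 1 then some (g.symm ⟨e u % k, Nat.mod_lt _ hk⟩) else none
  have hcard : ∀ (A : Set (Fin (r + 1) → Bool)) (f : Fin (2 ^ r + 1) → Fin (2 ^ (r + 1))),
      f.Injective → (∀ i, e.symm (f i) ∈ A) → 2 ^ r + 1 ≤ A.ncard := by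
    intro A f hf hA
    have h1 : Set.range (fun i => e.symm (f i)) ⊆ A := by rintro _ ⟨i, rfl⟩; exact hA i
    have h2 := Set.ncard_le_ncard h1
    rw [← Set.image_univ, Set.ncard_image_of_injective _ 
      (show Function.Injective fun i => e.symm (f i) from e.symm.injective.comp hf)] at h2
    simpa [Set.ncard_univ] using h2
  refine ⟨r, sel, ?_, fun τ => ?_⟩
  · refine hcard _ (fun i => ⟨i, by omega⟩) (fun i j h => by simpa [Fin.ext_iff] using h) fun i => ?_
    refine ⟨_, if_pos ?_⟩
    simp only [Equiv.apply_symm_apply]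
    exact i.2
  · have hτ := (g τ).2
    -- The outcomes numbered `g τ` and `g τ + k` select `τ`; together with the `2 ^ r - 1` rejecting
    -- ones these are `2 ^ r + 1`.
    refine hcard _ (fun i => if i.1 = 0 then ⟨g τ, by omega⟩ else if i.1 = 1 then
      ⟨g τ + k, by omega⟩ else ⟨2 ^ r - 1 + i, by omega⟩) (fun i j h => ?_) fun i => ?_
    · have h' := congrArg Fin.val h
      have hi := i.2
      have hj := j.2
      apply Fin.ext
      simp only at h'
      split_ifs at h' <;> simp only at h' <;> omega
    · simp only [Set.mem_ofPred_eq]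
      split_ifs with h0 h1
      · right
        simp only [sel, Equiv.apply_symm_apply]
        rw [if_pos (by omega)]
        simp [Nat.mod_eq_of_lt hτ]
      · right
        simp only [sel, Equiv.apply_symm_apply]
        rw [if_pos (by omega)]
        simp [Nat.mod_eq_of_lt hτ]
      · left
        simp only [sel, Equiv.apply_symm_apply]
        rw [if_neg (by omega)]


/-! ### Verifying the computation of a head program -/

namespace HeadProgram

variable {α : Type} {k : ℕ} (P : HeadProgram α (Fin k)) (m : ℕ)

/-- A letter of a certificate: an edge of the program, and the digit of the clock that is
incremented. -/
structure Letter where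
  src : P.Node
  head : Fin k
  op : HeadOp α
  tgt : P.Node
  clock : Fin m

instance [Finite α] : Finite (HeadOp α) := by
  refine Finite.of_surjective (fun a : Option α ⊕ Fin 4 => match a with
    | .inl o => HeadOp.sym o
    | .inr 0 => .nop
    | .inr 1 => .inc
    | .inr 2 => .dec
    | .inr 3 => .zero) ?_
  rintro (_ | _ | _ | _ | o)
  exacts [⟨.inr 0, rfl⟩, ⟨.inr 1, rfl⟩, ⟨.inr 2, rfl⟩, ⟨.inr 3, rfl⟩, ⟨.inl o, rfl⟩]

instance [Finite α] : Finite (P.Letter m) := by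
  have := P.finNode
  refine Finite.of_injective
    (fun l : P.Letter m => (l.src, l.head, l.op, l.tgt, l.clock)) ?_
  rintro ⟨_, _, _, _, _⟩ ⟨_, _, _, _, _⟩ h
  simpa using h

variable {P m}

/-- A test follows one of the heads or one of the digits of the clock. -/
noncomputable def testStep (τ : Fin k ⊕ Fin m) (f : Bool × Bool) (o : Option α) (l : P.Letter m) :
    Option ((Bool × Bool) × SignType) :=
  match τ with
  | .inl i => if l.head = i then (l.op.flagStep f.1 o).map fun b => ((b.1, f.2), b.2)
      else some (f, 0)
  | .inr j => clockStep f o (compare (j : ℕ) l.clock)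

open Classical in
/-- The next state of a test and the movement of its head, `none` standing for rejection. -/
noncomputable def testMove (τ : Fin k ⊕ Fin m) (q : P.Node) (f : Bool × Bool) (o : Option α)
    (g : Option (Option (P.Letter m))) : Option ((P.Node × (Bool × Bool)) × SignType) :=
  match g with
  | some (some l) => if l.src = q ∧ P.edge q l.head l.op l.tgt then
      (testStep τ f o l).map fun b => ((l.tgt, b.1), b.2) else none
  | _ => none

variable (P m)

open Classical in
/-- The verifier that carries out one of the tests, or none, depending on its coins. -/
noncomputable abbrev verifier [Finite α] {r : ℕ}
    (sel : (Fin (r + 1) → Bool) → Option (Fin k ⊕ Fin m)) : Verifier α where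
  R := Fin (r + 1) × (Fin (r + 1) → Bool)
  D := (Fin k ⊕ Fin m) × P.Node × (Bool × Bool)
  Work := Unit
  Comm := Option (Option (P.Letter m))
  finR := inferInstance
  finD := by have := P.finNode; infer_instance
  finWork := inferInstance
  finComm := inferInstance
  start := .coin (0, fun _ => false)
  start_ne_accept := by simp
  start_ne_reject := by simp
  blank := ()
  null := none
  msg q := match q with
    | .det _ => some none
    | _ => none
  δcoin q _ _ _ b :=
    (if h : (q.1 : ℕ) + 1 < r + 1 then .coin (⟨q.1 + 1, h⟩, Function.update q.2 q.1 b) else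
      match sel (Function.update q.2 q.1 b) with
      | none => .reject
      | some τ => .det (τ, P.start, (false, true)), (), 0, 0)
  δdet q o _ g := if q.2.1 = P.final then (.accept, (), 0, 0) else
    match testMove q.1 q.2.1 q.2.2 o g with
    | none => (.reject, (), 0, 0)
    | some ((q', f'), d) => (.det (q.1, q', f'), (), d, 0)

/-- The flags of a test are correct for the position of its head. -/
def TestOK (x : List α) (τ : Fin k ⊕ Fin m) (f : Bool × Bool) (v : Fin k → ℕ) (a : ℕ → ℕ)
    (p : ℕ) : Prop :=
  match τ with
  | .inl i => p = v i ∧ FlagOK x.length f.1 p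
  | .inr j => ClockOK x.length f p (a j)

variable {P m} {x : List α}

omit P in
theorem TestOK.le {τ : Fin k ⊕ Fin m} {f v a p} (h : TestOK m x τ f v a p) :
    p ≤ x.length + 1 := by
  rcases τ with i | j
  · exact h.2.1
  · exact ClockOK.le h

/-- A test that does not fail determines the new position of its head. -/
theorem testStep_sound {τ : Fin k ⊕ Fin m} {f f' : Bool × Bool} {v : Fin k → ℕ} {a : ℕ → ℕ}
    {p : ℕ} {l : P.Letter m} {d : SignType} (h : TestOK m x τ f v a p)
    (hs : testStep τ f (inputSymbol x p) l = some (f', d)) :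
    ∃ p' : ℕ, (p' : ℤ) = p + (d : ℤ) ∧
      match τ with
      | .inl i => FlagOK x.length f'.1 p' ∧ (l.head = i → l.op.Exec x (v i) p') ∧
          (l.head ≠ i → p' = v i)
      | .inr j => ∃ c', DigitStep x.length (compare (j : ℕ) l.clock) (a j) c' ∧
          ClockOK x.length f' p' c' := by
  rcases τ with i | j
  · obtain ⟨rfl, h⟩ := h
    simp only [testStep] at hs
    split_ifs at hs with hi
    · simp only [Option.map_eq_some_iff, Prod.mk.injEq, Prod.exists] at hs
      obtain ⟨b', d', hs', rfl, rfl⟩ := hs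
      obtain ⟨p', h1, h2, h3⟩ := HeadOp.flagStep_sound h hs'
      exact ⟨p', h2, h3, fun _ => h1, fun hne => (hne hi).elim⟩
    · simp only [Option.some.injEq, Prod.mk.injEq] at hs
      obtain ⟨rfl, rfl⟩ := hs
      exact ⟨v i, by simp, h, fun he => (hi he).elim, fun _ => rfl⟩
  · obtain ⟨p', c', h1, h2, h3⟩ := clockStep_sound h hs
    exact ⟨p', h2, c', h1, h3⟩

theorem testStep_complete {τ : Fin k ⊕ Fin m} {f : Bool × Bool} {v : Fin k → ℕ} {a a' : ℕ → ℕ}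
    {p p' : ℕ} {l : P.Letter m} (h : TestOK m x τ f v a p) (h1 : l.op.Exec x (v l.head) p')
    (h2 : ∀ j < m, DigitStep x.length (compare j l.clock) (a j) (a' j)) :
    ∃ (f' : Bool × Bool) (d : SignType) (p'' : ℕ),
      testStep τ f (inputSymbol x p) l = some (f', d) ∧ (p'' : ℤ) = p + (d : ℤ) ∧
      TestOK m x τ f' (Function.update v l.head p') a' p'' := by
  rcases τ with i | j
  · obtain ⟨rfl, h⟩ := h
    by_cases hi : l.head = i
    · subst hi
      obtain ⟨b', d, h3, h4, h5⟩ := HeadOp.flagStep_complete h h1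
      exact ⟨(b', f.2), d, p', by simp [testStep, h3], h4, by simp, h5⟩
    · exact ⟨f, 0, v i, by simp [testStep, hi], by simp,
        by rw [Function.update_of_ne (Ne.symm hi)], h⟩
  · obtain ⟨f', d, p'', h3, h4, h5⟩ := clockStep_complete h (h2 j j.2)
    exact ⟨f', d, p'', h3, h4, h5⟩

variable [Finite α] {r : ℕ} {sel : (Fin (r + 1) → Bool) → Option (Fin k ⊕ Fin m)}

/-- What holds at all times, for all provers and coins. -/
def VerifierInv (x : List α) (c : (P.verifier m sel).Config) : Prop :=
  c.workPos = 0 ∧ c.coins ≤ r + 1 ∧ ∃ p : ℕ, c.inputPos = p ∧ p ≤ x.length + 1 ∧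
    match c.state with
    | .coin q => c.coins = q.1 ∧ p = 0
    | .det q => ∃ v a, TestOK m x q.1 q.2.2 v a p
    | _ => True

omit [Finite α] in
theorem testOK_init (τ : Fin k ⊕ Fin m) :
    TestOK m x τ (false, true) (fun _ => 0) (fun _ => 0) 0 := by
  rcases τ with i | j
  · exact ⟨rfl, by omega, by simp, by simp⟩
  · exact ⟨Nat.zero_le _, by simp, by simp, by simp⟩

omit [Finite α] in
theorem testMove_eq_some {τ : Fin k ⊕ Fin m} {q q' : P.Node} {f f' : Bool × Bool} {o : Option α}
    {g : Option (Option (P.Letter m))} {d : SignType} :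
    testMove τ q f o g = some ((q', f'), d) ↔ ∃ l : P.Letter m, g = some (some l) ∧ l.src = q ∧
      P.edge q l.head l.op l.tgt ∧ l.tgt = q' ∧ testStep τ f o l = some (f', d) := by
  rcases g with _ | _ | l
  · simp [testMove]
  · simp [testMove]
  · simp only [testMove, Option.ite_none_right_eq_some, Option.map_eq_some_iff, Prod.mk.injEq,
      Option.some.injEq]
    constructor
    · rintro ⟨⟨h1, h2⟩, ⟨b, d'⟩, h3, ⟨rfl, rfl⟩, rfl⟩
      exact ⟨l, rfl, h1, h2, rfl, h3⟩
    · rintro ⟨_, rfl, h1, h2, rfl, h3⟩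
      exact ⟨⟨h1, h2⟩, (f', d), h3, ⟨rfl, rfl⟩, rfl⟩

/-- The head has to stay on the input whatever the prover sends. A test knows nothing of the other
heads and digits, so the valuation and the clock are existential and may be chosen anew after each
step to fit the head that is followed. -/
theorem VerifierInv.step {c : (P.verifier m sel).Config} (h : VerifierInv x c)
    (Q : Prover α (P.verifier m sel).Comm) (ω : ℕ → Bool) :
    VerifierInv x ((P.verifier m sel).step Q x ω c) := by
  obtain ⟨q, p, w, p', hist, n⟩ := c
  obtain ⟨rfl, hn, p, rfl, hp, hq⟩ := h
  rcases q with q | q | _ | _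
  · obtain ⟨h1, rfl⟩ := hq
    simp only at h1
    subst h1
    have hlt := q.1.2
    refine ⟨by simp [Verifier.step, Verifier.apply],
      by simp [Verifier.step, Verifier.apply]; omega, 0,
      by simp [Verifier.step, Verifier.apply], hp, ?_⟩
    simp only [Verifier.step, Verifier.apply]
    split_ifs with h
    · simp
    · cases hs : sel (Function.update q.2 q.1 (ω q.1)) with
      | none => trivial
      | some τ => exact ⟨_, _, testOK_init τ⟩
  · obtain ⟨τ, q, f⟩ := q
    obtain ⟨v, a, hq⟩ := hq
    simp only at hq
    by_cases hfin : q = P.final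
    · refine ⟨by simp [Verifier.step, Verifier.apply, hfin], hn, p,
        by simp [Verifier.step, Verifier.apply, hfin], hp, ?_⟩
      simp [Verifier.step, Verifier.apply, hfin]
    · cases hm : testMove τ q f (inputSymbol x p)
        ((P.verifier m sel).received Q x ⟨.det (τ, q, f), p, w, 0, hist, n⟩) with
      | none =>
        refine ⟨by simp [Verifier.step, Verifier.apply, hfin, hm], hn, p,
          by simp [Verifier.step, Verifier.apply, hfin, hm], hp, ?_⟩
        simp [Verifier.step, Verifier.apply, hfin, hm]
      | some b =>
        obtain ⟨⟨q', f'⟩, d⟩ := b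
        obtain ⟨l, -, -, -, -, hl⟩ := testMove_eq_some.1 hm
        obtain ⟨p', h1, h2⟩ := testStep_sound hq hl
        have h3 : ∃ v a, TestOK m x τ f' v a p' := by
          rcases τ with i | j
          · exact ⟨fun _ => p', a, rfl, h2.1⟩
          · obtain ⟨c', -, h3⟩ := h2
            exact ⟨v, fun _ => c', h3⟩
        have hp' : p' ≤ x.length + 1 := by
          obtain ⟨_, _, h⟩ := h3
          exact h.le
        refine ⟨by simp [Verifier.step, Verifier.apply, hfin, hm], hn, p',
          by simp [Verifier.step, Verifier.apply, hfin, hm, h1], hp', ?_⟩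
        simpa [Verifier.step, Verifier.apply, hfin, hm] using h3
  · exact ⟨rfl, hn, p, rfl, hp, hq⟩
  · exact ⟨rfl, hn, p, rfl, hp, hq⟩

theorem verifierInv_run (Q : Prover α (P.verifier m sel).Comm) (ω : ℕ → Bool) (t : ℕ) :
    VerifierInv x ((P.verifier m sel).run Q x ω t) := by
  induction t with
  | zero => exact ⟨rfl, Nat.zero_le _, 0, rfl, Nat.zero_le _, rfl, rfl⟩
  | succ t ih =>
    rw [Verifier.run_succ]
    exact ih.step Q ω

theorem verifier_restricted (provers : Set (Prover α (P.verifier m sel).Comm)) :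
    (P.verifier m sel).Restricted provers consBound consBound := by
  refine ⟨fun Q _ x ω t => ?_, ⟨fun _ => 1, mem_consBound_iff.2 ⟨1, fun _ => le_rfl⟩,
    fun Q _ x ω t => ?_⟩, fun _ => r + 1, mem_consBound_iff.2 ⟨r + 1, fun _ => le_rfl⟩,
    fun Q _ x ω t => ?_⟩
  · obtain ⟨-, -, p, h1, h2, -⟩ := verifierInv_run (P := P) (m := m) (sel := sel) (x := x) Q ω t
    rw [h1]
    omega
  · have h1 : (fun i => ((P.verifier m sel).run Q x ω i).workPos) = fun _ => 0 :=
      funext fun i => (verifierInv_run Q ω i).1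
    rw [h1, cellsVisited]
    refine (Finset.card_le_card (t := {0}) fun z hz => ?_).trans_eq (Finset.card_singleton _)
    obtain ⟨_, _, rfl⟩ := Finset.mem_image.1 hz
    simp
  · exact (verifierInv_run Q ω t).2.1

/-- The configuration in which the test `τ` is in the state `q` with the flags `f`. -/
def testConfig (τ : Fin k ⊕ Fin m) (q : P.Node) (f : Bool × Bool) (p : ℕ)
    (h : List ((P.verifier m sel).Comm × (P.verifier m sel).Comm)) : (P.verifier m sel).Config :=
  ⟨.det (τ, q, f), p, fun _ => (), 0, h, r + 1⟩

/-- Coin states send the null symbol, so the history is still empty after the tosses and every test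
reads the certificate from its first letter. -/
theorem run_coins (Q : Prover α (P.verifier m sel).Comm) (ω : ℕ → Bool) (t : ℕ) (ht : t < r + 1) :
    (P.verifier m sel).run Q x ω t =
      ⟨.coin (⟨t, ht⟩, fun i => if (i : ℕ) < t then ω i else false), 0, fun _ => (), 0, [], t⟩ := by
  induction t with
  | zero => simp [Verifier.run, Verifier.init]
  | succ t ih =>
    rw [Verifier.run_succ, ih (by omega)]
    simp only [Verifier.step, Verifier.apply, Verifier.newHistory, ht, dif_pos]
    have ht' : t < r + 1 := by omega
    simp
    funext i
    by_cases hi : (i : ℕ) = t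
    · obtain rfl : i = ⟨t, ht'⟩ := Fin.ext hi
      simp
    · rw [Function.update_of_ne (fun h => hi (by rw [h]))]
      have : (i : ℕ) < t ↔ (i : ℕ) < t + 1 := by omega
      simp [this]

theorem run_select (Q : Prover α (P.verifier m sel).Comm) (ω : ℕ → Bool) :
    (P.verifier m sel).run Q x ω (r + 1) =
      match sel (fun i => ω i) with
      | none => ⟨.reject, 0, fun _ => (), 0, [], r + 1⟩
      | some τ => testConfig τ P.start (false, true) 0 [] := by
  rw [Verifier.run_succ, run_coins Q ω r (by omega)]
  have h1 : Function.update (fun i : Fin (r + 1) => if (i : ℕ) < r then ω i else false)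
      ⟨r, by omega⟩ (ω r) = fun i : Fin (r + 1) => ω i := by
    funext i
    by_cases hi : (i : ℕ) = r
    · obtain rfl : i = ⟨r, Nat.lt_succ_self r⟩ := Fin.ext hi
      simp
    · rw [Function.update_of_ne (fun h => hi (by rw [h]))]
      have : (i : ℕ) < r := by omega
      simp [this]
  simp only [Verifier.step, Verifier.apply, Verifier.newHistory, lt_irrefl, dif_neg,
    not_false_eq_true, h1]
  cases sel (fun i => ω i) <;> simp [testConfig]

theorem step_testConfig_final (c : List α → ℕ → (P.verifier m sel).Comm) (ω : ℕ → Bool)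
    (τ : Fin k ⊕ Fin m) (f : Bool × Bool) (p : ℕ)
    (h : List ((P.verifier m sel).Comm × (P.verifier m sel).Comm)) :
    ((P.verifier m sel).step (.ofSequence c) x ω (testConfig τ P.final f p h)).state =
      .accept := by
  simp [Verifier.step, Verifier.apply, testConfig]

theorem step_testConfig_some (c : List α → ℕ → (P.verifier m sel).Comm) (ω : ℕ → Bool)
    {τ : Fin k ⊕ Fin m} {q q' : P.Node} {f f' : Bool × Bool} {p p' : ℕ} {d : SignType}
    {h : List ((P.verifier m sel).Comm × (P.verifier m sel).Comm)} (hq : q ≠ P.final)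
    (hm : testMove τ q f (inputSymbol x p) (c x h.length) = some ((q', f'), d))
    (hp : (p' : ℤ) = p + d) : ∃ y,
    (P.verifier m sel).step (.ofSequence c) x ω (testConfig τ q f p h) =
      testConfig τ q' f' p' (h ++ [y]) := by
  refine ⟨(some none, c x h.length), ?_⟩
  simp [Verifier.step, Verifier.apply, testConfig, Verifier.received, hq, Prover.ofSequence, hm, hp,
    Verifier.newHistory]

theorem step_testConfig_none (c : List α → ℕ → (P.verifier m sel).Comm) (ω : ℕ → Bool)
    {τ : Fin k ⊕ Fin m} {q : P.Node} {f : Bool × Bool} {p : ℕ}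
    {h : List ((P.verifier m sel).Comm × (P.verifier m sel).Comm)} (hq : q ≠ P.final)
    (hm : testMove τ q f (inputSymbol x p) (c x h.length) = none) :
    ((P.verifier m sel).step (.ofSequence c) x ω (testConfig τ q f p h)).state = .reject := by
  simp [Verifier.step, Verifier.apply, testConfig, Verifier.received, hq, Prover.ofSequence, hm]

end HeadProgram


/-! ### Soundness and completeness of the tests of a certificate -/

namespace HeadProgram

variable {α : Type} {k : ℕ} {P : HeadProgram α (Fin k)} {m : ℕ} {x : List α} [Finite α] {r : ℕ}
  {sel : (Fin (r + 1) → Bool) → Option (Fin k ⊕ Fin m)}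

/-- If the program does not accept, then every certificate fails one of the tests. -/
theorem verifier_sound (hm : 0 < m) (c : List α → ℕ → (P.verifier m sel).Comm)
    (hx : ∀ v, ¬ P.Reach x (P.start, fun _ => 0) (P.final, v)) :
    ∃ τ, ∀ ω : ℕ → Bool, sel (fun i => ω i) = some τ →
      ∃ t, ((P.verifier m sel).run (.ofSequence c) x ω t).state = .reject := by
  by_contra hcon
  push Not at hcon
  choose ω hω hrej using hcon
  -- If every test has a run that does not reject, these runs advance in lockstep on the same
  -- certificate. Each accounts for one head or one digit; jointly they yield a run of the program
  -- and a clock showing `t` after `t` letters.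
  have key : ∀ t : ℕ, ∃ (q : P.Node) (v : Fin k → ℕ) (a : ℕ → ℕ),
      P.Reach x (P.start, fun _ => 0) (q, v) ∧ digitValue (x.length + 2) m a = t ∧
      (∀ j < m, a j < x.length + 2) ∧ ∀ τ, ∃ f p h,
        (P.verifier m sel).run (.ofSequence c) x (ω τ) (r + 1 + t) = testConfig τ q f p h ∧
        h.length = t ∧ TestOK m x τ f v a p := by
    intro t
    induction t with
    | zero =>
      refine ⟨P.start, fun _ => 0, fun _ => 0, .refl, by simp [digitValue], fun _ _ => Nat.succ_pos _,
        fun τ => ⟨(false, true), 0, [], ?_, rfl, testOK_init τ⟩⟩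
      rw [add_zero, run_select, hω τ]
    | succ t ih =>
      obtain ⟨q, v, a, hreach, hval, ha, hτ⟩ := ih
      have hq : q ≠ P.final := by
        rintro rfl
        exact hx v hreach
      choose f p h hrun hlen hok using hτ
      have hmove : ∀ τ, ∃ l : P.Letter m, c x t = some (some l) ∧ l.src = q ∧
          P.edge q l.head l.op l.tgt ∧ ∃ f' d,
            testStep τ (f τ) (inputSymbol x (p τ)) l = some (f', d) := by
        intro τ
        cases hmv : testMove τ q (f τ) (inputSymbol x (p τ)) (c x (h τ).length) with
        | none =>
          have h1 := step_testConfig_none c (ω τ) hq hmv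
          rw [← hrun τ, ← Verifier.run_succ] at h1
          exact (hrej τ _ h1).elim
        | some b =>
          obtain ⟨⟨q', f'⟩, d⟩ := b
          obtain ⟨l, h1, h2, h3, -, h4⟩ := testMove_eq_some.1 hmv
          rw [hlen τ] at h1
          exact ⟨l, h1, h2, h3, f', d, h4⟩
      -- The letter does not depend on the test, so any test may name it; a digit test exists
      -- because `0 < m`.
      obtain ⟨l, hl, hsrc, hedge, -⟩ := hmove (.inr ⟨0, hm⟩)
      have hstep : ∀ τ, ∃ f' d, testStep τ (f τ) (inputSymbol x (p τ)) l = some (f', d) := by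
        intro τ
        obtain ⟨l', h1, -, -, h2⟩ := hmove τ
        rw [hl] at h1
        obtain rfl : l = l' := by simpa using h1
        exact h2
      choose f' d hstep using hstep
      have hsound := fun τ => testStep_sound (hok τ) (hstep τ)
      choose p' hp' hs using hsound
      have hdig : ∀ j : Fin m, ∃ c', DigitStep x.length (compare (j : ℕ) l.clock) (a j) c' ∧
          ClockOK x.length (f' (.inr j)) (p' (.inr j)) c' := fun j => hs (.inr j)
      choose a' ha' hclock using hdig
      have hv : ∀ i, p' (.inl i) = Function.update v l.head (p' (.inl l.head)) i := by
        intro i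
        by_cases hi : i = l.head
        · subst hi; simp
        · rw [Function.update_of_ne hi]
          exact (hs (.inl i)).2.2 (Ne.symm hi)
      refine ⟨l.tgt, Function.update v l.head (p' (.inl l.head)),
        fun j => if hj : j < m then a' ⟨j, hj⟩ else 0,
        hreach.tail ⟨l.head, l.op, _, hedge, (hs (.inl l.head)).2.1 rfl, rfl⟩, ?_,
        fun j hj => ?_, fun τ => ?_⟩
      · rw [digitValue_succ (τ := l.clock) l.clock.2, hval]
        intro j hj
        simp only [hj, dif_pos]
        exact ha' ⟨j, hj⟩
      · simp only [hj, dif_pos]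
        have := (hclock ⟨j, hj⟩).1
        omega
      · obtain ⟨y, hy⟩ := step_testConfig_some c (ω τ) hq
          (testMove_eq_some.2 ⟨l, (hlen τ).symm ▸ hl, hsrc, hedge, rfl, hstep τ⟩) (hp' τ)
        refine ⟨f' τ, p' τ, h τ ++ [y], ?_, by simp [hlen τ], ?_⟩
        · rw [← add_assoc, Verifier.run_succ, hrun τ, hy]
        · rcases τ with i | j
          · exact ⟨hv i, (hs (.inl i)).1⟩
          · simpa [TestOK] using hclock j
  -- A clock with `m` digits cannot show `(x.length + 2) ^ m`, so an endless certificate is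
  -- impossible.
  obtain ⟨q, v, a, -, h1, h2, -⟩ := key ((x.length + 2) ^ m)
  have := digitValue_lt h2
  omega

/-- An accepting computation of the program yields a certificate that passes all tests. -/
theorem verifier_complete (hm : 0 < m)
    (hcard : Nat.card P.Node * (x.length + 2) ^ k ≤ (x.length + 2) ^ m) {v : Fin k → ℕ}
    (hx : P.Reach x (P.start, fun _ => 0) (P.final, v)) :
    ∃ y : ℕ → (P.verifier m sel).Comm, ∀ c : List α → ℕ → (P.verifier m sel).Comm, c x = y →
      ∀ (ω : ℕ → Bool) (τ), sel (fun i => ω i) = some τ →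
        ∃ t, ((P.verifier m sel).run (.ofSequence c) x ω t).state = .accept := by
  have := P.finNode
  have := Fintype.ofFinite P.Node
  -- A shortest run is shorter than the number of configurations, so by `hcard` the clock can count
  -- all its steps.
  obtain ⟨n, F, hn, hF0, hFn, hF⟩ := exists_short_path hx
    (fun y : P.Node × (Fin k → Fin (x.length + 2)) => (y.1, fun i => ((y.2 i : Fin _) : ℕ)))
    (fun b hb => by
      have h1 := HeadProgram.Reach.headsOn hb fun _ => Nat.zero_le _
      exact ⟨(b.1, fun i => ⟨b.2 i, Nat.lt_succ_of_le (h1 i)⟩), rfl⟩)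
  rw [Fintype.card_prod, Fintype.card_fun, Fintype.card_fin, Fintype.card_fin,
    ← Nat.card_eq_fintype_card] at hn
  obtain ⟨a, clk, ha0, ha⟩ := exists_clock x.length m hm
  choose i op p' hedge hexec hupd using hF
  let l : ∀ t, t < n → P.Letter m := fun t ht => ⟨(F t).1, i t ht, op t ht, (F (t + 1)).1, clk t⟩
  refine ⟨fun t => if ht : t < n then some (some (l t ht)) else none, fun c hc ω τ hω => ?_⟩
  have key : ∀ t ≤ n, (∃ t, ((P.verifier m sel).run (.ofSequence c) x ω t).state = .accept) ∨
      ∃ f p h, (P.verifier m sel).run (.ofSequence c) x ω (r + 1 + t) =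
        testConfig τ (F t).1 f p h ∧ h.length = t ∧ TestOK m x τ f (F t).2 (a t) p := by
    intro t ht
    induction t with
    | zero =>
      refine .inr ⟨(false, true), 0, [], ?_, rfl, ?_⟩
      · rw [add_zero, run_select, hω, hF0]
      · rw [hF0, show a 0 = fun _ => 0 from funext ha0]
        exact testOK_init τ
    | succ t ih =>
      rcases ih (by omega) with h | ⟨f, p, h, hrun, hlen, hok⟩
      · exact .inl h
      -- The run may pass through the final node with other head positions before its end; the
      -- verifier then accepts early.
      · by_cases hq : (F t).1 = P.final
        · refine .inl ⟨r + 1 + t + 1, ?_⟩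
          rw [Verifier.run_succ, hrun, hq]
          exact step_testConfig_final c ω τ f p h
        · right
          obtain ⟨f', d, p'', h1, h2, h3⟩ := testStep_complete (l := l t ht) hok
            (hexec t (by omega)) (ha t (by omega))
          obtain ⟨y, hy⟩ := step_testConfig_some c ω hq
            (testMove_eq_some.2 ⟨l t ht, by rw [hlen, hc]; exact dif_pos ht, rfl, hedge t ht, rfl, h1⟩) h2
          refine ⟨f', p'', h ++ [y], ?_, by simp [hlen], ?_⟩
          · rw [← add_assoc, Verifier.run_succ, hrun, hy]
          · rw [hupd t (by omega)]
            exact h3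
  rcases key n le_rfl with h | ⟨f, p, h, hrun, -, -⟩
  · exact h
  · refine ⟨r + 1 + n + 1, ?_⟩
    rw [Verifier.run_succ, hrun, hFn]
    exact step_testConfig_final c ω τ f p h

end HeadProgram

/-- Members are accepted by every outcome that selects a test. Non-members are rejected by the
outcomes that reject outright and by those that select a test which the certificate fails. Either
way these are at least `2 ^ r + 1` of `2 ^ (r + 1)` outcomes, so the error is `1/2 - 1/2 ^ (r + 1)`.
-/
theorem headLanguages_subset_onewayIP (α : Type) [Finite α] :
    HeadLanguages α ⊆ onewayIP α consBound consBound := by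
  rintro L ⟨k, P, hL⟩
  classical
  have hfin := P.finNode
  -- A crude choice that covers all configurations: the base `x.length + 2` is at least 2, so its
  -- power `Nat.card P.Node + 1` exceeds the number of nodes.
  let m := k + Nat.card P.Node + 1
  have hm : 0 < m := Nat.succ_pos _
  have hcard : ∀ x : List α, Nat.card P.Node * (x.length + 2) ^ k ≤ (x.length + 2) ^ m := by
    intro x
    have h1 : Nat.card P.Node ≤ (x.length + 2) ^ (Nat.card P.Node + 1) :=
      (Nat.lt_two_pow_self.le.trans (Nat.pow_le_pow_left (by omega) _)).trans
        (Nat.pow_le_pow_right (by omega) (Nat.le_succ _))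
    calc _ ≤ (x.length + 2) ^ (Nat.card P.Node + 1) * (x.length + 2) ^ k :=
          Nat.mul_le_mul_right _ h1
      _ = _ := by rw [← pow_add]; congr 1; simp only [m]; omega
  have : Nonempty (Fin k ⊕ Fin m) := ⟨.inr ⟨0, hm⟩⟩
  obtain ⟨r, sel, hsel1, hsel2⟩ := exists_selection (Fin k ⊕ Fin m)
  let V := P.verifier m sel
  have hres : V.Restricted (onewayProvers α V.Comm) consBound consBound :=
    HeadProgram.verifier_restricted _
  have hcoins : ∀ Q x ω t, (V.run Q x ω t).coins ≤ r + 1 := fun Q x ω t =>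
    (HeadProgram.verifierInv_run Q ω t).2.1
  have hext : ∀ u : Fin (r + 1) → Bool, (fun i : Fin (r + 1) => extendCoins u i) = u := by
    intro u
    funext i
    exact dif_pos i.2
  have h2r : (0 : ℝ) < 2 ^ (r + 1) := by positivity
  have hprob : ∀ (A B : Set (Fin (r + 1) → Bool)), A ⊆ B → 2 ^ r + 1 ≤ A.ncard →
      ((2 : ℝ) ^ r + 1) / 2 ^ (r + 1) ≤ (B.ncard : ℝ) / 2 ^ (r + 1) := by
    intro A B hAB hA
    refine div_le_div_of_nonneg_right ?_ h2r.le
    exact_mod_cast hA.trans (Set.ncard_le_ncard hAB)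
  have hcert : ∀ x, ∃ y : ℕ → V.Comm, x ∈ L → ∀ c : List α → ℕ → V.Comm, c x = y →
      ∀ (ω : ℕ → Bool) (τ), sel (fun i => ω i) = some τ →
        ∃ t, (V.run (.ofSequence c) x ω t).state = .accept := by
    intro x
    by_cases hx : x ∈ L
    · obtain ⟨v, hv⟩ := (hL x).1 hx
      obtain ⟨y, hy⟩ := HeadProgram.verifier_complete (sel := sel) hm (hcard x) hv
      exact ⟨y, fun _ => hy⟩
    · exact ⟨fun _ => none, fun h => (hx h).elim⟩
  choose c hc using hcert
  refine ⟨V, hres, 1 - ((2 : ℝ) ^ r + 1) / 2 ^ (r + 1), ?_, ⟨.ofSequence c, ⟨c, rfl⟩, fun x hx => ?_⟩,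
    fun x hx Q hQ => ?_⟩
  · have : (1 : ℝ) / 2 < ((2 : ℝ) ^ r + 1) / 2 ^ (r + 1) := by
      rw [lt_div_iff₀ h2r, pow_succ]
      linarith
    linarith
  · rw [Verifier.acceptProb, V.probability_eq (hcoins _ x), sub_sub_cancel]
    refine hprob _ _ ?_ hsel1
    rintro u ⟨τ, hτ⟩
    exact hc x hx c rfl (extendCoins u) τ (by rw [hext, hτ])
  · obtain ⟨c, rfl⟩ := hQ
    rw [Verifier.rejectProb, V.probability_eq (hcoins _ x), sub_sub_cancel]
    obtain ⟨τ, hτ⟩ := HeadProgram.verifier_sound (sel := sel) hm c (x := x) fun v hv =>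
      hx ((hL x).2 ⟨v, hv⟩)
    refine hprob _ _ ?_ (hsel2 τ)
    rintro u (hu | hu)
    · refine ⟨r + 1, ?_⟩
      rw [HeadProgram.run_select, hext, hu]
    · exact hτ (extendCoins u) (by rw [hext, hu])


/-! ### Binary counters on a tape -/

/-- The value of a list of binary digits, least significant digit first. -/
def bitValue : List Bool → ℕ
  | [] => 0
  | b :: l => b.toNat + 2 * bitValue l

theorem bitValue_append (l₁ l₂ : List Bool) :
    bitValue (l₁ ++ l₂) = bitValue l₁ + 2 ^ l₁.length * bitValue l₂ := by
  induction l₁ with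
  | nil => simp [bitValue]
  | cons b l₁ ih => simp only [List.cons_append, bitValue, ih, List.length_cons, pow_succ]; ring

theorem inputSymbol_append {β : Type} (l₁ l₂ : List β) :
    inputSymbol (l₁ ++ l₂) ((l₁.length + 1 : ℕ) : ℤ) = l₂.head? := by
  rw [inputSymbol, if_neg (by omega)]
  simp [List.getElem?_append_right, List.head?_eq_getElem?]

theorem inputSymbol_nil {β : Type} : inputSymbol ([] : List β) = fun _ => none := by
  funext z
  simp [inputSymbol]

/-- A counter tape is described by `inputSymbol l`: a blank at 0, the digits from cell 1 on, blanks
beyond. Writing on the first blank after the digits appends a digit; this is the case of empty `l₂`,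
whose tail is empty. -/
theorem update_inputSymbol {β : Type} (l₁ l₂ : List β) (b : β) :
    Function.update (inputSymbol (l₁ ++ l₂)) ((l₁.length + 1 : ℕ) : ℤ) (some b) =
      inputSymbol (l₁ ++ b :: l₂.tail) := by
  funext z
  by_cases hz : z = ((l₁.length + 1 : ℕ) : ℤ)
  · subst hz
    rw [Function.update_self, inputSymbol_append, List.head?_cons]
  · rw [Function.update_of_ne hz]
    unfold inputSymbol
    split_ifs with h
    · rfl
    · rcases lt_or_ge (z.toNat - 1) l₁.length with h1 | h1
      · rw [List.getElem?_append_left h1, List.getElem?_append_left h1]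
      · rw [List.getElem?_append_right h1, List.getElem?_append_right h1]
        obtain ⟨m, hm⟩ : ∃ m, z.toNat - 1 - l₁.length = m + 1 := ⟨z.toNat - 1 - l₁.length - 1, by omega⟩
        rw [hm]
        cases l₂ <;> simp

/-- The stages of the simulation of an operation on a head whose position is held by a binary
counter: its value is moved from the counter to the input head, the operation is applied, and
the position of the input head is moved back to the counter. -/
inductive CounterStage : Type
  | fetch | dec | decBack | zero | zeroBack | oper | store | inc | incBack

instance : Finite CounterStage :=
  .of_surjective ![.fetch, .dec, .decBack, .zero, .zeroBack, .oper, .store, .inc, .incBack] fun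
    | .fetch => ⟨0, rfl⟩
    | .dec => ⟨1, rfl⟩
    | .decBack => ⟨2, rfl⟩
    | .zero => ⟨3, rfl⟩
    | .zeroBack => ⟨4, rfl⟩
    | .oper => ⟨5, rfl⟩
    | .store => ⟨6, rfl⟩
    | .inc => ⟨7, rfl⟩
    | .incBack => ⟨8, rfl⟩

/-- The moves of the simulation of `op`: stage and flag, scanned symbols, new stage and flag
(`none` at the end), written symbol, movement of the input head and of the work head. -/
inductive CounterMove {α : Type} (op : HeadOp α) : CounterStage → Bool → Option α → Option Bool →
    Option (CounterStage × Bool) → Option Bool → SignType → SignType → Prop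
  | fetch_dec b o : CounterMove op .fetch b o none (some (.dec, b)) none 0 1
  | fetch_zero b o : CounterMove op .fetch b o none (some (.zero, b)) none 0 1
  | dec_false b o : CounterMove op .dec b o (some false) (some (.dec, b)) (some true) 0 1
  | dec_true b o : CounterMove op .dec b o (some true) (some (.decBack, b)) (some false) 0 (-1)
  | decBack_some b o a : CounterMove op .decBack b o (some a) (some (.decBack, b)) (some a) 0 (-1)
  | decBack_none b o : CounterMove op .decBack b o none (some (.fetch, true)) none 1 0
  | zero_false b o : CounterMove op .zero b o (some false) (some (.zero, b)) (some false) 0 1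
  | zero_none b o : CounterMove op .zero b o none (some (.zeroBack, b)) none 0 (-1)
  | zeroBack_some b o a :
      CounterMove op .zeroBack b o (some a) (some (.zeroBack, b)) (some a) 0 (-1)
  | zeroBack_none b o : CounterMove op .zeroBack b o none (some (.oper, b)) none 0 0
  | oper b o c d : op.flagStep b o = some (c, d) →
      CounterMove op .oper b o none (some (.store, c)) none d 0
  | leave : CounterMove op .store false none none none none 0 0
  | store_inc b o : ¬ (o = none ∧ b = false) →
      CounterMove op .store b o none (some (.inc, b)) none 0 1
  | inc_true b o : CounterMove op .inc b o (some true) (some (.inc, b)) (some false) 0 1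
  | inc_end b o a : a ≠ some true →
      CounterMove op .inc b o a (some (.incBack, b)) (some true) 0 (-1)
  | incBack_some b o a : CounterMove op .incBack b o (some a) (some (.incBack, b)) (some a) 0 (-1)
  | incBack_none b o : CounterMove op .incBack b o none (some (.store, false)) none (-1) 0

/-- The state of affairs in each stage, for a head that is at position `u` before the operation:
`p` is the position of the input head, `l` the digits of the counter and `z` the position of the
work head. -/
def CounterInv {α : Type} (x : List α) (op : HeadOp α) (u : ℕ) (p : ℕ) (l : List Bool) (z : ℕ) :
    CounterStage → Bool → Prop
  | .fetch, b => (b = true ↔ 1 ≤ p) ∧ z = 0 ∧ bitValue l + p = u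
  | .dec, b => (b = true ↔ 1 ≤ p) ∧ ∃ l₁ l₂, l = l₁ ++ l₂ ∧ z = l₁.length + 1 ∧
      bitValue l + p + 1 = u + 2 ^ l₁.length ∧ p ≤ u
  | .decBack, b => (b = true ↔ 1 ≤ p) ∧ z ≤ l.length ∧ bitValue l + p + 1 = u
  | .zero, b => (b = true ↔ 1 ≤ p) ∧ ∃ l₁ l₂, l = l₁ ++ l₂ ∧ z = l₁.length + 1 ∧
      bitValue l₁ = 0 ∧ bitValue l + p = u
  | .zeroBack, b => (b = true ↔ 1 ≤ p) ∧ z ≤ l.length ∧ bitValue l = 0 ∧ p = u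
  | .oper, b => (b = true ↔ 1 ≤ p) ∧ z = 0 ∧ bitValue l = 0 ∧ p = u
  | .store, b => ∃ w, op.Exec x u w ∧ FlagOK x.length b p ∧ z = 0 ∧ bitValue l + p = w
  | .inc, _ => ∃ w, op.Exec x u w ∧ 1 ≤ p ∧ ∃ l₁ l₂, l = l₁ ++ l₂ ∧ z = l₁.length + 1 ∧
      bitValue l + 2 ^ l₁.length + p = w + 1
  | .incBack, _ => ∃ w, op.Exec x u w ∧ 1 ≤ p ∧ p ≤ x.length + 1 ∧ z ≤ l.length ∧
      bitValue l + p = w + 1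

/-- The state of affairs after a move. -/
def CounterResult {α : Type} (x : List α) (op : HeadOp α) (u : ℕ) (p : ℕ) (l : List Bool) (z : ℕ) :
    Option (CounterStage × Bool) → Prop
  | some (s, b) => CounterInv x op u p l z s b
  | none => p = 0 ∧ z = 0 ∧ op.Exec x u (bitValue l)

section Counter

variable {α : Type} {x : List α} {op : HeadOp α}

theorem CounterInv.bounds {u p z : ℕ} {l : List Bool} {s : CounterStage} {b : Bool}
    (h : CounterInv x op u p l z s b) (hu : u ≤ x.length + 1) :
    p ≤ x.length + 1 ∧ z ≤ l.length + 1 := by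
  cases s with
  | fetch => obtain ⟨-, h1, h2⟩ := h; omega
  | dec => obtain ⟨-, l₁, l₂, rfl, h1, h2, h3⟩ := h; simp; omega
  | decBack => obtain ⟨-, h1, h2⟩ := h; omega
  | zero => obtain ⟨-, l₁, l₂, rfl, h1, h2, h3⟩ := h; simp; omega
  | zeroBack => obtain ⟨-, h1, h2, h3⟩ := h; omega
  | oper => obtain ⟨-, h1, h2, h3⟩ := h; omega
  | store => obtain ⟨w, -, h1, h2, h3⟩ := h; exact ⟨h1.1, by omega⟩
  | inc =>
    obtain ⟨w, h0, -, l₁, l₂, rfl, h1, h2⟩ := h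
    have := h0.le hu
    have := Nat.one_le_two_pow (n := l₁.length)
    simp; omega
  | incBack => obtain ⟨w, -, -, h1, h2, -⟩ := h; omega

theorem eq_zero_of_inputSymbol_eq_none {β : Type} {l : List β} {z : ℕ} (hz : z ≤ l.length)
    (h : inputSymbol l z = none) : z = 0 := by
  rw [inputSymbol_eq_none (by omega)] at h
  omega

theorem one_le_of_inputSymbol_eq_some {β : Type} {l : List β} {z : ℕ} {b : β}
    (h : inputSymbol l z = some b) : 1 ≤ z := by
  rcases Nat.eq_zero_or_pos z with rfl | h1
  · simp [inputSymbol] at h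
  · exact h1

theorem flagOK_of_iff {n p : ℕ} {b : Bool} (hp : p ≤ n + 1) (hb : b = true ↔ 1 ≤ p) :
    FlagOK n b p := by
  refine ⟨hp, hb.1, fun h => ?_⟩
  have := hb.not.1 (by simp [h])
  omega

/-- The space bound concerns all computations, so the invariant has to survive wrong guesses as
well. A wrong choice between decrementing and testing for zero gets stuck at the end of the digits
or at a digit 1. -/
theorem CounterInv.move {u p z : ℕ} {l : List Bool} {s : CounterStage} {b : Bool}
    (h : CounterInv x op u p l z s b) (hu : u ≤ x.length + 1)
    (hl : l.length ≤ (x.length + 1).size) {t w d e}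
    (hm : CounterMove op s b (inputSymbol x p) (inputSymbol l z) t w d e) :
    ∃ (p' : ℕ) (l' : List Bool) (z' : ℕ), (p' : ℤ) = p + d ∧
      Function.update (inputSymbol l) z w = inputSymbol l' ∧ (z' : ℤ) = z + e ∧
      l'.length ≤ (x.length + 1).size ∧
      CounterResult x op u p' l' z' t := by
  have hsame : ∀ {a}, a = inputSymbol l z → Function.update (inputSymbol l) z a = inputSymbol l := by
    rintro _ rfl
    exact Function.update_eq_self _ _
  generalize ho : inputSymbol x p = o at hm
  generalize ha : inputSymbol l z = a at hm
  cases hm with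
  | fetch_dec =>
    obtain ⟨h0, rfl, h2⟩ := h
    exact ⟨p, l, 1, by simp, hsame ha.symm, by simp, hl, h0, [], l, rfl, rfl, by simp; omega,
      by omega⟩
  | fetch_zero =>
    obtain ⟨h0, rfl, h2⟩ := h
    exact ⟨p, l, 1, by simp, hsame ha.symm, by simp, hl, h0, [], l, rfl, rfl, rfl, h2⟩
  | dec_false =>
    obtain ⟨h0, l₁, l₂, rfl, rfl, h2, h3⟩ := h
    rw [inputSymbol_append] at ha
    obtain ⟨l₂, rfl⟩ : ∃ l, l₂ = false :: l := ⟨l₂.tail, by cases l₂ <;> simp_all⟩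
    refine ⟨p, l₁ ++ true :: l₂, l₁.length + 2, by simp, update_inputSymbol _ _ _, by simp; ring,
      by simpa using hl, h0, l₁ ++ [true], l₂, by simp, by simp, ?_, h3⟩
    simp only [bitValue_append, bitValue, List.length_append, List.length_cons, List.length_nil,
      Bool.toNat_true, Bool.toNat_false, pow_succ, mul_add, zero_add] at h2 ⊢
    linarith
  | dec_true =>
    obtain ⟨h0, l₁, l₂, rfl, rfl, h2, h3⟩ := h
    rw [inputSymbol_append] at ha
    obtain ⟨l₂, rfl⟩ : ∃ l, l₂ = true :: l := ⟨l₂.tail, by cases l₂ <;> simp_all⟩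
    refine ⟨p, l₁ ++ false :: l₂, l₁.length, by simp, update_inputSymbol _ _ _, by simp,
      by simpa using hl, h0, by simp, ?_⟩
    simp only [bitValue_append, bitValue, Bool.toNat_true, Bool.toNat_false, mul_add, zero_add] at h2 ⊢
    linarith
  | decBack_some =>
    obtain ⟨h0, h1, h2⟩ := h
    have := one_le_of_inputSymbol_eq_some ha
    exact ⟨p, l, z - 1, by simp, hsame ha.symm, by simp; omega, hl, h0, by omega, h2⟩
  | decBack_none =>
    obtain ⟨h0, h1, h2⟩ := h
    obtain rfl := eq_zero_of_inputSymbol_eq_none h1 ha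
    exact ⟨p + 1, l, 0, by simp, hsame ha.symm, by simp, hl, by simp, rfl, by omega⟩
  | zero_false =>
    obtain ⟨h0, l₁, l₂, rfl, rfl, h2, h3⟩ := h
    have ha' := ha
    rw [inputSymbol_append] at ha
    obtain ⟨l₂, rfl⟩ : ∃ l, l₂ = false :: l := ⟨l₂.tail, by cases l₂ <;> simp_all⟩
    exact ⟨p, l₁ ++ false :: l₂, l₁.length + 2, by simp, hsame ha'.symm, by simp; ring,
      hl, h0, l₁ ++ [false], l₂, by simp, by simp, by simp [bitValue_append, bitValue, h2], h3⟩
  | zero_none =>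
    obtain ⟨h0, l₁, l₂, rfl, rfl, h2, h3⟩ := h
    have ha' := ha
    rw [inputSymbol_append, List.head?_eq_none_iff] at ha
    subst ha
    rw [List.append_nil] at *
    exact ⟨p, l₁, l₁.length, by simp, hsame ha'.symm, by simp, hl, h0, le_rfl, h2, by omega⟩
  | zeroBack_some =>
    obtain ⟨h0, h1, h2⟩ := h
    have := one_le_of_inputSymbol_eq_some ha
    exact ⟨p, l, z - 1, by simp, hsame ha.symm, by simp; omega, hl, h0, by omega, h2⟩
  | zeroBack_none =>
    obtain ⟨h0, h1, h2⟩ := h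
    obtain rfl := eq_zero_of_inputSymbol_eq_none h1 ha
    exact ⟨p, l, 0, by simp, hsame ha.symm, by simp, hl, h0, rfl, h2⟩
  | oper _ _ c d hop =>
    obtain ⟨h0, rfl, h1, rfl⟩ := h
    subst ho
    obtain ⟨p', h2, h3, h4⟩ := HeadOp.flagStep_sound (flagOK_of_iff hu h0) hop
    exact ⟨p', l, 0, h3, hsame ha.symm, by simp, hl, p', h2, h4, rfl, by omega⟩
  | leave =>
    obtain ⟨w, h0, h1, rfl, h3⟩ := h
    obtain rfl := h1.isZero.1 ⟨ho, rfl⟩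
    exact ⟨0, l, 0, by simp, hsame ha.symm, by simp, hl, rfl, rfl, by rwa [← h3] at h0⟩
  | store_inc _ _ hne =>
    obtain ⟨w, h0, h1, rfl, h3⟩ := h
    subst ho
    rw [h1.isZero] at hne
    exact ⟨p, l, 1, by simp, hsame ha.symm, by simp, hl, w, h0, by omega, [], l, rfl, rfl,
      by simp; omega⟩
  | inc_true =>
    obtain ⟨w, h0, h1, l₁, l₂, rfl, rfl, h2⟩ := h
    rw [inputSymbol_append] at ha
    obtain ⟨l₂, rfl⟩ : ∃ l, l₂ = true :: l := ⟨l₂.tail, by cases l₂ <;> simp_all⟩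
    refine ⟨p, l₁ ++ false :: l₂, l₁.length + 2, by simp, update_inputSymbol _ _ _, by simp; ring,
      by simpa using hl, w, h0, h1, l₁ ++ [false], l₂, by simp, by simp, ?_⟩
    simp only [bitValue_append, bitValue, List.length_append, List.length_cons, List.length_nil,
      Bool.toNat_true, Bool.toNat_false, pow_succ, mul_add, zero_add] at h2 ⊢
    linarith
  | inc_end _ _ a hne =>
    obtain ⟨w, h0, h1, l₁, l₂, rfl, rfl, h2⟩ := h
    rw [inputSymbol_append] at ha
    have h3 := h0.le hu
    have h4 := Nat.one_le_two_pow (n := l₁.length)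
    -- A carry past `l₁` means that the counter has to hold `2 ^ l₁.length`, which is at most
    -- `x.length + 1` because `p ≥ 1`; so the counter never outgrows its bound.
    have h5 : l₁.length < (x.length + 1).size := Nat.lt_size.2 (by omega)
    refine ⟨p, l₁ ++ true :: l₂.tail, l₁.length, by simp, update_inputSymbol _ _ _, by simp, ?_,
      w, h0, h1, by omega, by simp, ?_⟩
    · simp only [List.length_append, List.length_cons, List.length_tail] at hl ⊢
      omega
    · have h6 : bitValue l₂ = 2 * bitValue l₂.tail := by
        rcases l₂ with _ | ⟨_ | _, l₂⟩ <;> simp_all [bitValue]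
      simp only [bitValue_append, bitValue, h6, Bool.toNat_true, mul_add] at h2 ⊢
      linarith
  | incBack_some =>
    obtain ⟨w, h0, h1, h2, h3, h4⟩ := h
    have := one_le_of_inputSymbol_eq_some ha
    exact ⟨p, l, z - 1, by simp, hsame ha.symm, by simp; omega, hl, w, h0, h1, h2, by omega, h4⟩
  | incBack_none =>
    obtain ⟨w, h0, h1, h2, h3, h4⟩ := h
    obtain rfl := eq_zero_of_inputSymbol_eq_none h3 ha
    exact ⟨p - 1, l, 0, by simp; omega, hsame ha.symm, by simp, hl, w, h0,
      ⟨by omega, by simp, fun _ => by omega⟩, rfl, by omega⟩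

/-- One step of the simulation of `op`: stage and flag, position of the input head, digits of the
counter, position of the work head. -/
def CounterStep (x : List α) (op : HeadOp α)
    (c c' : Option (CounterStage × Bool) × ℕ × List Bool × ℕ) : Prop :=
  ∃ s b w d e, c.1 = some (s, b) ∧
    CounterMove op s b (inputSymbol x c.2.1) (inputSymbol c.2.2.1 c.2.2.2) c'.1 w d e ∧
    (c'.2.1 : ℤ) = c.2.1 + d ∧
    Function.update (inputSymbol c.2.2.1) c.2.2.2 w = inputSymbol c'.2.2.1 ∧
    (c'.2.2.2 : ℤ) = c.2.2.2 + e

def CounterReach (x : List α) (op : HeadOp α) :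
    Option (CounterStage × Bool) × ℕ × List Bool × ℕ →
      Option (CounterStage × Bool) × ℕ × List Bool × ℕ → Prop :=
  Relation.ReflTransGen (CounterStep x op)

/-- A step that leaves the tape unchanged. -/
theorem CounterReach.of_keep {s b t d e} {p p' z z' : ℕ} {l : List Bool}
    (h : CounterMove op s b (inputSymbol x p) (inputSymbol l z) t (inputSymbol l z) d e)
    (hp : (p' : ℤ) = p + d) (hz : (z' : ℤ) = z + e) :
    CounterReach x op (some (s, b), p, l, z) (t, p', l, z') :=
  .single ⟨s, b, _, d, e, rfl, h, hp, Function.update_eq_self _ _, hz⟩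

/-- A step that rewrites a digit. -/
theorem CounterReach.of_write {s b t a d e} {p p' z' : ℕ} {l₁ l₂ : List Bool}
    (h : CounterMove op s b (inputSymbol x p) l₂.head? t (some a) d e)
    (hp : (p' : ℤ) = p + d) (hz : (z' : ℤ) = l₁.length + 1 + e) :
    CounterReach x op (some (s, b), p, l₁ ++ l₂, l₁.length + 1)
      (t, p', l₁ ++ a :: l₂.tail, z') :=
  .single ⟨s, b, _, d, e, rfl, by rwa [inputSymbol_append], hp, update_inputSymbol _ _ _,
    by push_cast; exact hz⟩

theorem CounterReach.back {s b} {p z : ℕ} {l : List Bool} (hz : z ≤ l.length)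
    (h : ∀ o a, CounterMove op s b o (some a) (some (s, b)) (some a) 0 (-1)) :
    CounterReach x op (some (s, b), p, l, z) (some (s, b), p, l, 0) := by
  induction z with
  | zero => exact .refl
  | succ z ih =>
    refine Relation.ReflTransGen.trans (of_keep (d := 0) (e := -1) ?_ (by simp) (by simp))
      (ih (by omega))
    cases ha : inputSymbol l ((z + 1 : ℕ) : ℤ) with
    | none => exact absurd (eq_zero_of_inputSymbol_eq_none hz ha) (by omega)
    | some a => exact h _ _

/-- Borrowing: the digits 0 passed on the way become 1, up to the first 1, which becomes 0. The
passed digits `l₁` are generalized in the induction. -/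
theorem CounterReach.dec {b} {p : ℕ} {l₁ l₂ : List Bool} (h : 1 ≤ bitValue l₂) :
    ∃ l₂', CounterReach x op (some (.dec, b), p, l₁ ++ l₂, l₁.length + 1)
      (some (.fetch, true), p + 1, l₁ ++ l₂', 0) ∧ bitValue l₂' + 1 = bitValue l₂ := by
  induction l₂ generalizing l₁ with
  | nil => simp [bitValue] at h
  | cons a l₂ ih =>
    cases a with
    | true =>
      refine ⟨false :: l₂, ?_, by simp [bitValue]; omega⟩
      refine (of_write (d := 0) (e := -1) (p' := p) (.dec_true _ _) (by simp)
        (z' := l₁.length) (by simp)).trans ?_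
      refine (back (by simp) fun o a => .decBack_some _ _ _).trans ?_
      exact of_keep (d := 1) (e := 0) (.decBack_none _ _) (by simp) (by simp)
    | false =>
      simp only [bitValue, Bool.toNat_false] at h
      obtain ⟨l₂', h1, h2⟩ := ih (l₁ := l₁ ++ [true]) (by omega)
      refine ⟨true :: l₂', ?_, by simp [bitValue]; omega⟩
      refine (of_write (d := 0) (e := 1) (p' := p) (.dec_false _ _) (by simp)
        (z' := l₁.length + 1 + 1) (by simp)).trans ?_
      simpa [CounterReach] using h1

theorem CounterReach.zero {b} {p : ℕ} {l₁ l₂ : List Bool} (h : bitValue l₂ = 0) :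
    CounterReach x op (some (.zero, b), p, l₁ ++ l₂, l₁.length + 1)
      (some (.oper, b), p, l₁ ++ l₂, 0) := by
  induction l₂ generalizing l₁ with
  | nil =>
    have h1 : inputSymbol (l₁ ++ []) ((l₁.length + 1 : ℕ) : ℤ) = none := by
      rw [inputSymbol_append, List.head?_nil]
    refine Relation.ReflTransGen.trans (of_keep (d := 0) (e := -1) (p' := p) (z' := l₁.length) (by
      rw [h1]; exact .zero_none _ _) (by simp) (by simp)) ?_
    refine (back (by simp) fun o a => .zeroBack_some _ _ _).trans ?_
    exact of_keep (d := 0) (e := 0) (.zeroBack_none _ _) (by simp) (by simp)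
  | cons a l₂ ih =>
    cases a with
    | true => simp [bitValue] at h
    | false =>
      have h1 := ih (l₁ := l₁ ++ [false]) (by simpa [bitValue] using h)
      refine (of_write (d := 0) (e := 1) (p' := p) (.zero_false _ _) (by simp)
        (z' := l₁.length + 1 + 1) (by simp)).trans ?_
      simpa [CounterReach] using h1

theorem CounterReach.inc {b} {p : ℕ} {l₁ l₂ : List Bool} :
    ∃ l₂', CounterReach x op (some (.inc, b), p + 1, l₁ ++ l₂, l₁.length + 1)
      (some (.store, false), p, l₁ ++ l₂', 0) ∧ bitValue l₂' = bitValue l₂ + 1 := by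
  induction l₂ generalizing l₁ with
  | nil =>
    refine ⟨[true], ?_, by simp [bitValue]⟩
    refine (of_write (d := 0) (e := -1) (p' := p + 1) (.inc_end _ _ _ (by simp)) (by simp)
      (z' := l₁.length) (by simp)).trans ?_
    refine (back (by simp) fun o a => .incBack_some _ _ _).trans ?_
    exact of_keep (d := -1) (e := 0) (.incBack_none _ _) (by simp) (by simp)
  | cons a l₂ ih =>
    cases a with
    | false =>
      refine ⟨true :: l₂, ?_, by simp [bitValue]; omega⟩
      refine (of_write (d := 0) (e := -1) (p' := p + 1) (.inc_end _ _ _ (by simp)) (by simp)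
        (z' := l₁.length) (by simp)).trans ?_
      refine (back (by simp) fun o a => .incBack_some _ _ _).trans ?_
      exact of_keep (d := -1) (e := 0) (.incBack_none _ _) (by simp) (by simp)
    | true =>
      obtain ⟨l₂', h1, h2⟩ := ih (l₁ := l₁ ++ [false])
      refine ⟨false :: l₂', ?_, by simp [bitValue]; omega⟩
      refine (of_write (d := 0) (e := 1) (p' := p + 1) (.inc_true _ _) (by simp)
        (z' := l₁.length + 1 + 1) (by simp)).trans ?_
      simpa [CounterReach] using h1

/-- The input head moves right once for each decrement, so the sum of its position and the counter
is constant. -/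
theorem CounterReach.fetch {b} {p : ℕ} {l : List Bool} (hb : b = true ↔ 1 ≤ p) :
    ∃ b' l', CounterReach x op (some (.fetch, b), p, l, 0)
      (some (.oper, b'), p + bitValue l, l', 0) ∧ bitValue l' = 0 ∧
      (b' = true ↔ 1 ≤ p + bitValue l) := by
  induction hv : bitValue l generalizing b p l with
  | zero =>
    refine ⟨b, l, ?_, hv, hb⟩
    refine (of_keep (d := 0) (e := 1) (p' := p) (z' := 1) (.fetch_zero _ _) (by simp) (by simp)).trans ?_
    exact zero (l₁ := []) hv
  | succ m ih =>
    obtain ⟨l₁, h1, h2⟩ := dec (x := x) (op := op) (b := b) (p := p) (l₁ := []) (l₂ := l) (by omega)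
    obtain ⟨b', l', h3, h4, h5⟩ := ih (b := true) (p := p + 1) (l := l₁) (by simp) (by omega)
    have e : p + (m + 1) = p + 1 + m := by omega
    refine ⟨b', l', ?_, h4, e ▸ h5⟩
    refine (of_keep (d := 0) (e := 1) (p' := p) (z' := 1) (.fetch_dec _ _) (by simp) (by simp)).trans ?_
    rw [e]
    exact Relation.ReflTransGen.trans h1 h3

/-- The input head returns to the left end-marker while the counter is incremented at each step.
After a step to the left the flag is `false`, which identifies that end-marker. -/
theorem CounterReach.store {b} {p : ℕ} {l : List Bool} (hb : FlagOK x.length b p) :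
    ∃ l', CounterReach x op (some (.store, b), p, l, 0) (none, 0, l', 0) ∧
      bitValue l' = bitValue l + p := by
  induction p generalizing b l with
  | zero =>
    refine ⟨l, of_keep (d := 0) (e := 0) ?_ (by simp) (by simp), rfl⟩
    obtain ⟨h1, h2⟩ := hb.isZero.2 rfl
    rw [h1, h2]
    exact .leave
  | succ p ih =>
    obtain ⟨l₁, h1, h2⟩ := inc (x := x) (op := op) (b := b) (p := p) (l₁ := []) (l₂ := l)
    obtain ⟨l', h3, h4⟩ := ih (b := false) (l := l₁)
      ⟨by have := hb.1; omega, by simp, fun _ => by have := hb.1; omega⟩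
    refine ⟨l', ?_, by omega⟩
    refine (of_keep (d := 0) (e := 1) (p' := p + 1) (z' := 1) (.store_inc _ _ ?_) (by simp) (by simp)).trans ?_
    · rw [hb.isZero]; omega
    · exact Relation.ReflTransGen.trans h1 h3

theorem CounterReach.of_exec {l : List Bool} {w : ℕ} (hl : bitValue l ≤ x.length + 1)
    (h : op.Exec x (bitValue l) w) :
    ∃ l', CounterReach x op (some (.fetch, false), 0, l, 0) (none, 0, l', 0) ∧ bitValue l' = w := by
  obtain ⟨b, l₁, h1, h2, h3⟩ := fetch (x := x) (op := op) (b := false) (p := 0) (l := l) (by simp)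
  rw [zero_add] at h1 h3
  obtain ⟨b', d, h4, h5, h6⟩ := HeadOp.flagStep_complete (flagOK_of_iff hl h3) h
  obtain ⟨l', h7, h8⟩ := store (x := x) (op := op) (b := b') (p := w) (l := l₁) h6
  refine ⟨l', h1.trans (.trans ?_ h7), by omega⟩
  exact of_keep (d := d) (e := 0) (.oper _ _ _ _ h4) h5 (by simp)

end Counter


/-! ### The Turing machine with head positions in binary -/

namespace HeadProgram

variable {α : Type} {k : ℕ} [Finite α] (P : HeadProgram α (Fin k))

/-- The states of the Turing machine: the nodes, and the stages of the simulation of the edges. -/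
abbrev CounterState : Type := P.Node ⊕ (Fin k × HeadOp α × P.Node) × CounterStage × Bool

/-- The state that follows a move in the simulation of an edge. -/
def counterTarget {P : HeadProgram α (Fin k)} (e : Fin k × HeadOp α × P.Node) :
    Option (CounterStage × Bool) → P.CounterState
  | some t => .inr (e, t)
  | none => .inl e.2.2

/-- The Turing machine that holds the positions of the heads in binary, on one tape each. -/
def toNTM : NTM α where
  State := P.CounterState
  Work := Option Bool
  finState := by
    have := P.finNode
    infer_instance
  finWork := inferInstance
  k := k
  start := .inl P.start
  accept := .inl P.final
  blank := none
  δ s o a :=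
    match s with
    | .inl q => {m | ∃ e : Fin k × HeadOp α × P.Node, P.edge q e.1 e.2.1 e.2.2 ∧
        m = (.inr (e, .fetch, false), a, 0, 0)}
    | .inr (e, s, b) => {m | ∃ t w d d', CounterMove e.2.1 s b o (a e.1) t w d d' ∧
        m = (counterTarget e t, Function.update a e.1 w, d, Pi.single e.1 d')}

variable {P} {x : List α}

def ntmConfig (s : P.CounterState) (p : ℤ) (W : Fin k → ℤ → Option Bool) (w : Fin k → ℤ) :
    P.toNTM.Config :=
  ⟨s, p, W, w⟩

/-- The configuration in which the tapes hold the counters `l` and all work heads are at the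
origin, except for the one on the tape `i`, which is at `z`. -/
def counterConfig (s : P.CounterState) (p : ℕ) (l : Fin k → List Bool) (i : Fin k) (z : ℕ) :
    P.toNTM.Config :=
  ntmConfig s p (fun j => inputSymbol (l j)) (Pi.single i (z : ℤ))

/-- The configuration in which the tapes hold the counters `l` and all heads are at the origin. -/
def restConfig (q : P.Node) (l : Fin k → List Bool) : P.toNTM.Config :=
  ntmConfig (.inl q) 0 (fun j => inputSymbol (l j)) 0

theorem counterConfig_zero (q : P.Node) (l : Fin k → List Bool) (i : Fin k) :
    counterConfig (.inl q) 0 l i 0 = restConfig q l := by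
  simp [counterConfig, restConfig]

theorem restConfig_step {q : P.Node} {l : Fin k → List Bool} {c : P.toNTM.Config} :
    P.toNTM.Step x (restConfig q l) c ↔ q ≠ P.final ∧ ∃ e : Fin k × HeadOp α × P.Node,
      P.edge q e.1 e.2.1 e.2.2 ∧ c = counterConfig (.inr (e, .fetch, false)) 0 l e.1 0 := by
  have key : ∀ e : Fin k × HeadOp α × P.Node,
      ntmConfig (P := P) (.inr (e, .fetch, false)) (0 + ((0 : SignType) : ℤ))
        (fun i => Function.update (inputSymbol (l i)) 0 (inputSymbol (l i) 0))
        (fun _ => 0 + ((0 : SignType) : ℤ)) =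
      counterConfig (.inr (e, .fetch, false)) 0 l e.1 0 := by
    intro e
    simp only [counterConfig, SignType.coe_zero, Function.update_eq_self, Nat.cast_zero,
      Pi.single_zero, add_zero]
    rfl
  constructor
  · rintro ⟨h1, _, ⟨e, he, rfl⟩, rfl⟩
    exact ⟨fun h => h1 (congrArg Sum.inl h), e, he, key e⟩
  · rintro ⟨h1, e, he, rfl⟩
    exact ⟨fun h => h1 (Sum.inl_injective h), _, ⟨e, he, rfl⟩, (key e).symm⟩

theorem counterConfig_step {e : Fin k × HeadOp α × P.Node} {s : CounterStage} {b : Bool} {p z : ℕ}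
    {l : Fin k → List Bool} {c : P.toNTM.Config} :
    P.toNTM.Step x (counterConfig (.inr (e, s, b)) p l e.1 z) c ↔ ∃ t w d d',
      CounterMove e.2.1 s b (inputSymbol x p) (inputSymbol (l e.1) z) t w d d' ∧
      c = ntmConfig (counterTarget e t) (p + (d : ℤ))
        (Function.update (fun j => inputSymbol (l j)) e.1
          (Function.update (inputSymbol (l e.1)) z w)) (Pi.single e.1 (z + (d' : ℤ))) := by
  have key : ∀ (t) (w : Option Bool) (d d' : SignType),
      ntmConfig (counterTarget e t) (p + (d : ℤ))
        (fun i => Function.update (inputSymbol (l i)) ((Pi.single e.1 (z : ℤ) : Fin k → ℤ) i)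
          (Function.update (fun i => inputSymbol (l i) ((Pi.single e.1 (z : ℤ) : Fin k → ℤ) i))
            e.1 w i))
        (fun i => (Pi.single e.1 (z : ℤ) : Fin k → ℤ) i +
          (((Pi.single e.1 d' : Fin k → SignType) i : SignType) : ℤ)) =
      ntmConfig (counterTarget e t) (p + (d : ℤ))
        (Function.update (fun j => inputSymbol (l j)) e.1
          (Function.update (inputSymbol (l e.1)) z w)) (Pi.single e.1 (z + (d' : ℤ))) := by
    intro t w d d'
    congr 1
    · funext i
      by_cases hi : i = e.1
      · subst hi; simp
      · simp [hi]
    · funext i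
      by_cases hi : i = e.1
      · subst hi; simp
      · simp [hi]
  have hread : (Pi.single e.1 (z : ℤ) : Fin k → ℤ) e.1 = z := Pi.single_eq_same _ _
  constructor
  · rintro ⟨h1, _, ⟨t, w, d, d', he, rfl⟩, rfl⟩
    exact ⟨t, w, d, d', hread ▸ he, key t w d d'⟩
  · rintro ⟨t, w, d, d', he, rfl⟩
    rw [← hread] at he
    exact ⟨nofun, _, ⟨t, w, d, d', he, rfl⟩, (key t w d d').symm⟩

theorem ntmConfig_eq_counterConfig {s : P.CounterState} {i : Fin k} {p z p' z' : ℕ}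
    {l : Fin k → List Bool} {l' : List Bool} {w : Option Bool} {d d' : SignType}
    (hp : (p' : ℤ) = p + d) (hl : Function.update (inputSymbol (l i)) z w = inputSymbol l')
    (hz : (z' : ℤ) = z + d') :
    ntmConfig s (p + (d : ℤ)) (Function.update (fun j => inputSymbol (l j)) i
        (Function.update (inputSymbol (l i)) z w)) (Pi.single i (z + (d' : ℤ))) =
      counterConfig s p' (Function.update l i l') i z' := by
  rw [counterConfig, ← hp, ← hz, hl]
  congr 1
  funext j
  by_cases hj : j = i
  · subst hj; simp
  · simp [hj]

theorem counterConfig_reach {e : Fin k × HeadOp α × P.Node} {t : CounterStage × Bool}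
    {l : Fin k → List Bool} {c : Option (CounterStage × Bool) × ℕ × List Bool × ℕ}
    (h : CounterReach x e.2.1 (some t, 0, l e.1, 0) c) :
    Relation.ReflTransGen (P.toNTM.Step x) (counterConfig (.inr (e, t)) 0 l e.1 0)
      (counterConfig (counterTarget e c.1) c.2.1 (Function.update l e.1 c.2.2.1) e.1 c.2.2.2) := by
  induction h with
  | refl => rw [Function.update_eq_self]; exact .refl
  | @tail c c' _ h ih =>
    refine ih.tail ?_
    obtain ⟨_, p, l₁, z⟩ := c
    obtain ⟨s, b, w, d, d', rfl, h1, h2, h3, h4⟩ := h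
    refine counterConfig_step.2 ⟨c'.1, w, d, d', by simpa using h1, ?_⟩
    rw [ntmConfig_eq_counterConfig h2 (l' := c'.2.2.1) (by rw [Function.update_self]; exact h3) h4,
      Function.update_idem]

theorem restConfig_reach {q q' : P.Node} {i : Fin k} {op : HeadOp α} {l : Fin k → List Bool}
    {w : ℕ} (hq : q ≠ P.final) (he : P.edge q i op q') (hl : bitValue (l i) ≤ x.length + 1)
    (h : op.Exec x (bitValue (l i)) w) : ∃ l',
      Relation.ReflTransGen (P.toNTM.Step x) (restConfig q l)
        (restConfig q' (Function.update l i l')) ∧ bitValue l' = w := by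
  obtain ⟨l', h1, h2⟩ := CounterReach.of_exec hl h
  refine ⟨l', ?_, h2⟩
  have h3 := counterConfig_reach (P := P) (e := (i, op, q')) (l := l) h1
  simp only [counterTarget, counterConfig_zero] at h3
  exact .head (restConfig_step.2 ⟨hq, _, he, rfl⟩) h3

theorem toNTM_init : P.toNTM.init = restConfig P.start fun _ => [] := by
  rw [restConfig, inputSymbol_nil]
  rfl

/-- The accepting state of the Turing machine halts, while a run of the program may continue through
its final node; hence the first alternative. -/
theorem toNTM_complete {a : P.Node × (Fin k → ℕ)} (h : P.Reach x (P.start, fun _ => 0) a) :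
    (∃ c, Relation.ReflTransGen (P.toNTM.Step x) P.toNTM.init c ∧ c.state = P.toNTM.accept) ∨
    ∃ l, Relation.ReflTransGen (P.toNTM.Step x) P.toNTM.init (restConfig a.1 l) ∧
      ∀ i, bitValue (l i) = a.2 i := by
  induction h with
  | refl => exact .inr ⟨fun _ => [], by rw [toNTM_init], fun _ => rfl⟩
  | @tail a b ha hb ih =>
    rcases ih with h | ⟨l, h1, h2⟩
    · exact .inl h
    · by_cases hq : a.1 = P.final
      · exact .inl ⟨_, h1, congrArg Sum.inl hq⟩
      · obtain ⟨i, op, w, he, hw, hb⟩ := hb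
        have hle := HeadProgram.Reach.headsOn ha (fun _ => Nat.zero_le _) i
        rw [← h2 i] at hw hle
        obtain ⟨l', h3, h4⟩ := restConfig_reach hq he hle hw
        refine .inr ⟨_, h1.trans h3, fun j => ?_⟩
        rw [hb]
        by_cases hj : j = i
        · subst hj; simpa using h4
        · simpa [hj] using h2 j

/-- The configurations that the machine can reach. -/
def NTMInv (x : List α) (c : P.toNTM.Config) : Prop :=
  ∃ (q : P.Node) (v : Fin k → ℕ) (l : Fin k → List Bool),
    P.Reach x (P.start, fun _ => 0) (q, v) ∧ (∀ i, (l i).length ≤ (x.length + 1).size) ∧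
    ((c = restConfig q l ∧ ∀ i, bitValue (l i) = v i) ∨
      ∃ e s b p z, P.edge q e.1 e.2.1 e.2.2 ∧ (∀ i, i ≠ e.1 → bitValue (l i) = v i) ∧
        c = counterConfig (.inr (e, s, b)) p l e.1 z ∧
        CounterInv x e.2.1 (v e.1) p (l e.1) z s b)

/-- During the simulation of an edge, only the counter of its head deviates from the valuation
before the edge. The valuation changes when the last stage is left, and by then the operation is
known to have been executed. -/
theorem NTMInv.step {c c' : P.toNTM.Config} (h : NTMInv x c) (hs : P.toNTM.Step x c c') :
    NTMInv x c' := by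
  obtain ⟨q, v, l, hr, hl, ⟨rfl, hv⟩ | ⟨e, s, b, p, z, he, hv, rfl, hi⟩⟩ := h
  · obtain ⟨-, e, he, rfl⟩ := restConfig_step.1 hs
    exact ⟨q, v, l, hr, hl, .inr ⟨e, _, _, _, _, he, fun i _ => hv i, rfl, by simp, rfl, by simp [hv]⟩⟩
  · obtain ⟨t, w, d, d', hm, rfl⟩ := counterConfig_step.1 hs
    obtain ⟨p', l', z', h1, h2, h3, h4, h5⟩ :=
      hi.move (HeadProgram.Reach.headsOn hr (fun _ => Nat.zero_le _) e.1) (hl e.1) hm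
    rw [ntmConfig_eq_counterConfig h1 h2 h3]
    have hl' : ∀ i, (Function.update l e.1 l' i).length ≤ (x.length + 1).size := by
      intro i
      by_cases hj : i = e.1
      · subst hj; simpa using h4
      · simpa [hj] using hl i
    cases t with
    | some t =>
      refine ⟨q, v, _, hr, hl', .inr ⟨e, t.1, t.2, p', z', he, fun i hj => ?_, rfl, ?_⟩⟩
      · simpa [hj] using hv i hj
      · rw [Function.update_self]
        exact h5
    | none =>
      obtain ⟨rfl, rfl, h6⟩ := h5
      refine ⟨e.2.2, Function.update v e.1 (bitValue l'), _, hr.tail ⟨_, _, _, he, h6, rfl⟩, hl',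
        .inl ⟨counterConfig_zero _ _ _, fun i => ?_⟩⟩
      by_cases hj : i = e.1
      · subst hj; simp
      · simpa [hj] using hv i hj

theorem NTMInv.of_reach {c : P.toNTM.Config}
    (h : Relation.ReflTransGen (P.toNTM.Step x) P.toNTM.init c) : NTMInv x c := by
  induction h with
  | refl => exact ⟨P.start, fun _ => 0, fun _ => [], .refl, fun _ => Nat.zero_le _,
      .inl ⟨toNTM_init, fun _ => rfl⟩⟩
  | tail _ hs ih => exact ih.step hs

theorem NTMInv.bounds {c : P.toNTM.Config} (h : NTMInv x c) :
    (0 ≤ c.inputPos ∧ c.inputPos ≤ (x.length : ℤ) + 1) ∧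
      ∀ i, 0 ≤ c.workPos i ∧ c.workPos i ≤ (x.length + 1).size + 1 := by
  obtain ⟨q, v, l, hr, hl, ⟨rfl, hv⟩ | ⟨e, s, b, p, z, he, hv, rfl, hi⟩⟩ := h
  · exact ⟨⟨le_rfl, Int.le_add_one (Int.natCast_nonneg _)⟩,
      fun _ => ⟨le_rfl, Int.le_add_one (Int.natCast_nonneg _)⟩⟩
  · have h1 := hi.bounds (HeadProgram.Reach.headsOn hr (fun _ => Nat.zero_le _) e.1)
    have h2 := hl e.1
    have h3 : ∀ i, 0 ≤ (Pi.single e.1 (z : ℤ) : Fin k → ℤ) i ∧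
        (Pi.single e.1 (z : ℤ) : Fin k → ℤ) i ≤ (x.length + 1).size + 1 := by
      intro i
      by_cases hj : i = e.1
      · subst hj; rw [Pi.single_eq_same]; omega
      · rw [Pi.single_eq_of_ne hj]; omega
    exact ⟨⟨Int.natCast_nonneg p, Int.ofNat_le.2 h1.1⟩, h3⟩

theorem toNTM_accepts_iff :
    P.toNTM.Accepts x ↔ ∃ v, P.Reach x (P.start, fun _ => 0) (P.final, v) := by
  constructor
  · rintro ⟨c, t, h1, h2⟩
    obtain ⟨q, v, l, hr, -, ⟨h3, -⟩ | ⟨e, s, b, p, z, -, -, h3, -⟩⟩ :=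
      NTMInv.of_reach (P.toNTM.reflTransGen_iff.2 ⟨c, t, h1, rfl⟩)
    · rw [h3] at h2
      obtain rfl : q = P.final := Sum.inl_injective h2
      exact ⟨v, hr⟩
    · rw [h3] at h2
      exact absurd h2 nofun
  · rintro ⟨v, h⟩
    have key : ∃ c, Relation.ReflTransGen (P.toNTM.Step x) P.toNTM.init c ∧
        c.state = P.toNTM.accept := by
      rcases toNTM_complete h with h1 | ⟨l, h1, -⟩
      · exact h1
      · exact ⟨_, h1, rfl⟩
    obtain ⟨d, h1, h2⟩ := key
    obtain ⟨c, t, h3, rfl⟩ := P.toNTM.reflTransGen_iff.1 h1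
    exact ⟨c, t, h3, h2⟩

end HeadProgram

/-! ### Logarithmic size of the counters, and the cycle of inclusions -/

theorem mul_size_mem_logBound (k : ℕ) : (fun n => k * ((n + 1).size + 2)) ∈ logBound := by
  have h1 : ∀ n : ℕ, 2 ≤ n → (((n + 1).size : ℕ) : ℝ) ≤ 4 / Real.log 2 * Real.log n := by
    intro n hn
    -- Once `Nat.log 2 n ≥ 1`, the summand 2 is absorbed by the factor 4.
    have h2 : (n + 1).size ≤ Nat.log 2 n + 2 := by
      rw [Nat.size_le]
      have := Nat.lt_pow_succ_log_self (b := 2) one_lt_two n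
      rw [pow_succ]
      have := Nat.one_le_two_pow (n := Nat.log 2 n + 1)
      omega
    have h3 : 1 ≤ Nat.log 2 n := Nat.log_pos one_lt_two hn
    have h4 : (((n + 1).size : ℕ) : ℝ) ≤ 4 * (Nat.log 2 n : ℝ) := by
      exact_mod_cast h2.trans (by omega)
    have h5 : (Nat.log 2 n : ℝ) ≤ Real.log n / Real.log 2 := Real.natLog_le_logb n 2
    calc _ ≤ 4 * (Real.log n / Real.log 2) := h4.trans (by linarith)
      _ = _ := by ring
  have h2 : (fun n : ℕ => (((n + 1).size : ℕ) : ℝ)) =O[atTop] fun n : ℕ => Real.log n := by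
    refine IsBigO.of_bound (4 / Real.log 2) ?_
    filter_upwards [eventually_ge_atTop 2] with n hn
    rw [Real.norm_natCast, Real.norm_of_nonneg (Real.log_natCast_nonneg n)]
    exact h1 n hn
  have h3 : (fun _ : ℕ => (2 : ℕ)) ∈ logBound :=
    consBound_subset_logBound (mem_consBound_iff.2 ⟨2, fun _ => le_rfl⟩)
  simp only [logBound, Set.mem_ofPred_eq] at h3 ⊢
  push_cast at h3 ⊢
  exact (h2.add h3).const_mul_left _

theorem headLanguages_subset_NL (α : Type) [Finite α] : HeadLanguages α ⊆ NL α := by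
  rintro L ⟨k, P, hL⟩
  have key : ∀ {x : List α} {c t}, P.toNTM.IsComputation x c t → ∀ i ≤ t, P.NTMInv x (c i) :=
    fun h i hi => .of_reach (P.toNTM.reflTransGen_iff.2 ⟨_, i, h.mono hi, rfl⟩)
  refine ⟨P.toNTM, fun x c t h => (key h t le_rfl).bounds.1,
    ⟨_, mul_size_mem_logBound k, fun x c t h => ?_⟩,
    fun x => (hL x).trans HeadProgram.toNTM_accepts_iff.symm⟩
  have h1 : ∀ j : Fin k, cellsVisited (fun i => (c i).workPos j) t ≤ (x.length + 1).size + 2 := by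
    intro j
    -- A work head uses the blank cell 0, the digits, and one cell beyond them: at most `size + 2`
    -- cells on each of the `k` tapes.
    have h2 : (Finset.range (t + 1)).image (fun i => (c i).workPos j) ⊆
        Finset.Icc 0 (((x.length + 1).size : ℤ) + 1) := by
      intro z hz
      obtain ⟨i, hi, rfl⟩ := Finset.mem_image.1 hz
      exact Finset.mem_Icc.2 ((key h i (by simpa [Nat.lt_succ_iff] using hi)).bounds.2 j)
    have h3 := Finset.card_le_card h2
    rw [Int.card_Icc] at h3
    unfold cellsVisited
    omega
  calc _ ≤ ∑ _ : Fin k, ((x.length + 1).size + 2) := Finset.sum_le_sum fun j _ => h1 j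
    _ = _ := by simp

theorem theorem3p5 (α : Type) [Finite α] :
    onewayIP α consBound consBound = NL α ∧ NL α = weakIP α logBound consBound := by
  have h1 : weakIP α logBound consBound ⊆ NL α :=
    (weakIP_subset_headLanguages α).trans (headLanguages_subset_NL α)
  have h2 : NL α ⊆ onewayIP α consBound consBound :=
    (NL_subset_headLanguages α).trans (headLanguages_subset_onewayIP α)
  have h3 := onewayIP_subset_weakIP α
  exact ⟨(h3.trans h1).antisymm h2, (h2.trans h3).antisymm h1⟩
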